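/- Let $d\ge 1$ be an integer, $0<s<1$, and let $\alpha>\frac{4s}{d}$, with moreover $\alpha<\frac{4s}{d-2s}$ if $d>2s$ (no upper bound on $\alpha$ if $d\le 2s$). Put $$s_c=\frac d2-\frac{2s}{\alpha},\qquad \alpha_c=\frac{2d}{d-2s_c}=\frac{d\alpha}{2s}.$$ For $\gamma\ge 0$ let $(-\Delta)^{\gamma}$ and $|\nabla|^\gamma=(-\Delta)^{\gamma/2}$ be the Fourier multipliers with symbols $|\xi|^{2\gamma}$ and $|\xi|^\gamma$ (for the convention $\hat f(\xi)=\int e^{-ix\cdot\xi}f(x)\,dx$), and let $\dot H^\gamma=\dot H^\gamma(\mathbb R^d;\mathbb C)$ be the homogeneous Sobolev space with norm $\|f\|_{\dot H^\gamma}=\||\nabla|^\gamma f\|_{L^2}$. (For $\gamma<\frac d2$ it is realized as the space of tempered distributions whose Fourier transform is a locally integrable function with $|\xi|^\gamma\hat f\in L^2$; for $\gamma\ge\frac d2$, $|\nabla|^\gamma f$ is understood modulo polynomials, that is, on Schwartz test functions whose Fourier transform vanishes to infinite order at $0$.) Define $$A_{\mathrm{GN}}=\sup_{0\ne f\in\dot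 H^{s_c}\cap\dot H^s}H(f),\quad H(f)=\frac{\|f\|_{L^{\alpha+2}}^{\alpha+2}}{\|f\|_{\dot H^{s_c}}^{\alpha}\|f\|_{\dot H^s}^2},\qquad B_{\mathrm{GN}}=\sup_{0\ne f\in L^{\alpha_c}\cap\dot H^s}K(f),\quad K(f)=\frac{\|f\|_{L^{\alpha+2}}^{\alpha+2}}{\|f\|_{L^{\alpha_c}}^{\alpha}\|f\|_{\dot H^s}^2},$$ i.e. $A_{\mathrm{GN}}$ and $B_{\mathrm{GN}}$ are the sharp constants in $\|f\|_{L^{\alpha+2}}^{\alpha+2}\le A_{\mathrm{GN}}\|f\|_{\dot H^{s_c}}^{\alpha}\|f\|_{\dot H^s}^2$ and $\|f\|_{L^{\alpha+2}}^{\alpha+2}\le B_{\mathrm{GN}}\|f\|_{L^{\alpha_c}}^{\alpha}\|f\|_{\dot H^s}^2$. Then: 1. The constant $A_{\mathrm{GN}}$ is finite and is attained at a function $0\neq U\in\dot H^{s_c}\cap\dot H^s$ of the form $U(x)=aQ(\lambda x+x_0)$ for some $a\in\mathbb C\setminus\{0\}$, $\lambda>0$ and $x_0\in\mathbb R^d$,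 where $Q\in\dot H^{s_c}\cap\dot H^s$ is a solution, in the sense of tempered distributions, of $$(-\Delta)^sQ+(-\Delta)^{s_c}Q-|Q|^\alpha Q=0.$$ Moreover, $A_{\mathrm{GN}}=\frac{\alpha+2}{2}\|Q\|_{\dot H^{s_c}}^{-\alpha}$. 2. The constant $B_{\mathrm{GN}}$ is finite and is attained at a function $0\ne V\in L^{\alpha_c}\cap\dot H^s$ of the form $V(x)=bR(\mu x+y_0)$ for some $b\in\mathbb C\setminus\{0\}$, $\mu>0$ and $y_0\in\mathbb R^d$, where $R\in L^{\alpha_c}\cap\dot H^s$ is a solution, in the sense of tempered distributions, of $$(-\Delta)^sR+|R|^{\alpha_c-2}R-|R|^\alpha R=0.$$ Moreover, $B_{\mathrm{GN}}=\frac{\alpha+2}{2}\|R\|_{L^{\alpha_c}}^{-\alpha}$. -/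

import Mathlib

open MeasureTheory
open scoped SchwartzMap FourierTransform ENNReal

noncomputable section

/-- The critical Sobolev exponent `s_c = d/2 - 2s/α`. -/
def critSobolev (d : ℕ) (s α : ℝ) : ℝ := (d : ℝ) / 2 - 2 * s / α

/-- The critical Lebesgue exponent `α_c = 2d / (d - 2 s_c)`. -/
def critLebesgue (d : ℕ) (s α : ℝ) : ℝ :=
  2 * (d : ℝ) / ((d : ℝ) - 2 * critSobolev d s α)

/-- `f` is a measurable function of at most polynomial growth in the mean, so that
`φ ↦ ∫ f φ` is a tempered distribution. -/
def IsTemperedFun {d : ℕ} (f : EuclideanSpace ℝ (Fin d) → ℂ) : Prop :=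
  ∃ k : ℕ, Integrable (fun x => f x / (((1 + ‖x‖) ^ k : ℝ) : ℂ)) volume

/-- The symbol of `|∇|^γ = (-Δ)^(γ/2)`. With the normalisation `𝓕 f ξ = ∫ exp(-2πi x·ξ) f x dx`
the operator `-Δ` is the Fourier multiplier by `(2π|ξ|)^2`. -/
def symb {d : ℕ} (γ : ℝ) (ξ : EuclideanSpace ℝ (Fin d)) : ℝ := (2 * Real.pi * ‖ξ‖) ^ γ

/-- `h` is the Fourier transform of the tempered function `f`, and `|∇|^γ f ∈ L²`, that is
`(2π|ξ|)^γ h ∈ L²`.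

If `γ < d/2`, then `h` is locally integrable and `𝓕 f = h` is required in the sense of tempered
distributions. If `γ ≥ d/2`, the closure of the Schwartz functions whose Fourier transform vanishes
to infinite order at `0` consists of classes modulo polynomials, and `𝓕 f = h` is required against
the Schwartz functions which vanish to infinite order at `0`.

In both cases `h` is unique up to a null set. -/
def IsFourierDensity {d : ℕ} (γ : ℝ) (f h : EuclideanSpace ℝ (Fin d) → ℂ) : Prop :=
  AEStronglyMeasurable h volume ∧
  MemLp (fun ξ => (symb γ ξ : ℂ) * h ξ) 2 volume ∧
  ∀ φ : 𝓢(EuclideanSpace ℝ (Fin d), ℂ),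
    (γ < (d : ℝ) / 2 ∨ ∀ n : ℕ, iteratedFDeriv ℝ n (fun ξ => φ ξ) 0 = 0) →
      ∫ x, f x * (𝓕 φ) x = ∫ ξ, h ξ * φ ξ

/-- The homogeneous Sobolev space `Ḣ^γ` (for `γ ≥ 0`), as a set of functions. -/
def HomSobolev (d : ℕ) (γ : ℝ) : Set (EuclideanSpace ℝ (Fin d) → ℂ) :=
  {f | IsTemperedFun f ∧ ∃ h, IsFourierDensity γ f h}

open Classical in
/-- The Fourier transform of `f ∈ Ḣ^γ`, as a function defined almost everywhere. -/
def fourierDensity {d : ℕ} (γ : ℝ) (f : EuclideanSpace ℝ (Fin d) → ℂ) :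
    EuclideanSpace ℝ (Fin d) → ℂ :=
  if h : ∃ g, IsFourierDensity γ f g then h.choose else 0

theorem fourierDensity_spec {d : ℕ} {γ : ℝ} {f : EuclideanSpace ℝ (Fin d) → ℂ}
    (hf : f ∈ HomSobolev d γ) : IsFourierDensity γ f (fourierDensity γ f) := by
  have h := hf.2
  unfold fourierDensity
  rw [dif_pos h]
  exact h.choose_spec

/-- The norm `‖f‖_{Ḣ^γ} = ‖|∇|^γ f‖_{L²}` of `f ∈ Ḣ^γ`, computed through the Plancherel formula. -/
def homSobolevNorm {d : ℕ} (γ : ℝ) (f : EuclideanSpace ℝ (Fin d) → ℂ) : ℝ≥0∞ :=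
  eLpNorm (fun ξ => (symb γ ξ : ℂ) * fourierDensity γ f ξ) 2 volume

/-- The fractional Laplacian `(-Δ)^γ f` of `f ∈ Ḣ^γ` (for `γ ≥ 0`), the Fourier multiplier by
`(2π|ξ|)^(2γ)`, as a tempered distribution:
`⟨(-Δ)^γ f, φ⟩ = ∫ (2π|ξ|)^(2γ) (𝓕 f)(ξ) (𝓕⁻ φ)(ξ) dξ`. -/
def fracLaplacian {d : ℕ} (γ : ℝ) (f : EuclideanSpace ℝ (Fin d) → ℂ)
    (φ : 𝓢(EuclideanSpace ℝ (Fin d), ℂ)) : ℂ :=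
  ∫ ξ, (symb (2 * γ) ξ : ℂ) * fourierDensity γ f ξ * (𝓕⁻ φ) ξ

/-- The `L^p` norm for a real exponent `p`. -/
def lebNorm {d : ℕ} (p : ℝ) (f : EuclideanSpace ℝ (Fin d) → ℂ) : ℝ≥0∞ :=
  eLpNorm f (ENNReal.ofReal p) volume

/-- The space `Ḣ^{s_c} ∩ Ḣ^s`. -/
def SobolevClass (d : ℕ) (s α : ℝ) : Set (EuclideanSpace ℝ (Fin d) → ℂ) :=
  HomSobolev d (critSobolev d s α) ∩ HomSobolev d s

/-- The space `L^{α_c} ∩ Ḣ^s`. -/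
def LebesgueClass (d : ℕ) (s α : ℝ) : Set (EuclideanSpace ℝ (Fin d) → ℂ) :=
  {f | MemLp f (ENNReal.ofReal (critLebesgue d s α)) volume} ∩ HomSobolev d s

/-- The functional `H(f) = ‖f‖_{L^{α+2}}^{α+2} / (‖f‖_{Ḣ^{s_c}}^α ‖f‖_{Ḣ^s}^2)`. -/
def quotientH {d : ℕ} (s α : ℝ) (f : EuclideanSpace ℝ (Fin d) → ℂ) : ℝ≥0∞ :=
  lebNorm (α + 2) f ^ (α + 2) /
    (homSobolevNorm (critSobolev d s α) f ^ α * homSobolevNorm s f ^ 2)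

/-- The functional `K(f) = ‖f‖_{L^{α+2}}^{α+2} / (‖f‖_{L^{α_c}}^α ‖f‖_{Ḣ^s}^2)`. -/
def quotientK {d : ℕ} (s α : ℝ) (f : EuclideanSpace ℝ (Fin d) → ℂ) : ℝ≥0∞ :=
  lebNorm (α + 2) f ^ (α + 2) /
    (lebNorm (critLebesgue d s α) f ^ α * homSobolevNorm s f ^ 2)

/-- The sharp constant `A_GN`: the supremum of `H` over the nonzero elements of `Ḣ^{s_c} ∩ Ḣ^s`. -/
def sharpA (d : ℕ) (s α : ℝ) : ℝ≥0∞ :=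
  sSup {r | ∃ f ∈ SobolevClass d s α, ¬ f =ᵐ[volume] 0 ∧ r = quotientH s α f}

/-- The sharp constant `B_GN`: the supremum of `K` over the nonzero elements of `L^{α_c} ∩ Ḣ^s`. -/
def sharpB (d : ℕ) (s α : ℝ) : ℝ≥0∞ :=
  sSup {r | ∃ f ∈ LebesgueClass d s α, ¬ f =ᵐ[volume] 0 ∧ r = quotientK s α f}

/-- `Q ∈ Ḣ^{s_c} ∩ Ḣ^s` solves `(-Δ)^s Q + (-Δ)^{s_c} Q - |Q|^α Q = 0` in the sense of tempered
distributions. -/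
def IsSobolevSolution {d : ℕ} (s α : ℝ) (Q : EuclideanSpace ℝ (Fin d) → ℂ) : Prop :=
  Q ∈ SobolevClass d s α ∧
  MemLp Q (ENNReal.ofReal (α + 2)) volume ∧
  ∀ φ : 𝓢(EuclideanSpace ℝ (Fin d), ℂ),
    fracLaplacian s Q φ + fracLaplacian (critSobolev d s α) Q φ
      - (∫ x, ((‖Q x‖ ^ α : ℝ) : ℂ) * Q x * φ x) = 0

/-- `R ∈ L^{α_c} ∩ Ḣ^s` solves `(-Δ)^s R + |R|^{α_c - 2} R - |R|^α R = 0` in the sense of tempered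
distributions. -/
def IsLebesgueSolution {d : ℕ} (s α : ℝ) (R : EuclideanSpace ℝ (Fin d) → ℂ) : Prop :=
  R ∈ LebesgueClass d s α ∧
  MemLp R (ENNReal.ofReal (α + 2)) volume ∧
  ∀ φ : 𝓢(EuclideanSpace ℝ (Fin d), ℂ),
    fracLaplacian s R φ
      + (∫ x, ((‖R x‖ ^ (critLebesgue d s α - 2) : ℝ) : ℂ) * R x * φ x)
      - (∫ x, ((‖R x‖ ^ α : ℝ) : ℂ) * R x * φ x) = 0

end

/-!
The two interpolation inequalities are treated at once. Write `J f = ‖f‖_{L^{α+2}}^{α+2}`,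
`N f = ‖f‖_{Ḣ^s}`, and let `E` be the norm of `Ḣ^{s_c}` or of `L^{α_c}`. Both norms `E` have the
same scaling and control the `L^{α_c}` norm (`CriticalFunctional`), so that `J / (E^α N²)` is
invariant under `f ↦ c f(l x + x₀)`.

*Finiteness.* Smooth frequency truncations `lowPass t f` split `f` into a part bounded by a power of
`t` and a remainder whose `L²` norm is a tail of the Fourier transform. Chebyshev's inequality and
the layer cake formula (`lintegral_rpow_le_of_decomposition`) turn this into the Gagliardo–Nirenberg
inequality `exists_gagliardoNirenberg` and the Sobolev embedding `exists_sobolev`, without any Besov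
or Lorentz space theory.

*Attainment.* Take a maximizing sequence with `E` and `N` normalized. The same layer cake argument,
with a smaller power of `t`, shows that the high frequencies contribute little to `J`, so some low
frequency part is bounded below at some point (`exists_lowPass_ge`); translating that point to the
origin gives a nonzero weak limit `Q`. By `exists_subseq_tendsto_ae` the convergence is also almost
everywhere, so `E^q`, `N²` and `J` split between `Q` and the remainder: for Hilbert norms by weak
convergence, for Lebesgue norms by the Brezis–Lieb lemma `brezis_lieb`. Since
`a^θ b + (e - a)^θ (m - b) < e^θ m` for a nontrivial splitting (`eq_of_rpow_mul_split`), nothing is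
lost and `Q` is a maximizer (`CriticalFunctional.exists_maximizer`).

*The equation.* The values of `E Q` and `N Q` may be prescribed. For the right choice
(`exists_normalization`) the first variation of `A E^α N² - J ≥ 0` at `Q` is the equation with unit
coefficients (`CriticalFunctional.first_variation`), and the sharp constant is
`(α + 2) / 2 * (E Q) ^ (-α)`. So the maximizer itself solves the equation.
-/

open MeasureTheory Filter Set
open scoped SchwartzMap FourierTransform ENNReal Topology ContDiff RealInnerProductSpace

/-! ### Symbols, tempered functions and admissible test functions -/

section Basics

variable {d : ℕ}

local notation "𝔼" => EuclideanSpace ℝ (Fin d)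

theorem symb_nonneg (γ : ℝ) (ξ : 𝔼) : 0 ≤ symb γ ξ := by
  unfold symb; positivity

theorem symb_pos (γ : ℝ) {ξ : 𝔼} (h : ξ ≠ 0) : 0 < symb γ ξ := by
  unfold symb
  have := norm_pos_iff.2 h
  positivity

theorem symb_two_mul (γ : ℝ) (ξ : 𝔼) : symb (2 * γ) ξ = symb γ ξ ^ 2 := by
  unfold symb
  rw [mul_comm 2 γ, Real.rpow_mul (by positivity), Real.rpow_two]

theorem symb_smul (γ : ℝ) {l : ℝ} (hl : 0 < l) (ξ : 𝔼) : symb γ (l • ξ) = l ^ γ * symb γ ξ := by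
  unfold symb
  rw [norm_smul, Real.norm_of_nonneg hl.le, ← Real.mul_rpow hl.le (by positivity)]
  congr 1; ring

theorem measurable_symb (γ : ℝ) : Measurable (symb γ : 𝔼 → ℝ) := by
  unfold symb; fun_prop

theorem ae_ne_zero (hd : 1 ≤ d) : ∀ᵐ ξ : 𝔼, ξ ≠ 0 := by
  have : Nonempty (Fin d) := ⟨⟨0, hd⟩⟩
  have : Nontrivial 𝔼 := inferInstance
  exact Measure.ae_ne volume 0

theorem IsTemperedFun.aestronglyMeasurable {f : 𝔼 → ℂ} (hf : IsTemperedFun f) :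
    AEStronglyMeasurable f volume := by
  obtain ⟨k, hk⟩ := hf
  have h2 : Continuous (fun x : 𝔼 => (((1 + ‖x‖) ^ k : ℝ) : ℂ)) := by fun_prop
  refine (hk.aestronglyMeasurable.mul h2.aestronglyMeasurable).congr (ae_of_all _ fun x => ?_)
  have : (((1 + ‖x‖) ^ k : ℝ) : ℂ) ≠ 0 := by
    have : 0 < (1 + ‖x‖) ^ k := by positivity
    exact_mod_cast this.ne'
  exact div_mul_cancel₀ _ this

/-- Schwartz functions decay faster than every power of `1 + |x|`. -/
theorem exists_schwartz_decay (φ : 𝓢(𝔼, ℂ)) (k : ℕ) :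
    ∃ C, 0 < C ∧ ∀ x, (1 + ‖x‖) ^ k * ‖φ x‖ ≤ C := by
  have h := φ.one_add_le_sup_seminorm_apply (𝕜 := ℝ) (m := (k, 0)) (k := k) (n := 0) le_rfl le_rfl
  simp only [norm_iteratedFDeriv_zero] at h
  exact ⟨max _ 1, lt_max_of_lt_right one_pos, fun x => (h x).trans (le_max_left _ _)⟩

theorem IsTemperedFun.mul_of_decay {f : 𝔼 → ℂ} (hf : IsTemperedFun f) {g : 𝔼 → ℂ}
    (hgm : AEStronglyMeasurable g volume) (hg : ∀ k : ℕ, ∃ C, ∀ x, (1 + ‖x‖) ^ k * ‖g x‖ ≤ C) :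
    Integrable (fun x => f x * g x) volume := by
  have hfm := hf.aestronglyMeasurable
  obtain ⟨k, hk⟩ := hf
  obtain ⟨C, hC⟩ := hg k
  refine Integrable.mono' (hk.norm.mul_const C) (hfm.mul hgm) (ae_of_all _ fun x => ?_)
  have h0 : 0 < (1 + ‖x‖) ^ k := by positivity
  rw [norm_mul, norm_div, Complex.norm_real, Real.norm_of_nonneg h0.le, div_mul_eq_mul_div,
    le_div_iff₀ h0, mul_assoc]
  gcongr
  rw [mul_comm]; exact hC x

theorem IsTemperedFun.integrable_mul {f : 𝔼 → ℂ} (hf : IsTemperedFun f) (φ : 𝓢(𝔼, ℂ)) :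
    Integrable (fun x => f x * φ x) volume :=
  hf.mul_of_decay φ.continuous.aestronglyMeasurable fun k =>
    (exists_schwartz_decay φ k).imp fun _ h => h.2

theorem isTemperedFun_of_integrable_pow {f : 𝔼 → ℂ} {k : ℕ}
    (hm : AEStronglyMeasurable f volume)
    (h : Integrable (fun x => ‖f x‖ / (1 + ‖x‖) ^ k) volume) : IsTemperedFun f := by
  refine ⟨k, h.mono' ?_ (ae_of_all _ fun x => ?_)⟩
  · exact hm.div₀ (by fun_prop)
  · rw [norm_div, Complex.norm_real, Real.norm_of_nonneg (by positivity)]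

theorem IsTemperedFun.add_smul {f g : 𝔼 → ℂ} (hf : IsTemperedFun f) (hg : IsTemperedFun g)
    (c : ℂ) : IsTemperedFun (fun x => f x + c * g x) := by
  have hfm := hf.aestronglyMeasurable
  have hgm := hg.aestronglyMeasurable
  obtain ⟨k, hk⟩ := hf
  obtain ⟨m, hm⟩ := hg
  refine isTemperedFun_of_integrable_pow (k := max k m) (hfm.add (hgm.const_mul c)) ?_
  refine (hk.norm.add (hm.norm.const_mul ‖c‖)).mono'
    (((hfm.add (hgm.const_mul c)).norm).div₀ (by fun_prop)) (ae_of_all _ fun x => ?_)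
  have h1 : (1 : ℝ) ≤ 1 + ‖x‖ := by linarith [norm_nonneg x]
  have hk' : (1 + ‖x‖) ^ k ≤ (1 + ‖x‖) ^ max k m := pow_le_pow_right₀ h1 (le_max_left _ _)
  have hm' : (1 + ‖x‖) ^ m ≤ (1 + ‖x‖) ^ max k m := pow_le_pow_right₀ h1 (le_max_right _ _)
  simp only [Pi.add_apply, norm_div, Complex.norm_real, norm_norm]
  rw [Real.norm_of_nonneg (by positivity : (0 : ℝ) ≤ (1 + ‖x‖) ^ k),
    Real.norm_of_nonneg (by positivity : (0 : ℝ) ≤ (1 + ‖x‖) ^ m),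
    Real.norm_of_nonneg (by positivity : (0 : ℝ) ≤ (1 + ‖x‖) ^ max k m)]
  calc _ ≤ (‖f x‖ + ‖c‖ * ‖g x‖) / (1 + ‖x‖) ^ max k m := by
        gcongr; exact (norm_add_le _ _).trans (by rw [norm_mul])
    _ = ‖f x‖ / (1 + ‖x‖) ^ max k m + ‖c‖ * (‖g x‖ / (1 + ‖x‖) ^ max k m) := by ring
    _ ≤ _ := by gcongr

/-- The test functions against which the Fourier transform of an element of `Ḣ^γ` is tested: all
Schwartz functions if `γ < d/2`, and those vanishing to infinite order at the origin otherwise. -/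
def Admissible (γ : ℝ) (φ : 𝓢(𝔼, ℂ)) : Prop :=
  γ < (d : ℝ) / 2 ∨ ∀ n : ℕ, iteratedFDeriv ℝ n (fun ξ => φ ξ) 0 = 0

theorem admissible_of_eventuallyEq_zero (γ : ℝ) {φ : 𝓢(𝔼, ℂ)} (h : ∀ᶠ ξ in 𝓝 0, φ ξ = 0) :
    Admissible γ φ := by
  right
  intro n
  have h' : (fun ξ => φ ξ) =ᶠ[𝓝 0] (fun _ => (0 : ℂ)) := h
  rw [h'.iteratedFDeriv ℝ n |>.eq_of_nhds]
  simp

theorem lipschitz_schwartz (φ : 𝓢(𝔼, ℂ)) : ∃ C, 0 ≤ C ∧ ∀ x, ‖φ x - φ 0‖ ≤ C * ‖x‖ := by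
  refine ⟨SchwartzMap.seminorm ℝ 0 1 φ, apply_nonneg _ _, fun x => ?_⟩
  have := Convex.norm_image_sub_le_of_norm_fderiv_le (𝕜 := ℝ) (f := φ) (s := univ) (x := 0) (y := x)
    (C := SchwartzMap.seminorm ℝ 0 1 φ) (fun x _ => φ.differentiableAt) (fun y _ => ?_)
    convex_univ (mem_univ _) (mem_univ _)
  · simpa using this
  · have := φ.norm_iteratedFDeriv_le_seminorm ℝ 1 y
    rwa [norm_iteratedFDeriv_one] at this

theorem integrableOn_ball_norm_rpow (hd : 1 ≤ d) {a : ℝ} (ha : a < d) (r : ℝ) :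
    IntegrableOn (fun ξ : 𝔼 => ‖ξ‖ ^ (-a)) (Metric.ball 0 r) volume := by
  refine integrableOn_ball_of_norm_le_rpow (α := a) (C := 1) (by simpa) (by simpa) ?_ ?_
  · refine ae_of_all _ fun x => ?_
    rw [one_mul, Real.norm_of_nonneg (by positivity)]
  · exact Measurable.aestronglyMeasurable (by fun_prop)

/-- For an admissible test function `φ`, the quotient `φ / (2π|ξ|)^γ` is square integrable. This
makes every pairing `∫ h φ` with a density `h` of an element of `Ḣ^γ` absolutely convergent. -/
theorem Admissible.memLp_div_symb (hd : 1 ≤ d) {γ : ℝ} (h0 : 0 ≤ γ) (h1 : γ < 1) {φ : 𝓢(𝔼, ℂ)}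
    (hφ : Admissible γ φ) : MemLp (fun ξ => φ ξ / (symb γ ξ : ℂ)) 2 volume := by
  have hm : AEStronglyMeasurable (fun ξ : 𝔼 => φ ξ / (symb γ ξ : ℂ)) volume :=
    φ.continuous.aestronglyMeasurable.div₀
      (Complex.measurable_ofReal.comp (measurable_symb γ)).aestronglyMeasurable
  -- Near the origin the quotient is at most `C |ξ|^(-a)` for some `a < d/2`: either `a = γ`, or
  -- `φ 0 = 0` makes `φ` of size `|ξ|`, and `a = 0` works because `γ < 1`.
  obtain ⟨a, ha, C, hC0, hC⟩ : ∃ a : ℝ, a < d / 2 ∧ ∃ C : ℝ, 0 ≤ C ∧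
      ∀ ξ ∈ Metric.ball (0 : 𝔼) 1, ‖φ ξ / (symb γ ξ : ℂ)‖ ≤ C * ‖ξ‖ ^ (-a) := by
    have hpi : (0 : ℝ) < 2 * Real.pi := by positivity
    rcases hφ with h | h
    · obtain ⟨C, hC, h2⟩ := exists_schwartz_decay φ 0
      refine ⟨γ, h, C / (2 * Real.pi) ^ γ, by positivity, fun ξ _ => ?_⟩
      rw [norm_div, Complex.norm_real, Real.norm_of_nonneg (symb_nonneg _ _), symb,
        Real.mul_rpow hpi.le (norm_nonneg _), Real.rpow_neg (norm_nonneg _)]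
      have := h2 ξ
      rw [pow_zero, one_mul] at this
      calc _ ≤ C / ((2 * Real.pi) ^ γ * ‖ξ‖ ^ γ) := by gcongr
        _ = _ := by field_simp
    · have h00 : φ 0 = 0 := by
        have := h 0
        have h3 := congrArg (fun L => L 0) this
        simpa using h3
      obtain ⟨C, hC, h2⟩ := lipschitz_schwartz φ
      refine ⟨0, by positivity, C / (2 * Real.pi) ^ γ, by positivity, fun ξ hξ => ?_⟩
      have hξ1 : ‖ξ‖ < 1 := by simpa using hξ
      rw [norm_div, Complex.norm_real, Real.norm_of_nonneg (symb_nonneg _ _), symb,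
        Real.mul_rpow hpi.le (norm_nonneg _), neg_zero, Real.rpow_zero, mul_one]
      have := h2 ξ
      rw [h00, sub_zero] at this
      rcases eq_or_ne ξ 0 with rfl | hne
      · simp [h00]; positivity
      have hp := norm_pos_iff.2 hne
      calc _ ≤ C * ‖ξ‖ / ((2 * Real.pi) ^ γ * ‖ξ‖ ^ γ) := by gcongr
        _ = C / (2 * Real.pi) ^ γ * (‖ξ‖ / ‖ξ‖ ^ γ) := by field_simp
        _ ≤ C / (2 * Real.pi) ^ γ * 1 := by
          gcongr
          rw [div_le_one (by positivity)]
          calc ‖ξ‖ = ‖ξ‖ ^ (1 : ℝ) := by simp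
            _ ≤ ‖ξ‖ ^ γ := Real.rpow_le_rpow_of_exponent_ge hp hξ1.le h1.le
        _ = _ := by ring
  have hB : MemLp ((Metric.ball (0 : 𝔼) 1).indicator fun ξ => C * ‖ξ‖ ^ (-a)) 2 volume := by
    rw [memLp_indicator_iff_restrict measurableSet_ball]
    refine (memLp_two_iff_integrable_sq (Measurable.aestronglyMeasurable (by fun_prop))).2 ?_
    have := (integrableOn_ball_norm_rpow (d := d) hd (a := 2 * a) (by linarith) 1).const_mul (C ^ 2)
    refine this.congr (ae_of_all _ fun ξ => ?_)
    simp only [mul_pow]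
    rw [← Real.rpow_natCast (‖ξ‖ ^ (-a)), ← Real.rpow_mul (norm_nonneg _)]
    congr 2; push_cast; ring
  have hS : MemLp (fun ξ => ‖φ ξ‖) 2 volume := (φ.memLp 2).norm
  refine (hB.add hS).mono hm (ae_of_all _ fun ξ => ?_)
  by_cases hξ : ξ ∈ Metric.ball (0 : 𝔼) 1
  · simp only [Pi.add_apply, indicator_of_mem hξ]
    rw [Real.norm_of_nonneg (by positivity)]
    exact (hC ξ hξ).trans (by linarith [norm_nonneg (φ ξ)])
  · simp only [Pi.add_apply, indicator_of_notMem hξ, zero_add, norm_norm]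
    rw [norm_div, Complex.norm_real, Real.norm_of_nonneg (symb_nonneg _ _)]
    have hξ' : 1 ≤ ‖ξ‖ := by simpa using hξ
    refine div_le_self (norm_nonneg _) (Real.one_le_rpow ?_ h0)
    nlinarith [Real.pi_gt_three]

end Basics

/-! ### Fourier densities and the homogeneous Sobolev norm -/

section Densities

variable {d : ℕ}

local notation "𝔼" => EuclideanSpace ℝ (Fin d)

/-- The pairing of a density with a test function, written as a pairing of two `L²` functions. -/
theorem IsFourierDensity.mul_ae_eq (hd : 1 ≤ d) (γ : ℝ) (h φ : 𝔼 → ℂ) :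
    (fun ξ => h ξ * φ ξ) =ᵐ[volume]
      fun ξ => ((symb γ ξ : ℂ) * h ξ) * (φ ξ / (symb γ ξ : ℂ)) := by
  filter_upwards [ae_ne_zero hd] with ξ hξ
  have : (symb γ ξ : ℂ) ≠ 0 := by exact_mod_cast (symb_pos γ hξ).ne'
  field_simp

theorem integrable_mul_of_memLp_symb (hd : 1 ≤ d) {γ : ℝ} (h0 : 0 ≤ γ) (h1 : γ < 1)
    {h : 𝔼 → ℂ} (hh : MemLp (fun ξ => (symb γ ξ : ℂ) * h ξ) 2 volume)
    {φ : 𝓢(𝔼, ℂ)} (hφ : Admissible γ φ) : Integrable (fun ξ => h ξ * φ ξ) volume :=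
  (hh.integrable_mul (hφ.memLp_div_symb hd h0 h1)).congr
    (IsFourierDensity.mul_ae_eq hd γ h φ).symm

theorem locallyIntegrableOn_of_memLp_symb {γ : ℝ} {h : 𝔼 → ℂ}
    (hh : MemLp (fun ξ => (symb γ ξ : ℂ) * h ξ) 2 volume) :
    LocallyIntegrableOn h {0}ᶜ volume := by
  have h1 : LocallyIntegrableOn (fun ξ => (symb γ ξ : ℂ) * h ξ) {0}ᶜ volume :=
    (hh.locallyIntegrable (by norm_num)).locallyIntegrableOn _
  have h2 : ContinuousOn (fun ξ : 𝔼 => ((symb γ ξ : ℂ))⁻¹) {0}ᶜ := by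
    refine ContinuousOn.inv₀ (Complex.continuous_ofReal.comp_continuousOn ?_) fun ξ hξ => ?_
    · unfold symb
      refine ContinuousOn.rpow_const (by fun_prop) fun ξ hξ => Or.inl ?_
      have := norm_pos_iff.2 (show ξ ≠ 0 from hξ)
      positivity
    · exact_mod_cast (symb_pos γ hξ).ne'
  refine LocallyIntegrableOn.congr ?_
    (h1.continuousOn_mul h2 isOpen_compl_singleton.isLocallyClosed)
  filter_upwards [ae_restrict_mem (measurableSet_singleton 0).compl] with ξ hξ
  exact inv_mul_cancel_left₀ (by exact_mod_cast (symb_pos γ hξ).ne') _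

/-- The Fourier density of a function is unique up to a null set, even when the two densities
refer to different Sobolev exponents. -/
theorem IsFourierDensity.ae_unique (hd : 1 ≤ d) {γ₁ γ₂ : ℝ} (h₁0 : 0 ≤ γ₁) (h₁1 : γ₁ < 1)
    (h₂0 : 0 ≤ γ₂) (h₂1 : γ₂ < 1) {f h k : 𝔼 → ℂ}
    (hh : IsFourierDensity γ₁ f h) (hk : IsFourierDensity γ₂ f k) : h =ᵐ[volume] k := by
  have hloc := (locallyIntegrableOn_of_memLp_symb hh.2.1).sub
    (locallyIntegrableOn_of_memLp_symb hk.2.1)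
  have := isOpen_compl_singleton.ae_eq_zero_of_integral_contDiff_smul_eq_zero hloc ?_
  · filter_upwards [this, ae_ne_zero hd] with ξ h1 h2
    exact sub_eq_zero.1 (h1 h2)
  intro g hg hgc hgs
  let φ : 𝓢(𝔼, ℂ) := HasCompactSupport.toSchwartzMap (f := fun ξ => (g ξ : ℂ))
    (hgc.comp_left Complex.ofReal_zero) (Complex.ofRealCLM.contDiff.comp hg)
  have hφg (ξ : 𝔼) : φ ξ = (g ξ : ℂ) := rfl
  have hφ (γ : ℝ) : Admissible γ φ := by
    refine admissible_of_eventuallyEq_zero γ ?_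
    have h0 : (0 : 𝔼) ∉ tsupport g := fun h => hgs h rfl
    filter_upwards [notMem_tsupport_iff_eventuallyEq.1 h0] with ξ hξ
    simp [hφg, hξ]
  have e1 := hh.2.2 φ (hφ _)
  have e2 := hk.2.2 φ (hφ _)
  have i1 := integrable_mul_of_memLp_symb hd h₁0 h₁1 hh.2.1 (hφ _)
  have i2 := integrable_mul_of_memLp_symb hd h₂0 h₂1 hk.2.1 (hφ _)
  have : ∀ ξ, g ξ • (h - k) ξ = h ξ * φ ξ - k ξ * φ ξ := fun ξ => by
    simp [hφg]; ring
  simp_rw [this]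
  rw [integral_sub i1 i2, ← e1, ← e2, sub_self]

theorem homSobolevNorm_eq (hd : 1 ≤ d) {γ : ℝ} (h0 : 0 ≤ γ) (h1 : γ < 1) {f h : 𝔼 → ℂ}
    (hf : f ∈ HomSobolev d γ) (hh : IsFourierDensity γ f h) :
    homSobolevNorm γ f = eLpNorm (fun ξ => (symb γ ξ : ℂ) * h ξ) 2 volume := by
  refine eLpNorm_congr_ae ?_
  filter_upwards [(fourierDensity_spec hf).ae_unique hd h0 h1 h0 h1 hh] with ξ hξ
  rw [hξ]

theorem homSobolevNorm_lt_top {γ : ℝ} {f : 𝔼 → ℂ} (hf : f ∈ HomSobolev d γ) :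
    homSobolevNorm γ f < ⊤ := (fourierDensity_spec hf).2.1.2

theorem IsFourierDensity.add_smul (hd : 1 ≤ d) {γ : ℝ} (h0 : 0 ≤ γ) (h1 : γ < 1)
    {f g h k : 𝔼 → ℂ} (hf : IsTemperedFun f) (hg : IsTemperedFun g)
    (hh : IsFourierDensity γ f h) (hk : IsFourierDensity γ g k) (c : ℂ) :
    IsFourierDensity γ (fun x => f x + c * g x) (fun ξ => h ξ + c * k ξ) := by
  refine ⟨hh.1.add (hk.1.const_mul c), ?_, fun φ hφ => ?_⟩
  · refine (hh.2.1.add (hk.2.1.const_mul c)).ae_eq (ae_of_all _ fun ξ => ?_)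
    simp only [Pi.add_apply]; ring
  · have e1 := hh.2.2 φ hφ
    have e2 := hk.2.2 φ hφ
    have i1 := integrable_mul_of_memLp_symb hd h0 h1 hh.2.1 hφ
    have i2 := integrable_mul_of_memLp_symb hd h0 h1 hk.2.1 hφ
    have j1 := hf.integrable_mul (𝓕 φ)
    have j2 := hg.integrable_mul (𝓕 φ)
    simp_rw [add_mul, mul_assoc]
    rw [integral_add j1 (j2.const_mul c), integral_add i1 (i2.const_mul c), integral_const_mul,
      integral_const_mul, e1, e2]

theorem homSobolev_add_smul (hd : 1 ≤ d) {γ : ℝ} (h0 : 0 ≤ γ) (h1 : γ < 1) {f g : 𝔼 → ℂ}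
    (hf : f ∈ HomSobolev d γ) (hg : g ∈ HomSobolev d γ) (c : ℂ) :
    (fun x => f x + c * g x) ∈ HomSobolev d γ :=
  ⟨hf.1.add_smul hg.1 c, _, (fourierDensity_spec hf).add_smul hd h0 h1 hf.1 hg.1
    (fourierDensity_spec hg) c⟩

theorem schwartz_isTemperedFun (φ : 𝓢(𝔼, ℂ)) : IsTemperedFun φ :=
  ⟨0, by simpa using φ.integrable⟩

theorem memLp_symb_mul_schwartz {γ : ℝ} (h0 : 0 ≤ γ) (φ : 𝓢(𝔼, ℂ)) :
    MemLp (fun ξ => (symb γ ξ : ℂ) * φ ξ) 2 volume := by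
  obtain ⟨k, hk⟩ := Measure.HasTemperateGrowth.exists_eLpNorm_lt_top (E := 𝔼) 2
    (μ := volume) inferInstance
  obtain ⟨C, hC0, hC⟩ := exists_schwartz_decay φ (k + ⌈γ⌉₊)
  have hm : MemLp (fun x : 𝔼 => (1 + ‖x‖) ^ (-k : ℝ)) 2 volume :=
    ⟨Measurable.aestronglyMeasurable (by fun_prop), hk⟩
  refine (hm.const_mul ((2 * Real.pi) ^ γ * C)).mono
    ((Complex.measurable_ofReal.comp (measurable_symb γ)).aestronglyMeasurable.mul
      φ.continuous.aestronglyMeasurable) (ae_of_all _ fun ξ => ?_)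
  have h1 : 1 ≤ 1 + ‖ξ‖ := by linarith [norm_nonneg ξ]
  rw [norm_mul, Complex.norm_real, Real.norm_of_nonneg (symb_nonneg _ _),
    Real.norm_of_nonneg (by positivity), symb, Real.mul_rpow (by positivity) (norm_nonneg _),
    mul_assoc, mul_assoc]
  refine mul_le_mul_of_nonneg_left ?_ (by positivity)
  rw [Real.rpow_neg (by positivity), ← div_eq_mul_inv, le_div_iff₀ (by positivity),
    Real.rpow_natCast]
  refine le_trans ?_ (hC ξ)
  have : ‖ξ‖ ^ γ ≤ (1 + ‖ξ‖) ^ ⌈γ⌉₊ := by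
    rw [← Real.rpow_natCast]
    calc ‖ξ‖ ^ γ ≤ (1 + ‖ξ‖) ^ γ := by gcongr; linarith
      _ ≤ _ := Real.rpow_le_rpow_of_exponent_le h1 (Nat.le_ceil γ)
  calc _ ≤ (1 + ‖ξ‖) ^ ⌈γ⌉₊ * ‖φ ξ‖ * (1 + ‖ξ‖) ^ k := by gcongr
    _ = _ := by ring

theorem schwartz_isFourierDensity {γ : ℝ} (h0 : 0 ≤ γ) (φ : 𝓢(𝔼, ℂ)) :
    IsFourierDensity γ φ (𝓕 φ : 𝓢(𝔼, ℂ)) :=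
  ⟨(𝓕 φ : 𝓢(𝔼, ℂ)).continuous.aestronglyMeasurable, memLp_symb_mul_schwartz h0 _, fun ψ _ => by
    rw [SchwartzMap.integral_fourier_mul_eq]⟩

/-- Multiplication of a Schwartz function by the character `ξ ↦ exp(2πi ξ·x)`. -/
noncomputable def modulate (x : 𝔼) (φ : 𝓢(𝔼, ℂ)) : 𝓢(𝔼, ℂ) :=
  𝓕⁻ ((𝓕 φ).compSubConstCLM ℂ x)

theorem fourier_modulate (x : 𝔼) (φ : 𝓢(𝔼, ℂ)) (y : 𝔼) :
    (𝓕 (modulate x φ)) y = (𝓕 φ) (y - x) := by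
  simp [modulate]

theorem modulate_apply (x : 𝔼) (φ : 𝓢(𝔼, ℂ)) (ξ : 𝔼) :
    modulate x φ ξ = (Real.fourierChar ⟪x, ξ⟫ : ℂ) * φ ξ := by
  have h2 : φ ξ = ∫ v, Real.fourierChar ⟪v, ξ⟫ • (𝓕 φ : 𝓢(𝔼, ℂ)) v := by
    conv_lhs => rw [← FourierTransform.fourierInv_fourier_eq (F := 𝓢(𝔼, ℂ)) φ]
    rw [SchwartzMap.fourierInv_coe, Real.fourierInv_eq]
  rw [h2, modulate, SchwartzMap.fourierInv_coe, Real.fourierInv_eq, ← integral_const_mul,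
    ← integral_add_right_eq_self _ x]
  refine integral_congr_ae (ae_of_all _ fun v => ?_)
  simp only [SchwartzMap.compSubConstCLM_apply, add_sub_cancel_right, inner_add_left,
    AddChar.map_add_eq_mul, Circle.smul_def, Circle.coe_mul, smul_eq_mul]
  ring

/-- Modulations keep the vanishing to infinite order at the origin. -/
theorem Admissible.modulate {γ : ℝ} {φ : 𝓢(𝔼, ℂ)} (hφ : Admissible γ φ) (x : 𝔼) :
    Admissible γ (modulate x φ) := by
  refine hφ.imp_right fun h n => ?_
  have hc : ContDiff ℝ ∞ fun ξ : 𝔼 => (Real.fourierChar ⟪x, ξ⟫ : ℂ) := by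
    simp only [Real.fourierChar_apply]
    exact ((Complex.ofRealCLM.contDiff.comp
      (contDiff_const.mul (contDiff_const.inner ℝ contDiff_id))).mul contDiff_const).cexp
  simp_rw [modulate_apply]
  rw [← norm_le_zero_iff]
  refine (norm_iteratedFDeriv_mul_le (N := ∞) hc (φ.smooth ⊤) 0 (n := n)
    (by exact_mod_cast le_top)).trans ?_
  refine (Finset.sum_eq_zero fun i _ => ?_).le
  have := h (n - i)
  simp [this]

end Densities

/-! ### Translations and dilations -/

section Affine

variable {d : ℕ}

local notation "𝔼" => EuclideanSpace ℝ (Fin d)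

theorem eLpNorm_comp_smul {l : ℝ} (hl : 0 < l) (g : 𝔼 → ℂ) (p : ℝ≥0∞) :
    eLpNorm (fun x => g (l • x)) p volume =
      ENNReal.ofReal (l ^ (-(d : ℝ) * (1 / p).toReal)) * eLpNorm g p volume := by
  have he : MeasurableEmbedding (fun x : 𝔼 => l • x) :=
    (Homeomorph.smulOfNeZero l hl.ne').measurableEmbedding
  have h1 := he.eLpNorm_map_measure (g := g) (p := p) (μ := volume)
  rw [Measure.map_addHaar_smul volume hl.ne', eLpNorm_smul_measure_of_ne_zero] at h1
  · rw [← Function.comp_def g, ← h1, smul_eq_mul, ENNReal.ofReal_rpow_of_pos (by positivity)]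
    congr 2
    rw [abs_of_pos (by positivity), finrank_euclideanSpace_fin, ← Real.rpow_natCast,
      ← Real.rpow_neg hl.le, ← Real.rpow_mul hl.le]
  · rw [ne_eq, ENNReal.ofReal_eq_zero, not_le]; positivity

theorem eLpNorm_comp_add (x₀ : 𝔼) (g : 𝔼 → ℂ) (p : ℝ≥0∞) :
    eLpNorm (fun x => g (x + x₀)) p volume = eLpNorm g p volume := by
  have he : MeasurableEmbedding (fun x : 𝔼 => x + x₀) :=
    (Homeomorph.addRight x₀).measurableEmbedding
  have h1 := he.eLpNorm_map_measure (g := g) (p := p) (μ := volume)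
  rw [map_add_right_eq_self] at h1
  exact h1.symm

theorem quasiMeasurePreserving_affine {l : ℝ} (hl : 0 < l) (x₀ : 𝔼) :
    Measure.QuasiMeasurePreserving (fun x : 𝔼 => l • x + x₀) volume volume :=
  (measurePreserving_add_right volume x₀).quasiMeasurePreserving.comp
    (Measure.quasiMeasurePreserving_smul volume hl.ne')

theorem eLpNorm_affine (c : ℂ) {l : ℝ} (hl : 0 < l) (x₀ : 𝔼) (g : 𝔼 → ℂ) (p : ℝ≥0∞) :
    eLpNorm (fun x => c * g (l • x + x₀)) p volume =
      ENNReal.ofReal (‖c‖ * l ^ (-(d : ℝ) * (1 / p).toReal)) * eLpNorm g p volume := by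
  have h1 := eLpNorm_const_smul c (fun x => g (l • x + x₀)) p (volume : Measure 𝔼)
  rw [eLpNorm_comp_smul hl (fun x => g (x + x₀)), eLpNorm_comp_add, ← mul_assoc] at h1
  rw [ENNReal.ofReal_mul (norm_nonneg _), ofReal_norm]
  exact h1

theorem IsTemperedFun.affine {f : 𝔼 → ℂ} (hf : IsTemperedFun f) (c : ℂ) {l : ℝ} (hl : 0 < l)
    (x₀ : 𝔼) : IsTemperedFun (fun x => c * f (l • x + x₀)) := by
  have hm : AEStronglyMeasurable (fun x => c * f (l • x + x₀)) volume :=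
    (hf.aestronglyMeasurable.comp_quasiMeasurePreserving
      (quasiMeasurePreserving_affine hl x₀)).const_mul c
  obtain ⟨k, hk⟩ := hf
  have h1 := (hk.norm.comp_add_right x₀).comp_smul hl.ne'
  refine isTemperedFun_of_integrable_pow (k := k) hm ((h1.const_mul
    (‖c‖ * (1 + l + ‖x₀‖) ^ k)).mono' (hm.norm.div₀ (by fun_prop)) (ae_of_all _ fun x => ?_))
  rw [norm_div, norm_norm, Real.norm_of_nonneg (by positivity), norm_mul, norm_div,
    Complex.norm_real, Real.norm_of_nonneg (by positivity), mul_assoc, mul_div_assoc]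
  refine mul_le_mul_of_nonneg_left ?_ (norm_nonneg _)
  have h3 : 1 + ‖l • x + x₀‖ ≤ (1 + l + ‖x₀‖) * (1 + ‖x‖) := by
    have := norm_add_le (l • x) x₀
    rw [norm_smul, Real.norm_of_nonneg hl.le] at this
    nlinarith [norm_nonneg x, norm_nonneg x₀, mul_nonneg (norm_nonneg x) (norm_nonneg x₀)]
  have h4 := pow_le_pow_left₀ (by positivity) h3 k
  rw [mul_pow] at h4
  rw [div_le_iff₀ (by positivity), mul_div_assoc', div_mul_eq_mul_div,
    le_div_iff₀ (by positivity)]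
  calc _ ≤ ‖f (l • x + x₀)‖ * ((1 + l + ‖x₀‖) ^ k * (1 + ‖x‖) ^ k) := by gcongr
    _ = _ := by ring

/-- Precomposition of a Schwartz function with the dilation by `l`. -/
noncomputable def dilate (l : ℝ) (hl : l ≠ 0) (φ : 𝓢(𝔼, ℂ)) : 𝓢(𝔼, ℂ) :=
  SchwartzMap.compCLMOfContinuousLinearEquiv ℂ
    (ContinuousLinearEquiv.smulLeft (R₁ := ℝ) (M₁ := 𝔼) (Units.mk0 l hl)) φ

theorem dilate_apply (l : ℝ) (hl : l ≠ 0) (φ : 𝓢(𝔼, ℂ)) (ξ : 𝔼) :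
    dilate l hl φ ξ = φ (l • ξ) := rfl

theorem Admissible.dilate {γ : ℝ} {φ : 𝓢(𝔼, ℂ)} (hφ : Admissible γ φ) {l : ℝ} (hl : l ≠ 0) :
    Admissible γ (dilate l hl φ) := by
  refine hφ.imp_right fun h n => ?_
  have h1 := ContinuousLinearMap.iteratedFDeriv_comp_right (𝕜 := ℝ)
    (ContinuousLinearEquiv.smulLeft (R₁ := ℝ) (M₁ := 𝔼) (Units.mk0 l hl) : 𝔼 →L[ℝ] 𝔼)
    (φ.smooth ⊤) 0 (i := n) (by exact_mod_cast le_top)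
  refine h1.trans ?_
  have := h n
  simp only [map_zero]
  erw [this]
  ext; simp

theorem fourier_dilate {l : ℝ} (hl : 0 < l) (φ : 𝓢(𝔼, ℂ)) (y : 𝔼) :
    (𝓕 (dilate l hl.ne' φ)) y = (((l ^ d)⁻¹ : ℝ) : ℂ) * (𝓕 φ) (l⁻¹ • y) := by
  rw [SchwartzMap.fourier_coe, SchwartzMap.fourier_coe, Real.fourier_eq, Real.fourier_eq]
  have h1 := Measure.integral_comp_smul_of_nonneg (volume : Measure 𝔼)
    (fun v => Real.fourierChar (-⟪v, l⁻¹ • y⟫) • φ v) l (hR := hl.le)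
  rw [finrank_euclideanSpace_fin] at h1
  rw [← Complex.real_smul, ← h1]
  refine integral_congr_ae (ae_of_all _ fun v => ?_)
  simp [dilate_apply, real_inner_smul_left, real_inner_smul_right, hl.ne']

/-- The Fourier transform of `x ↦ c f(l x + x₀)` is
`ξ ↦ c l^{-d} exp(2πi x₀·ξ/l) (𝓕 f)(ξ/l)`. -/
theorem IsFourierDensity.affine {γ : ℝ} {f h : 𝔼 → ℂ} (hh : IsFourierDensity γ f h) (c : ℂ)
    {l : ℝ} (hl : 0 < l) (x₀ : 𝔼) :
    IsFourierDensity γ (fun x => c * f (l • x + x₀)) (fun ξ => (c * ((l ^ d)⁻¹ : ℝ)) *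
      ((Real.fourierChar ⟪x₀, l⁻¹ • ξ⟫ : ℂ) * h (l⁻¹ • ξ))) := by
  have hl' : 0 < l⁻¹ := by positivity
  have hq : Measure.QuasiMeasurePreserving (fun x : 𝔼 => l⁻¹ • x) volume volume :=
    Measure.quasiMeasurePreserving_smul volume hl'.ne'
  have hcont : Continuous fun ξ : 𝔼 => (Real.fourierChar ⟪x₀, ξ⟫ : ℂ) :=
    continuous_subtype_val.comp (Real.continuous_fourierChar.comp (by fun_prop))
  have hm : AEStronglyMeasurable (fun ξ => (c * ((l ^ d)⁻¹ : ℝ)) *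
      ((Real.fourierChar ⟪x₀, l⁻¹ • ξ⟫ : ℂ) * h (l⁻¹ • ξ))) volume :=
    ((hcont.aestronglyMeasurable.mul hh.1).comp_quasiMeasurePreserving hq).const_mul _
  refine ⟨hm, ?_, fun φ hφ => ?_⟩
  · have h2 : MemLp (fun ξ => (symb γ (l⁻¹ • ξ) : ℂ) * h (l⁻¹ • ξ)) 2 volume :=
      ⟨hh.2.1.1.comp_quasiMeasurePreserving hq, by
        have := eLpNorm_comp_smul hl' (fun ξ => (symb γ ξ : ℂ) * h ξ) 2
        rw [this]
        exact ENNReal.mul_lt_top ENNReal.ofReal_lt_top hh.2.1.2⟩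
    refine (h2.const_mul ((c * ((l ^ d)⁻¹ : ℝ)) * ((l ^ γ : ℝ) : ℂ))).mono
      ((Complex.measurable_ofReal.comp (measurable_symb γ)).aestronglyMeasurable.mul hm)
      (ae_of_all _ fun ξ => ?_)
    have h3 : symb γ ξ = l ^ γ * symb γ (l⁻¹ • ξ) := by
      rw [← symb_smul γ hl, smul_inv_smul₀ hl.ne']
    rw [h3]
    simp only [norm_mul, Circle.norm_coe, Complex.ofReal_mul]
    exact le_of_eq (by ring)
  · have h1 := hh.2.2 (_root_.modulate x₀ (_root_.dilate l hl.ne' φ))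
      (Admissible.modulate (Admissible.dilate hφ hl.ne') x₀)
    calc ∫ x, c * f (l • x + x₀) * (𝓕 φ) x
        = ∫ x, (fun y => c * f (y + x₀) * (𝓕 φ) (l⁻¹ • y)) (l • x) := by
          simp [inv_smul_smul₀ hl.ne']
      _ = (l ^ d)⁻¹ • ∫ y, c * f (y + x₀) * (𝓕 φ) (l⁻¹ • y) := by
          have := Measure.integral_comp_smul_of_nonneg (volume : Measure 𝔼)
            (fun y => c * f (y + x₀) * (𝓕 φ) (l⁻¹ • y)) l (hR := hl.le)
          rwa [finrank_euclideanSpace_fin] at this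
      _ = c * ∫ y, f (y + x₀) * (𝓕 (_root_.dilate l hl.ne' φ)) y := by
          rw [Complex.real_smul, ← integral_const_mul, ← integral_const_mul]
          congr 1 with y
          rw [fourier_dilate hl]; ring
      _ = c * ∫ y, f y * (𝓕 (_root_.modulate x₀ (_root_.dilate l hl.ne' φ))) y := by
          rw [← integral_add_right_eq_self (fun y => f y * _) x₀]
          simp_rw [fourier_modulate, add_sub_cancel_right]
      _ = c * ∫ ξ, h ξ * ((Real.fourierChar ⟪x₀, ξ⟫ : ℂ) * φ (l • ξ)) := by
          rw [h1]; simp_rw [modulate_apply, dilate_apply]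
      _ = (c * ((l ^ d)⁻¹ : ℝ)) * ∫ ξ, h (l⁻¹ • ξ) *
            ((Real.fourierChar ⟪x₀, l⁻¹ • ξ⟫ : ℂ) * φ ξ) := by
          have := Measure.integral_comp_smul_of_nonneg volume (fun ξ => h (l⁻¹ • ξ) *
            ((Real.fourierChar ⟪x₀, l⁻¹ • ξ⟫ : ℂ) * φ ξ)) l (hR := hl.le)
          simp only [inv_smul_smul₀ hl.ne', finrank_euclideanSpace_fin] at this
          rw [this, Complex.real_smul, mul_assoc]
      _ = _ := by
          rw [← integral_const_mul]
          congr 1 with ξ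
          ring

theorem homSobolev_affine {γ : ℝ} {f : 𝔼 → ℂ} (hf : f ∈ HomSobolev d γ) (c : ℂ) {l : ℝ}
    (hl : 0 < l) (x₀ : 𝔼) : (fun x => c * f (l • x + x₀)) ∈ HomSobolev d γ :=
  ⟨hf.1.affine c hl x₀, _, (fourierDensity_spec hf).affine c hl x₀⟩

theorem homSobolevNorm_affine (hd : 1 ≤ d) {γ : ℝ} (h0 : 0 ≤ γ) (h1 : γ < 1) {f : 𝔼 → ℂ}
    (hf : f ∈ HomSobolev d γ) (c : ℂ) {l : ℝ} (hl : 0 < l) (x₀ : 𝔼) :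
    homSobolevNorm γ (fun x => c * f (l • x + x₀)) =
      ENNReal.ofReal (‖c‖ * l ^ (γ - d / 2)) * homSobolevNorm γ f := by
  have hl' : 0 < l⁻¹ := by positivity
  rw [homSobolevNorm_eq hd h0 h1 (homSobolev_affine hf c hl x₀)
    ((fourierDensity_spec hf).affine c hl x₀)]
  have h2 := eLpNorm_affine (c * ((l ^ d)⁻¹ : ℝ) * ((l ^ γ : ℝ) : ℂ)) hl' 0
    (fun ξ => (symb γ ξ : ℂ) * fourierDensity γ f ξ) 2
  simp only [add_zero] at h2
  rw [homSobolevNorm]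
  have h3 : ENNReal.ofReal (‖c‖ * l ^ (γ - d / 2)) = ENNReal.ofReal
      (‖c * ((l ^ d)⁻¹ : ℝ) * ((l ^ γ : ℝ) : ℂ)‖ * l⁻¹ ^ (-(d : ℝ) * (1 / 2 : ℝ≥0∞).toReal)) := by
    congr 1
    rw [norm_mul, norm_mul, Complex.norm_real, Complex.norm_real,
      Real.norm_of_nonneg (by positivity), Real.norm_of_nonneg (by positivity),
      Real.inv_rpow hl.le, ← Real.rpow_neg hl.le, ← Real.rpow_natCast, ← Real.rpow_neg hl.le,
      mul_assoc, mul_assoc, ← Real.rpow_add hl, ← Real.rpow_add hl]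
    congr 2
    simp
    ring
  rw [h3, ← h2]
  refine eLpNorm_congr_norm_ae (ae_of_all _ fun ξ => ?_)
  have h3 : symb γ ξ = l ^ γ * symb γ (l⁻¹ • ξ) := by
    rw [← symb_smul γ hl, smul_inv_smul₀ hl.ne']
  rw [h3]
  simp only [norm_mul, Circle.norm_coe, Complex.ofReal_mul]
  ring

end Affine

/-! ### Smooth frequency truncation -/

section LowPass

variable {d : ℕ}

local notation "𝔼" => EuclideanSpace ℝ (Fin d)

/-- A smooth bump equal to `1` on the unit ball and supported in the ball of radius `2`. -/
noncomputable def unitBump (d : ℕ) : ContDiffBump (0 : EuclideanSpace ℝ (Fin d)) :=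
  ⟨1, 2, one_pos, one_lt_two⟩

/-- The unit bump as a Schwartz function. -/
noncomputable def bumpSchwartz (d : ℕ) : 𝓢(EuclideanSpace ℝ (Fin d), ℂ) :=
  HasCompactSupport.toSchwartzMap (f := fun ξ => ((unitBump d ξ : ℝ) : ℂ))
    ((unitBump d).hasCompactSupport.comp_left Complex.ofReal_zero)
    (Complex.ofRealCLM.contDiff.comp (unitBump d).contDiff)

theorem bumpSchwartz_apply (ξ : 𝔼) : bumpSchwartz d ξ = ((unitBump d ξ : ℝ) : ℂ) := rfl

/-- The smooth frequency cutoff `χ(ξ/N)`, equal to `1` for `|ξ| ≤ N` and to `0` for `|ξ| ≥ 2N`. -/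
noncomputable def cutoff (N : ℝ) (ξ : 𝔼) : ℝ := unitBump d (N⁻¹ • ξ)

theorem cutoff_nonneg (N : ℝ) (ξ : 𝔼) : 0 ≤ cutoff N ξ := (unitBump d).nonneg

theorem cutoff_le_one (N : ℝ) (ξ : 𝔼) : cutoff N ξ ≤ 1 := (unitBump d).le_one

theorem norm_inv_smul {N : ℝ} (hN : 0 < N) (ξ : 𝔼) : ‖N⁻¹ • ξ‖ = ‖ξ‖ / N := by
  rw [norm_smul, norm_inv, Real.norm_of_nonneg hN.le]; field_simp

theorem cutoff_eq_one {N : ℝ} (hN : 0 < N) {ξ : 𝔼} (h : ‖ξ‖ ≤ N) : cutoff N ξ = 1 := by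
  refine (unitBump d).one_of_mem_closedBall ?_
  rw [mem_closedBall_zero_iff, norm_inv_smul hN]
  exact (div_le_one hN).2 h

theorem cutoff_eq_zero {N : ℝ} (hN : 0 < N) {ξ : 𝔼} (h : 2 * N ≤ ‖ξ‖) : cutoff N ξ = 0 := by
  refine (unitBump d).zero_of_le_dist ?_
  rw [dist_zero_right, norm_inv_smul hN]
  exact (le_div_iff₀ hN).2 h

theorem continuous_cutoff (N : ℝ) : Continuous (cutoff N : 𝔼 → ℝ) :=
  (unitBump d).continuous.comp (continuous_const_smul _)

/-- The test function `ξ ↦ χ(ξ/N) exp(2πi x·ξ)`, whose pairing with the Fourier transform of `f`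
is the value at `x` of the low frequency part of `f`. -/
noncomputable def lowTest (N : ℝ) (x : 𝔼) : 𝓢(𝔼, ℂ) :=
  if hN : N⁻¹ ≠ 0 then modulate x (dilate N⁻¹ hN (bumpSchwartz d)) else 0

theorem lowTest_apply {N : ℝ} (hN : 0 < N) (x ξ : 𝔼) :
    lowTest N x ξ = (Real.fourierChar ⟪x, ξ⟫ : ℂ) * (cutoff N ξ : ℂ) := by
  have h : N⁻¹ ≠ 0 := by positivity
  rw [lowTest, dif_pos h, modulate_apply, dilate_apply, bumpSchwartz_apply, cutoff]

theorem norm_lowTest_apply {N : ℝ} (hN : 0 < N) (x ξ : 𝔼) : ‖lowTest N x ξ‖ = cutoff N ξ := by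
  rw [lowTest_apply hN, norm_mul, Circle.norm_coe, one_mul, Complex.norm_real,
    Real.norm_of_nonneg (cutoff_nonneg _ _)]

/-- The low frequency part `P_{≤N} f = f * K_N`, where `K_N` has Fourier transform `χ(·/N)`. -/
noncomputable def lowPass (N : ℝ) (f : 𝔼 → ℂ) (x : 𝔼) : ℂ := ∫ y, f y * (𝓕 (lowTest N x)) y

theorem fourier_lowTest {N : ℝ} (hN : 0 < N) (x y : 𝔼) :
    (𝓕 (lowTest N x)) y = ((N ^ d : ℝ) : ℂ) * (𝓕 (bumpSchwartz d)) (N • (y - x)) := by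
  have h : 0 < N⁻¹ := by positivity
  rw [lowTest, dif_pos h.ne', fourier_modulate, fourier_dilate h, inv_inv, inv_pow, inv_inv]

theorem lowPass_translate {N : ℝ} (hN : 0 < N) (f : 𝔼 → ℂ) (x₀ x : 𝔼) :
    lowPass N (fun y => f (y + x₀)) x = lowPass N f (x + x₀) := by
  rw [lowPass, lowPass, ← integral_add_right_eq_self (fun y => f y * _) x₀]
  simp_rw [fourier_lowTest hN, add_sub_add_right_eq_sub]

theorem norm_integral_mul_le {X : Type*} {_ : MeasurableSpace X} {μ : Measure X} {f g : X → ℂ}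
    {p q : ℝ≥0∞} [p.HolderConjugate q] (hf : MemLp f p μ) (hg : MemLp g q μ) :
    ‖∫ x, f x * g x ∂μ‖ ≤ (eLpNorm f p μ).toReal * (eLpNorm g q μ).toReal := by
  rw [← ENNReal.toReal_mul, ← toReal_enorm]
  refine ENNReal.toReal_mono (ENNReal.mul_ne_top hf.2.ne hg.2.ne) ?_
  refine (enorm_integral_le_lintegral_enorm _).trans ?_
  have := eLpNorm_smul_le_mul_eLpNorm (p := p) (q := q) (r := 1) hg.1 hf.1
  rwa [eLpNorm_one_eq_lintegral_enorm] at this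

theorem eLpNorm_two_sq {X : Type*} {_ : MeasurableSpace X} {μ : Measure X} (f : X → ℂ) :
    eLpNorm f 2 μ ^ 2 = ∫⁻ x, ‖f x‖ₑ ^ 2 ∂μ := by
  have := eLpNorm_nnreal_pow_eq_lintegral (f := f) (μ := μ) (p := 2) (by norm_num)
  simpa using this

/-- Bernstein's inequality `‖P_{≤N} f‖_∞ ≤ C N^{d/p} ‖f‖_p`. -/
theorem exists_lowPass_le_eLpNorm (d : ℕ) {p : ℝ} (hp : 1 < p) : ∃ C : ℝ, 0 < C ∧
    ∀ (f : EuclideanSpace ℝ (Fin d) → ℂ), MemLp f (ENNReal.ofReal p) volume → ∀ N : ℝ, 0 < N →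
      ∀ x, ‖lowPass N f x‖ ≤ C * N ^ ((d : ℝ) / p) * (lebNorm p f).toReal := by
  set q := Real.conjExponent p with hq
  have hpq : p.HolderConjugate q := Real.HolderConjugate.conjExponent hp
  have hq0 : 0 < q := hpq.symm.pos
  have hHC : ENNReal.HolderConjugate (ENNReal.ofReal p) (ENNReal.ofReal q) := hpq.ennrealOfReal
  let K : EuclideanSpace ℝ (Fin d) → ℂ := ⇑(𝓕 (bumpSchwartz d) : 𝓢(EuclideanSpace ℝ (Fin d), ℂ))
  refine ⟨(eLpNorm K (ENNReal.ofReal q) volume).toReal + 1, by positivity, fun f hf N hN x => ?_⟩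
  have hg : MemLp (𝓕 (lowTest N x) : 𝓢(EuclideanSpace ℝ (Fin d), ℂ)) (ENNReal.ofReal q) volume :=
    SchwartzMap.memLp _ _ _
  have h1 : ‖lowPass N f x‖ ≤ (lebNorm p f).toReal *
      (eLpNorm (𝓕 (lowTest N x) : 𝓢(EuclideanSpace ℝ (Fin d), ℂ)) (ENNReal.ofReal q)
        volume).toReal := norm_integral_mul_le hf hg
  have h2 : eLpNorm (𝓕 (lowTest N x) : 𝓢(EuclideanSpace ℝ (Fin d), ℂ)) (ENNReal.ofReal q) volume
      = ENNReal.ofReal (N ^ ((d : ℝ) / p)) * eLpNorm K (ENNReal.ofReal q) volume := by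
    have := eLpNorm_affine ((N ^ d : ℝ) : ℂ) hN (-(N • x)) K (ENNReal.ofReal q)
    have h3 : (𝓕 (lowTest N x) : 𝓢(EuclideanSpace ℝ (Fin d), ℂ)) =
        fun y => ((N ^ d : ℝ) : ℂ) * K (N • y + -(N • x)) := by
      ext y
      rw [fourier_lowTest hN, smul_sub, sub_eq_add_neg]
    rw [h3, this]
    congr 2
    rw [Complex.norm_real, Real.norm_of_nonneg (by positivity), ← Real.rpow_natCast,
      ← Real.rpow_add hN]
    congr 1
    rw [ENNReal.toReal_div, ENNReal.toReal_ofReal hq0.le]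
    have := hpq.inv_add_inv_eq_one
    simp only [ENNReal.toReal_one]
    rw [one_div, ← sub_eq_zero, div_eq_mul_inv]
    have h5 : q⁻¹ = 1 - p⁻¹ := by linarith
    rw [h5]; ring
  rw [h2, ENNReal.toReal_mul, ENNReal.toReal_ofReal (by positivity)] at h1
  refine h1.trans ?_
  have h6 : 0 ≤ (lebNorm p f).toReal := ENNReal.toReal_nonneg
  have h7 : 0 < N ^ ((d : ℝ) / p) := by positivity
  nlinarith [mul_nonneg h6 h7.le]

theorem lowPass_eq_integral {γ : ℝ} (hγ : γ < (d : ℝ) / 2) {f h : 𝔼 → ℂ}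
    (hh : IsFourierDensity γ f h) (N : ℝ) (x : 𝔼) :
    lowPass N f x = ∫ ξ, h ξ * lowTest N x ξ := hh.2.2 _ (Or.inl hγ)

/-- Differences of low frequency parts are given by the density for every `γ`, because their test
functions vanish near the origin. -/
theorem lowPass_sub_lowPass {γ : ℝ} {f h : 𝔼 → ℂ}
    (hf : IsTemperedFun f) (hh : IsFourierDensity γ f h) {N N' : ℝ} (hN : 0 < N) (hN' : N ≤ N')
    (x : 𝔼) :
    lowPass N' f x - lowPass N f x = ∫ ξ, h ξ * (lowTest N' x - lowTest N x) ξ := by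
  have ha : Admissible γ (lowTest N' x - lowTest N x) := by
    refine admissible_of_eventuallyEq_zero γ ?_
    filter_upwards [Metric.ball_mem_nhds 0 hN] with ξ hξ
    have : ‖ξ‖ ≤ N := (mem_ball_zero_iff.1 hξ).le
    rw [sub_apply, lowTest_apply hN, lowTest_apply (hN.trans_le hN'), cutoff_eq_one hN this,
      cutoff_eq_one (hN.trans_le hN') (this.trans hN'), sub_self]
  rw [← hh.2.2 _ ha, lowPass, lowPass, ← integral_sub (hf.integrable_mul _) (hf.integrable_mul _)]
  congr 1 with y
  rw [← mul_sub]
  congr 1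
  have : 𝓕 (lowTest N' x - lowTest N x) = 𝓕 (lowTest N' x) - 𝓕 (lowTest N x) := by
    rw [sub_eq_add_neg, FourierTransform.fourier_add, FourierTransform.fourier_neg,
      ← sub_eq_add_neg]
  rw [this]; rfl

theorem fourier_lowTest_eq {N : ℝ} (hN : 0 < N) (x y : 𝔼) :
    (𝓕 (lowTest N x)) y = (𝓕 (lowTest N 0)) (y - x) := by
  rw [fourier_lowTest hN, fourier_lowTest hN, sub_zero]

/-- The integrand of the double integral of `f(y) K_N(x - y) w(x)` is dominated by a product. -/
theorem exists_lowPass_kernel_bound {N : ℝ} (hN : 0 < N) (k : ℕ) : ∃ C, 0 < C ∧ ∀ x y : 𝔼,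
    ‖(𝓕 (lowTest N x)) y‖ ≤ C * (1 + ‖x‖) ^ k / (1 + ‖y‖) ^ k := by
  obtain ⟨C, hC0, hC⟩ := exists_schwartz_decay (𝓕 (lowTest N (0 : 𝔼))) k
  refine ⟨C, hC0, fun x y => ?_⟩
  rw [fourier_lowTest_eq hN, le_div_iff₀ (by positivity)]
  have h1 : 1 + ‖y‖ ≤ (1 + ‖y - x‖) * (1 + ‖x‖) := by
    have := norm_add_le (y - x) x
    rw [sub_add_cancel] at this
    nlinarith [norm_nonneg x, norm_nonneg (y - x), mul_nonneg (norm_nonneg (y - x)) (norm_nonneg x)]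
  have h2 := pow_le_pow_left₀ (by positivity) h1 k
  rw [mul_pow] at h2
  calc _ ≤ ‖(𝓕 (lowTest N (0 : 𝔼))) (y - x)‖ * ((1 + ‖y - x‖) ^ k * (1 + ‖x‖) ^ k) := by gcongr
    _ = ((1 + ‖y - x‖) ^ k * ‖(𝓕 (lowTest N (0 : 𝔼))) (y - x)‖) * (1 + ‖x‖) ^ k := by ring
    _ ≤ _ := by gcongr; exact hC _

theorem aestronglyMeasurable_lowPass_kernel {f : 𝔼 → ℂ} (hf : IsTemperedFun f) {N : ℝ}
    (hN : 0 < N) : AEStronglyMeasurable (fun z : 𝔼 × 𝔼 => f z.2 * (𝓕 (lowTest N z.1)) z.2)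
      (volume.prod volume) := by
  refine hf.aestronglyMeasurable.comp_snd.mul (Continuous.aestronglyMeasurable ?_)
  have h1 : (fun z : 𝔼 × 𝔼 => (𝓕 (lowTest N z.1)) z.2) =
      fun z => (𝓕 (lowTest N (0 : 𝔼))) (z.2 - z.1) :=
    funext fun z => fourier_lowTest_eq hN _ _
  rw [h1]
  exact (SchwartzMap.continuous _).comp (by fun_prop)

theorem aestronglyMeasurable_lowPass {f : 𝔼 → ℂ} (hf : IsTemperedFun f) {N : ℝ} (hN : 0 < N) :
    AEStronglyMeasurable (lowPass N f) volume :=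
  (aestronglyMeasurable_lowPass_kernel hf hN).integral_prod_right'

theorem isTemperedFun_lowPass {f : 𝔼 → ℂ} (hf : IsTemperedFun f) {N : ℝ} (hN : 0 < N) :
    IsTemperedFun (lowPass N f) := by
  have hm := aestronglyMeasurable_lowPass hf hN
  obtain ⟨k, hk⟩ := hf
  obtain ⟨C, hC0, hC⟩ := exists_lowPass_kernel_bound (d := d) hN k
  set A := ∫ y, ‖f y / (((1 + ‖y‖) ^ k : ℝ) : ℂ)‖ with hA
  have hb (x : 𝔼) : ‖lowPass N f x‖ ≤ A * C * (1 + ‖x‖) ^ k := by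
    rw [mul_assoc, hA, ← integral_mul_const]
    refine norm_integral_le_of_norm_le (hk.norm.mul_const _) (ae_of_all _ fun y => ?_)
    rw [norm_mul, norm_div, Complex.norm_real, Real.norm_of_nonneg (by positivity),
      div_mul_eq_mul_div, mul_div_assoc]
    gcongr
    exact hC x y
  obtain ⟨m, hm2⟩ := Measure.HasTemperateGrowth.exists_eLpNorm_lt_top (E := 𝔼) 1
    (μ := volume) inferInstance
  have hi : Integrable (fun x : 𝔼 => (1 + ‖x‖) ^ (-m : ℝ)) volume :=
    memLp_one_iff_integrable.1 ⟨Measurable.aestronglyMeasurable (by fun_prop), hm2⟩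
  refine isTemperedFun_of_integrable_pow (k := k + m) hm ((hi.const_mul (A * C)).mono'
    (hm.norm.div₀ (by fun_prop)) (ae_of_all _ fun x => ?_))
  rw [norm_div, norm_norm, Real.norm_of_nonneg (by positivity), div_le_iff₀ (by positivity),
    Real.rpow_neg (by positivity), Real.rpow_natCast, pow_add]
  refine (hb x).trans (le_of_eq ?_)
  field_simp

theorem IsTemperedFun.locallyIntegrable {f : 𝔼 → ℂ} (hf : IsTemperedFun f) :
    LocallyIntegrable f volume := by
  obtain ⟨k, hk⟩ := hf
  have h2 : Continuous (fun x : 𝔼 => (((1 + ‖x‖) ^ k : ℝ) : ℂ)) := by fun_prop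
  have h1 := (hk.locallyIntegrable.locallyIntegrableOn univ).continuousOn_mul h2.continuousOn
    isClosed_univ.isLocallyClosed
  rw [locallyIntegrableOn_univ] at h1
  convert h1 using 2 with x
  have : (((1 + ‖x‖) ^ k : ℝ) : ℂ) ≠ 0 := by
    have : 0 < (1 + ‖x‖) ^ k := by positivity
    exact_mod_cast this.ne'
  exact (mul_div_cancel₀ _ this).symm

/-- The smooth frequency truncation of a Schwartz function. -/
noncomputable def lowFreq (N : ℝ) (φ : 𝓢(𝔼, ℂ)) : 𝓢(𝔼, ℂ) :=
  SchwartzMap.smulLeftCLM ℂ (lowTest N (0 : 𝔼)) φ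

theorem lowFreq_apply {N : ℝ} (hN : 0 < N) (φ : 𝓢(𝔼, ℂ)) (ξ : 𝔼) :
    lowFreq N φ ξ = (cutoff N ξ : ℂ) * φ ξ := by
  rw [lowFreq, SchwartzMap.smulLeftCLM_apply_apply (lowTest N (0 : 𝔼)).hasTemperateGrowth,
    lowTest_apply hN]
  simp

theorem fourier_lowFreq {N : ℝ} (hN : 0 < N) (ψ : 𝓢(𝔼, ℂ)) (y : 𝔼) :
    (𝓕 (lowFreq N (𝓕⁻ ψ))) y = ∫ x, ψ x * (𝓕 (lowTest N x)) y := by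
  have h1 : (𝓕 (lowFreq N (𝓕⁻ ψ))) y = ∫ ξ, (𝓕⁻ ψ) ξ * (lowTest N (-y)) ξ := by
    rw [SchwartzMap.fourier_coe, Real.fourier_eq]
    congr 1 with ξ
    rw [lowFreq_apply hN, lowTest_apply hN, inner_neg_left, real_inner_comm, Circle.smul_def,
      smul_eq_mul]
    ring
  rw [h1, SchwartzMap.integral_fourierInv_mul_eq]
  congr 1 with x
  rw [SchwartzMap.fourierInv_coe, Real.fourierInv_eq_fourier_neg, ← SchwartzMap.fourier_coe,
    fourier_lowTest hN, fourier_lowTest hN, sub_neg_eq_add, neg_add_eq_sub]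

/-- The pairing with the low frequency part, by Fubini's theorem. -/
theorem integral_lowPass_mul {f : 𝔼 → ℂ} (hf : IsTemperedFun f) {N : ℝ} (hN : 0 < N)
    (ψ : 𝓢(𝔼, ℂ)) :
    ∫ x, lowPass N f x * ψ x = ∫ y, f y * (𝓕 (lowFreq N (𝓕⁻ ψ))) y := by
  simp_rw [fourier_lowFreq hN, lowPass, ← integral_const_mul, ← integral_mul_const]
  rw [integral_integral_swap]
  · congr 1 with y
    congr 1 with x
    ring
  have hm := (aestronglyMeasurable_lowPass_kernel hf hN).mul
    (ψ.continuous.aestronglyMeasurable.comp_fst (ν := (volume : Measure 𝔼)) (μ := volume))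
  obtain ⟨k, hk⟩ := hf
  obtain ⟨C, hC0, hC⟩ := exists_lowPass_kernel_bound (d := d) hN k
  have hψ : Integrable (fun x => C * (1 + ‖x‖) ^ k * ‖ψ x‖) volume := by
    have hb (j : ℕ) : Integrable (fun x => ‖x‖ ^ j * ‖ψ x‖) volume := ψ.integrable_pow_mul volume j
    simp_rw [mul_assoc]
    refine Integrable.const_mul ?_ C
    refine ((hb 0).add (hb k)).const_mul (2 ^ (k - 1)) |>.mono' (by fun_prop)
      (ae_of_all _ fun x => ?_)
    rw [Real.norm_of_nonneg (by positivity)]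
    simp only [Pi.add_apply, pow_zero, ← add_mul, ← mul_assoc]
    gcongr
    simpa using add_pow_le zero_le_one (norm_nonneg x) k
  refine (hψ.mul_prod hk.norm).mono' hm (ae_of_all _ fun z => ?_)
  rw [Function.uncurry_def, norm_mul, norm_mul, norm_div, Complex.norm_real,
    Real.norm_of_nonneg (by positivity : (0 : ℝ) ≤ (1 + ‖z.2‖) ^ k)]
  calc _ ≤ ‖f z.2‖ * (C * (1 + ‖z.1‖) ^ k / (1 + ‖z.2‖) ^ k) * ‖ψ z.1‖ := by
        gcongr; exact hC _ _
    _ = _ := by ring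

/-- The high frequency part of a density is square integrable, since `|ξ|^γ` is bounded below away
from the origin. -/
theorem memLp_highFreq {γ : ℝ} (h0 : 0 ≤ γ) {h : 𝔼 → ℂ} (hm : AEStronglyMeasurable h volume)
    (hh : MemLp (fun ξ => (symb γ ξ : ℂ) * h ξ) 2 volume) {N : ℝ} (hN : 0 < N) :
    MemLp (fun ξ => ((1 - cutoff N ξ : ℝ) : ℂ) * h ξ) 2 volume := by
  refine (hh.const_mul (((2 * Real.pi * N) ^ γ : ℝ) : ℂ)⁻¹).mono
    (Continuous.aestronglyMeasurable (Complex.continuous_ofReal.comp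
      (continuous_const.sub (continuous_cutoff N))) |>.mul hm) (ae_of_all _ fun ξ => ?_)
  have hp : 0 < (2 * Real.pi * N) ^ γ := by positivity
  simp only [norm_mul, norm_inv, Complex.norm_real]
  rw [Real.norm_of_nonneg hp.le, Real.norm_of_nonneg (symb_nonneg _ _),
    Real.norm_of_nonneg (by linarith [cutoff_le_one N ξ]), ← mul_assoc]
  gcongr
  rcases le_total ‖ξ‖ N with h | h
  · rw [cutoff_eq_one hN h, sub_self]
    exact mul_nonneg (by positivity) (symb_nonneg _ _)
  · rw [inv_mul_eq_div, le_div_iff₀ hp]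
    have h1 : (2 * Real.pi * N) ^ γ ≤ symb γ ξ := by unfold symb; gcongr
    nlinarith [cutoff_nonneg N ξ, cutoff_le_one N ξ]

/-- The high frequency part `f - P_{≤N} f` is square integrable, and its `L²` norm is controlled by
the part of the Fourier density outside the ball of radius `N`. -/
theorem lintegral_highPass_le {γ : ℝ} (h0 : 0 ≤ γ) {f h : 𝔼 → ℂ}
    (hf : IsTemperedFun f) (hh : IsFourierDensity γ f h) {N : ℝ} (hN : 0 < N) :
    ∫⁻ x, ‖f x - lowPass N f x‖ₑ ^ 2 ≤ ∫⁻ ξ in {ξ | N < ‖ξ‖}, ‖h ξ‖ₑ ^ 2 := by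
  have hu := memLp_highFreq h0 hh.1 hh.2.1 hN
  set u : 𝔼 → ℂ := fun ξ => ((1 - cutoff N ξ : ℝ) : ℂ) * h ξ with hu_def
  set r : Lp ℂ 2 (volume : Measure 𝔼) := 𝓕⁻ hu.toLp with hr
  have hlow := isTemperedFun_lowPass hf hN
  have hdiff : IsTemperedFun (fun x => f x - lowPass N f x) := by
    simpa [sub_eq_add_neg] using hf.add_smul hlow (-1)
  -- `f - P_{≤N} f` is the inverse Fourier transform of `(1 - χ(ξ/N)) h`, by testing both.
  have hae : ∀ᵐ x, f x - lowPass N f x = r x := by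
    refine ae_eq_of_integral_contDiff_smul_eq hdiff.locallyIntegrable
      ((Lp.memLp r).locallyIntegrable (by norm_num)) fun g hg hgc => ?_
    let ψ : 𝓢(𝔼, ℂ) := HasCompactSupport.toSchwartzMap (f := fun ξ => (g ξ : ℂ))
      (hgc.comp_left Complex.ofReal_zero) (Complex.ofRealCLM.contDiff.comp hg)
    have hψ (x : 𝔼) : ψ x = (g x : ℂ) := rfl
    have e1 : ∫ x, g x • (f x - lowPass N f x) = (∫ x, f x * ψ x) - ∫ x, lowPass N f x * ψ x := by
      rw [← integral_sub (hf.integrable_mul ψ) (hlow.integrable_mul ψ)]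
      congr 1 with x
      rw [hψ, Complex.real_smul]; ring
    have e2 : ∫ x, g x • r x = ∫ ξ, u ξ * (𝓕⁻ ψ) ξ := by
      have h2 := Lp.fourierInv_toTemperedDistribution_eq (hu.toLp)
      have h3 := congrArg (fun T => T ψ) h2
      simp only [TemperedDistribution.fourierInv_apply, Lp.toTemperedDistribution_apply] at h3
      rw [← hr] at h3
      rw [show ∫ x, g x • r x = ∫ x, ψ x • r x from by congr 1, ← h3]
      refine integral_congr_ae ?_
      filter_upwards [hu.coeFn_toLp] with ξ hξ
      rw [hξ, smul_eq_mul, mul_comm]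
    -- This test function vanishes near the origin, so it is admissible for every `γ`.
    have ha : Admissible γ (𝓕⁻ ψ - lowFreq N (𝓕⁻ ψ)) := by
      refine admissible_of_eventuallyEq_zero γ ?_
      filter_upwards [Metric.ball_mem_nhds 0 hN] with ξ hξ
      rw [sub_apply, lowFreq_apply hN, cutoff_eq_one hN (mem_ball_zero_iff.1 hξ).le]
      simp
    have e3 := hh.2.2 _ ha
    have e4 : 𝓕 (𝓕⁻ ψ - lowFreq N (𝓕⁻ ψ)) = ψ - 𝓕 (lowFreq N (𝓕⁻ ψ)) := by
      rw [sub_eq_add_neg, FourierTransform.fourier_add, FourierTransform.fourier_neg,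
        FourierTransform.fourier_fourierInv_eq, ← sub_eq_add_neg]
    rw [e1, e2, integral_lowPass_mul hf hN,
      ← integral_sub (hf.integrable_mul ψ) (hf.integrable_mul _)]
    rw [e4] at e3
    simp_rw [sub_apply, mul_sub] at e3
    rw [e3]
    congr 1 with ξ
    rw [lowFreq_apply hN, hu_def]
    push_cast
    ring
  calc ∫⁻ x, ‖f x - lowPass N f x‖ₑ ^ 2 = ∫⁻ x, ‖r x‖ₑ ^ 2 := by
        refine lintegral_congr_ae ?_
        filter_upwards [hae] with x hx
        rw [hx]
    _ = eLpNorm u 2 volume ^ 2 := by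
        have hn : ‖r‖ = ‖hu.toLp‖ := by
          rw [← Lp.norm_fourier_eq r, hr, FourierTransform.fourier_fourierInv_eq]
        rw [← eLpNorm_two_sq, ← Lp.enorm_def, ← eLpNorm_congr_ae hu.coeFn_toLp, ← Lp.enorm_def,
          ← ofReal_norm, hn, ofReal_norm]
    _ ≤ _ := by
        rw [eLpNorm_two_sq,
          ← lintegral_indicator (measurableSet_lt measurable_const measurable_norm)]
        refine lintegral_mono fun ξ => ?_
        by_cases hξ : N < ‖ξ‖
        · rw [indicator_of_mem (show ξ ∈ {ξ | N < ‖ξ‖} from hξ)]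
          gcongr
          rw [hu_def, enorm_mul]
          refine mul_le_of_le_one_left' ?_
          rw [← ofReal_norm, Complex.norm_real,
            Real.norm_of_nonneg (by linarith [cutoff_le_one N ξ])]
          exact ENNReal.ofReal_le_one.2 (by linarith [cutoff_nonneg N ξ])
        · rw [indicator_of_notMem (show ξ ∉ {ξ | N < ‖ξ‖} from hξ), hu_def]
          simp [cutoff_eq_one hN (not_lt.1 hξ)]

end LowPass

/-! ### The layer cake estimate and the Gagliardo–Nirenberg inequalities -/

section LayerCake

variable {d : ℕ}

local notation "𝔼" => EuclideanSpace ℝ (Fin d)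

theorem lintegral_indicator_rpow {q b c : ℝ} (hq : -1 < q) (hb : 0 ≤ b) (hc : 0 ≤ c) :
    ∫⁻ t in Ioi (0 : ℝ), (Iio b).indicator (fun t => ENNReal.ofReal (c * t ^ q)) t =
      ENNReal.ofReal (c * (b ^ (q + 1) / (q + 1))) := by
  rw [lintegral_indicator measurableSet_Iio, Measure.restrict_restrict measurableSet_Iio,
    inter_comm, Ioi_inter_Iio, restrict_Ioo_eq_restrict_Ioc]
  have hi : IntegrableOn (fun t : ℝ => c * t ^ q) (Ioc 0 b) volume :=
    ((intervalIntegrable_iff_integrableOn_Ioc_of_le hb).1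
      (intervalIntegral.intervalIntegrable_rpow' hq)).const_mul c
  rw [← ofReal_integral_eq_lintegral_ofReal hi, ← intervalIntegral.integral_of_le hb,
    intervalIntegral.integral_const_mul, integral_rpow (Or.inl hq)]
  · rw [Real.zero_rpow (by linarith), sub_zero]
  · filter_upwards [ae_restrict_mem measurableSet_Ioc] with t ht
    have := ht.1
    positivity

/-- If for every frequency `t` the function `F` is the sum of a part bounded by `C t^κ` and of a
part whose `L²` norm is at most that of `h` on `{|ξ| > t}`, then integrating the distribution
function of `F` over all levels, with `t` adapted to the level, bounds the `L^p` norm of `F` by a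
weighted `L²` norm of `h`. -/
theorem lintegral_rpow_le_of_decomposition {F h : 𝔼 → ℂ} (hF : AEStronglyMeasurable F volume)
    (hh : AEStronglyMeasurable h volume) {C κ p : ℝ} (hC : 0 < C) (hκ : 0 < κ) (hp : 2 < p)
    (H : ∀ t : ℝ, 0 < t → ∃ r : 𝔼 → ℂ, AEStronglyMeasurable r volume ∧
      (∀ᵐ x, ‖F x‖ ≤ C * t ^ κ + ‖r x‖) ∧
      ∫⁻ x, ‖r x‖ₑ ^ 2 ≤ ∫⁻ ξ in {ξ | t < ‖ξ‖}, ‖h ξ‖ₑ ^ 2) :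
    ∫⁻ x, ‖F x‖ₑ ^ p ≤ ENNReal.ofReal (4 * p / (p - 2) * (2 * C) ^ (p - 2)) *
      ∫⁻ ξ, ENNReal.ofReal (‖ξ‖ ^ (κ * (p - 2))) * ‖h ξ‖ₑ ^ 2 := by
  -- Chebyshev's inequality at level `l`, with the frequency `(l / 2C)^(1/κ)`.
  have hmeas (l : ℝ) (hl : 0 < l) : volume {x | l < ‖F x‖} ≤
      ENNReal.ofReal (4 / l ^ 2) * ∫⁻ ξ in {ξ | (l / (2 * C)) ^ κ⁻¹ < ‖ξ‖}, ‖h ξ‖ₑ ^ 2 := by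
    obtain ⟨r, hrm, hr1, hr2⟩ := H ((l / (2 * C)) ^ κ⁻¹) (by positivity)
    rw [← Real.rpow_mul (by positivity), inv_mul_cancel₀ hκ.ne', Real.rpow_one] at hr1
    have h1 : volume {x | l < ‖F x‖} ≤ volume {x | ENNReal.ofReal (l ^ 2 / 4) ≤ ‖r x‖ₑ ^ 2} := by
      refine measure_mono_ae ?_
      filter_upwards [hr1] with x hx hxl
      have hxl' : l < ‖F x‖ := hxl
      have h3 : C * (l / (2 * C)) = l / 2 := by field_simp
      have h2 : l / 2 ≤ ‖r x‖ := by linarith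
      show ENNReal.ofReal (l ^ 2 / 4) ≤ ‖r x‖ₑ ^ 2
      rw [← ofReal_norm, ← ENNReal.ofReal_pow (norm_nonneg _)]
      refine ENNReal.ofReal_le_ofReal ?_
      nlinarith
    have h2 := mul_meas_ge_le_lintegral₀ (hrm.enorm.pow_const 2) (ENNReal.ofReal (l ^ 2 / 4))
    have h3 := h2.trans hr2
    have h4 : ENNReal.ofReal (4 / l ^ 2) * ENNReal.ofReal (l ^ 2 / 4) = 1 := by
      rw [← ENNReal.ofReal_mul (by positivity), ← ENNReal.ofReal_one]
      congr 1; field_simp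
    calc volume {x | l < ‖F x‖} ≤ volume {x | ENNReal.ofReal (l ^ 2 / 4) ≤ ‖r x‖ₑ ^ 2} := h1
      _ = ENNReal.ofReal (4 / l ^ 2) * (ENNReal.ofReal (l ^ 2 / 4) *
          volume {x | ENNReal.ofReal (l ^ 2 / 4) ≤ ‖r x‖ₑ ^ 2}) := by
        rw [← mul_assoc, h4, one_mul]
      _ ≤ _ := by gcongr
  have h1 := lintegral_rpow_eq_lintegral_meas_lt_mul (μ := volume) (f := fun x => ‖F x‖)
    (ae_of_all _ fun x => norm_nonneg _) hF.norm.aemeasurable (p := p) (by linarith)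
  have h2 (x : 𝔼) : ENNReal.ofReal (‖F x‖ ^ p) = ‖F x‖ₑ ^ p := by
    rw [← ofReal_norm, ENNReal.ofReal_rpow_of_nonneg (norm_nonneg _) (by linarith)]
  simp_rw [h2] at h1
  rw [h1]
  have hset (l : ℝ) (hl : 0 < l) (ξ : 𝔼) :
      (l / (2 * C)) ^ κ⁻¹ < ‖ξ‖ ↔ l < 2 * C * ‖ξ‖ ^ κ := by
    rw [Real.rpow_inv_lt_iff_of_pos (by positivity) (norm_nonneg _) hκ, div_lt_iff₀ (by positivity),
      mul_comm]
  have hcalc : ∫⁻ l in Ioi (0 : ℝ), volume {x | l < ‖F x‖} * ENNReal.ofReal (l ^ (p - 1)) ≤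
      ∫⁻ l in Ioi (0 : ℝ), ∫⁻ ξ, (Iio (2 * C * ‖ξ‖ ^ κ)).indicator
        (fun l => ENNReal.ofReal (4 * l ^ (p - 3))) l * ‖h ξ‖ₑ ^ 2 := by
    refine setLIntegral_mono' measurableSet_Ioi fun l hl => ?_
    have hl' : 0 < l := hl
    have h3 : ENNReal.ofReal (4 / l ^ 2) * ENNReal.ofReal (l ^ (p - 1)) =
        ENNReal.ofReal (4 * l ^ (p - 3)) := by
      rw [← ENNReal.ofReal_mul (by positivity)]
      congr 1
      rw [show p - 1 = (p - 3) + 2 by ring, Real.rpow_add hl', Real.rpow_two]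
      field_simp
    calc _ ≤ (ENNReal.ofReal (4 / l ^ 2) * ∫⁻ ξ in {ξ | (l / (2 * C)) ^ κ⁻¹ < ‖ξ‖}, ‖h ξ‖ₑ ^ 2) *
          ENNReal.ofReal (l ^ (p - 1)) := by gcongr; exact hmeas l hl'
      _ = ENNReal.ofReal (4 * l ^ (p - 3)) *
          ∫⁻ ξ in {ξ | (l / (2 * C)) ^ κ⁻¹ < ‖ξ‖}, ‖h ξ‖ₑ ^ 2 := by rw [← h3]; ring
      _ = _ := by
        rw [← lintegral_indicator (measurableSet_lt measurable_const measurable_norm),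
          ← lintegral_const_mul' _ _ ENNReal.ofReal_ne_top]
        refine lintegral_congr fun ξ => ?_
        by_cases hξ : (l / (2 * C)) ^ κ⁻¹ < ‖ξ‖
        · rw [indicator_of_mem (show ξ ∈ {ξ | _ < ‖ξ‖} from hξ),
            indicator_of_mem (show l ∈ Iio _ from (hset l hl' ξ).1 hξ)]
        · rw [indicator_of_notMem (show ξ ∉ {ξ | _ < ‖ξ‖} from hξ),
            indicator_of_notMem (show l ∉ Iio _ from fun h => hξ ((hset l hl' ξ).2 h))]
          simp
  have hswap : ∫⁻ l in Ioi (0 : ℝ), ∫⁻ ξ, (Iio (2 * C * ‖ξ‖ ^ κ)).indicator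
        (fun l => ENNReal.ofReal (4 * l ^ (p - 3))) l * ‖h ξ‖ₑ ^ 2 =
      ∫⁻ ξ, ENNReal.ofReal (4 * ((2 * C * ‖ξ‖ ^ κ) ^ (p - 3 + 1) / (p - 3 + 1))) * ‖h ξ‖ₑ ^ 2 := by
    rw [lintegral_lintegral_swap]
    · refine lintegral_congr fun ξ => ?_
      rw [lintegral_mul_const' _ _ (by simp),
        lintegral_indicator_rpow (by linarith) (by positivity) (by norm_num)]
    · refine AEMeasurable.mul ?_ (hh.enorm.pow_const 2).comp_snd
      have hms : MeasurableSet {z : ℝ × 𝔼 | z.1 < 2 * C * ‖z.2‖ ^ κ} :=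
        measurableSet_lt (by fun_prop) (by fun_prop)
      have hmf : Measurable fun z : ℝ × 𝔼 => ENNReal.ofReal (4 * z.1 ^ (p - 3)) := by fun_prop
      exact (hmf.indicator hms).aemeasurable
  calc _ ≤ ENNReal.ofReal p * ∫⁻ ξ, ENNReal.ofReal
        (4 * ((2 * C * ‖ξ‖ ^ κ) ^ (p - 3 + 1) / (p - 3 + 1))) * ‖h ξ‖ₑ ^ 2 := by
        rw [← hswap]; gcongr
    _ = _ := by
        rw [← lintegral_const_mul' _ _ ENNReal.ofReal_ne_top,
          ← lintegral_const_mul' _ _ ENNReal.ofReal_ne_top]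
        refine lintegral_congr fun ξ => ?_
        rw [← mul_assoc, ← mul_assoc, ← ENNReal.ofReal_mul (by linarith),
          ← ENNReal.ofReal_mul (by
            have : 0 < p - 2 := by linarith
            positivity)]
        congr 2
        rw [show p - 3 + 1 = p - 2 by ring, Real.mul_rpow (by positivity) (by positivity),
          ← Real.rpow_mul (norm_nonneg _)]
        ring

end LayerCake

section Embedding

variable {d : ℕ}

local notation "𝔼" => EuclideanSpace ℝ (Fin d)

/-- The mass supercritical and energy subcritical range of the parameters: `0 < s < 1` and
`4s/d < α`, with `α < 4s/(d-2s)` if `2s < d`. -/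
structure Subcritical (d : ℕ) (s α : ℝ) : Prop where
  one_le : 1 ≤ d
  s_pos : 0 < s
  s_lt : s < 1
  lt_α : 4 * s / (d : ℝ) < α
  α_lt : 2 * s < (d : ℝ) → α < 4 * s / ((d : ℝ) - 2 * s)

namespace Subcritical

variable {s α : ℝ}

theorem d_pos (P : Subcritical d s α) : (0 : ℝ) < d := by exact_mod_cast P.one_le

theorem α_pos (P : Subcritical d s α) : 0 < α := by
  have := P.d_pos
  have := P.s_pos
  exact lt_trans (by positivity) P.lt_α

theorem crit_pos (P : Subcritical d s α) : 0 < critSobolev d s α := by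
  have h1 := P.lt_α
  have h2 := P.α_pos
  have h3 := P.d_pos
  rw [div_lt_iff₀ h3] at h1
  rw [critSobolev, sub_pos, div_lt_div_iff₀ h2 two_pos]
  linarith

theorem crit_lt_half (P : Subcritical d s α) : critSobolev d s α < d / 2 := by
  have h2 := P.α_pos
  have h3 := P.s_pos
  have : 0 < 2 * s / α := by positivity
  rw [critSobolev]; linarith

theorem crit_lt (P : Subcritical d s α) : critSobolev d s α < s := by
  rcases lt_or_ge (2 * s) d with h | h
  · have h1 := P.α_lt h
    have h2 := P.α_pos
    rw [lt_div_iff₀ (by linarith)] at h1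
    rw [critSobolev, sub_lt_comm, lt_div_iff₀ h2]
    linarith
  · have := P.crit_lt_half
    linarith

theorem crit_lt_one (P : Subcritical d s α) : critSobolev d s α < 1 := P.crit_lt.trans P.s_lt

theorem critLebesgue_eq (P : Subcritical d s α) : critLebesgue d s α = d * α / (2 * s) := by
  have h2 := P.α_pos
  have h3 := P.s_pos
  rw [critLebesgue, critSobolev]
  have : (d : ℝ) - 2 * (d / 2 - 2 * s / α) = 4 * s / α := by ring
  rw [this]; field_simp; ring

theorem two_lt_critLebesgue (P : Subcritical d s α) : 2 < critLebesgue d s α := by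
  have h1 := P.lt_α
  have h3 := P.s_pos
  rw [div_lt_iff₀ P.d_pos] at h1
  rw [P.critLebesgue_eq, lt_div_iff₀ (by positivity)]
  linarith

theorem critLebesgue_lt (P : Subcritical d s α) : critLebesgue d s α < α + 2 := by
  have h1 := P.crit_lt
  have h2 := P.α_pos
  have h3 := P.s_pos
  rw [critSobolev, sub_lt_comm, lt_div_iff₀ h2] at h1
  rw [P.critLebesgue_eq, div_lt_iff₀ (by positivity)]
  linarith

theorem div_critLebesgue (P : Subcritical d s α) : (d : ℝ) / critLebesgue d s α = 2 * s / α := by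
  have h2 := P.α_pos
  have h3 := P.s_pos
  have h4 := P.d_pos
  rw [P.critLebesgue_eq]; field_simp

theorem half_sub_crit : (d : ℝ) / 2 - critSobolev d s α = 2 * s / α := by
  rw [critSobolev]; ring

end Subcritical

theorem lebNorm_rpow {p : ℝ} (hp : 0 < p) (f : 𝔼 → ℂ) : lebNorm p f ^ p = ∫⁻ x, ‖f x‖ₑ ^ p := by
  rw [lebNorm, eLpNorm_eq_lintegral_rpow_enorm_toReal (by simpa using hp) ENNReal.ofReal_ne_top,
    ENNReal.toReal_ofReal hp.le, ← ENNReal.rpow_mul, one_div, inv_mul_cancel₀ hp.ne',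
    ENNReal.rpow_one]

theorem norm_rpow_le_symb {γ : ℝ} (h0 : 0 ≤ γ) (ξ : 𝔼) : ‖ξ‖ ^ γ ≤ symb γ ξ := by
  unfold symb
  gcongr
  nlinarith [norm_nonneg ξ, Real.pi_gt_three]

theorem lintegral_norm_rpow_mul_le {γ : ℝ} (h0 : 0 ≤ γ) (h : 𝔼 → ℂ) :
    ∫⁻ ξ, ENNReal.ofReal (‖ξ‖ ^ (2 * γ)) * ‖h ξ‖ₑ ^ 2 ≤
      eLpNorm (fun ξ => (symb γ ξ : ℂ) * h ξ) 2 volume ^ 2 := by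
  rw [eLpNorm_two_sq]
  refine lintegral_mono fun ξ => ?_
  rw [enorm_mul, mul_pow]
  gcongr
  rw [← ofReal_norm, Complex.norm_real, Real.norm_of_nonneg (symb_nonneg _ _),
    ← ENNReal.ofReal_pow (symb_nonneg _ _), ← symb_two_mul]
  exact ENNReal.ofReal_le_ofReal (norm_rpow_le_symb (by positivity) ξ)

/-- A density with `|ξ|^γ h ∈ L²` is integrable over bounded sets `A` on which `|ξ|^γ ≥ |ξ|^ρ` for
some `ρ < d/2`. -/
theorem exists_lintegral_density_le (hd : 1 ≤ d) {ρ : ℝ} (hρ : ρ < (d : ℝ) / 2) : ∃ C : ℝ, 0 < C ∧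
    ∀ (γ : ℝ) (h : 𝔼 → ℂ), AEStronglyMeasurable h volume → ∀ (R : ℝ), 0 < R →
    ∀ A : Set 𝔼, MeasurableSet A → (∀ ξ ∈ A, ‖ξ‖ < R ∧ (ξ ≠ 0 → ‖ξ‖ ^ ρ ≤ symb γ ξ)) →
    ∫⁻ ξ in A, ‖h ξ‖ₑ ≤ ENNReal.ofReal (C * R ^ ((d : ℝ) / 2 - ρ)) *
      eLpNorm (fun ξ => (symb γ ξ : ℂ) * h ξ) 2 volume := by
  set g : ℝ → 𝔼 → ℂ := fun R =>
    (Metric.ball (0 : 𝔼) R).indicator fun ξ => ((‖ξ‖ ^ (-ρ) : ℝ) : ℂ) with hg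
  have hgm (R : ℝ) : AEStronglyMeasurable (g R) volume :=
    (Measurable.indicator (by fun_prop) measurableSet_ball).aestronglyMeasurable
  have hg1 : eLpNorm (g 1) 2 volume < ⊤ := by
    have h1 : MemLp (g 1) 2 volume := by
      rw [hg, memLp_indicator_iff_restrict measurableSet_ball]
      refine (memLp_two_iff_integrable_sq_norm (Measurable.aestronglyMeasurable (by fun_prop))).2 ?_
      refine (integrableOn_ball_norm_rpow (d := d) hd (a := 2 * ρ) (by linarith) 1).congr
        (ae_of_all _ fun ξ => ?_)
      simp only [Complex.norm_real]
      rw [Real.norm_of_nonneg (by positivity), ← Real.rpow_natCast (‖ξ‖ ^ (-ρ)),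
        ← Real.rpow_mul (norm_nonneg _)]
      congr 1; push_cast; ring
    exact h1.2
  have hgR (R : ℝ) (hR : 0 < R) : eLpNorm (g R) 2 volume =
      ENNReal.ofReal (R ^ ((d : ℝ) / 2 - ρ)) * eLpNorm (g 1) 2 volume := by
    have hR' : 0 < R⁻¹ := by positivity
    have h1 := eLpNorm_affine ((R ^ (-ρ) : ℝ) : ℂ) hR' 0 (g 1) 2
    have h2 : g R = fun ξ => ((R ^ (-ρ) : ℝ) : ℂ) * g 1 (R⁻¹ • ξ + 0) := by
      ext ξ
      have h3 : ξ ∈ Metric.ball (0 : 𝔼) R ↔ R⁻¹ • ξ + 0 ∈ Metric.ball (0 : 𝔼) 1 := by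
        rw [add_zero, mem_ball_zero_iff, mem_ball_zero_iff, norm_inv_smul hR, div_lt_one hR]
      by_cases h4 : ξ ∈ Metric.ball (0 : 𝔼) R
      · rw [hg]
        simp only
        rw [indicator_of_mem h4, indicator_of_mem (h3.1 h4), add_zero, norm_inv_smul hR,
          ← Complex.ofReal_mul, ← Real.mul_rpow hR.le (by positivity)]
        congr 2
        field_simp
      · rw [hg]
        simp only
        rw [indicator_of_notMem h4, indicator_of_notMem (fun h => h4 (h3.2 h)), mul_zero]
    rw [h2, h1]
    congr 2
    rw [Complex.norm_real, Real.norm_of_nonneg (by positivity), Real.inv_rpow hR.le,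
      ← Real.rpow_neg hR.le, ← Real.rpow_add hR]
    congr 1
    simp
    ring
  refine ⟨(eLpNorm (g 1) 2 volume).toReal + 1, by positivity,
    fun γ h hh R hR A hA hAR => ?_⟩
  have hsm : AEStronglyMeasurable (fun ξ => (symb γ ξ : ℂ) * h ξ) volume :=
    (Complex.measurable_ofReal.comp (measurable_symb γ)).aestronglyMeasurable.mul hh
  calc ∫⁻ ξ in A, ‖h ξ‖ₑ ≤ ∫⁻ ξ, ‖((fun ξ => (symb γ ξ : ℂ) * h ξ) • g R) ξ‖ₑ := by
        rw [← lintegral_indicator hA]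
        refine lintegral_mono_ae ?_
        filter_upwards [ae_ne_zero hd] with ξ hξ
        by_cases hξA : ξ ∈ A
        · obtain ⟨h1, h2⟩ := hAR ξ hξA
          rw [indicator_of_mem hξA, Pi.smul_apply', smul_eq_mul, hg]
          simp only
          rw [indicator_of_mem (mem_ball_zero_iff.2 h1), enorm_mul, enorm_mul, mul_assoc, mul_comm,
            mul_assoc]
          refine le_mul_of_one_le_right' ?_
          rw [← ofReal_norm, ← ofReal_norm, Complex.norm_real, Complex.norm_real,
            Real.norm_of_nonneg (by positivity), Real.norm_of_nonneg (symb_nonneg _ _),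
            ← ENNReal.ofReal_mul (by positivity), ENNReal.one_le_ofReal,
            Real.rpow_neg (norm_nonneg _), inv_mul_eq_div]
          have := norm_pos_iff.2 hξ
          exact (one_le_div (by positivity)).2 (h2 hξ)
        · rw [indicator_of_notMem hξA]; exact zero_le
    _ = eLpNorm ((fun ξ => (symb γ ξ : ℂ) * h ξ) • g R) 1 volume :=
        eLpNorm_one_eq_lintegral_enorm.symm
    _ ≤ eLpNorm (fun ξ => (symb γ ξ : ℂ) * h ξ) 2 volume * eLpNorm (g R) 2 volume :=
        eLpNorm_smul_le_mul_eLpNorm (hgm R) hsm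
    _ ≤ _ := by
        rw [hgR R hR, mul_comm]
        gcongr
        rw [mul_comm, ENNReal.ofReal_mul (by positivity)]
        gcongr
        rw [← ENNReal.ofReal_toReal hg1.ne]
        refine ENNReal.ofReal_le_ofReal ?_
        simp

/-- The Gagliardo–Nirenberg inequality `‖f‖_{α+2}^{α+2} ≤ C ‖f‖_{α_c}^α ‖f‖_{Ḣ^s}^2`. Bernstein's
inequality bounds the low frequency part up to `t` by `C t^{2s/α} ‖f‖_{α_c}`, and the layer cake
estimate with `κ = 2s/α` produces exactly the weight `|ξ|^{2s}`. -/
theorem exists_gagliardoNirenberg {s α : ℝ} (P : Subcritical d s α) : ∃ C : ℝ, 0 < C ∧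
    ∀ f ∈ LebesgueClass d s α, lebNorm (α + 2) f ^ (α + 2) ≤
      ENNReal.ofReal C * (lebNorm (critLebesgue d s α) f ^ α * homSobolevNorm s f ^ 2) := by
  have hα := P.α_pos
  have hs := P.s_pos
  obtain ⟨C, hC0, hC⟩ := exists_lowPass_le_eLpNorm d (p := critLebesgue d s α)
    (by linarith [P.two_lt_critLebesgue])
  refine ⟨4 * (α + 2) / α * (2 * C) ^ α, by positivity, fun f hf => ?_⟩
  have hfd := fourierDensity_spec hf.2
  rcases eq_or_ne (lebNorm (critLebesgue d s α) f) 0 with h0 | h0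
  · have hf0 : f =ᵐ[volume] 0 := by
      rwa [lebNorm, eLpNorm_eq_zero_iff hf.2.1.aestronglyMeasurable] at h0
      simp; linarith [P.two_lt_critLebesgue]
    have : lebNorm (α + 2) f = 0 := by rw [lebNorm, eLpNorm_congr_ae hf0, eLpNorm_zero]
    rw [this, ENNReal.zero_rpow_of_pos (by linarith)]
    exact zero_le
  have hL : lebNorm (critLebesgue d s α) f ≠ ⊤ := hf.1.2.ne
  set L := (lebNorm (critLebesgue d s α) f).toReal with hLdef
  have hL0 : 0 < L := ENNReal.toReal_pos h0 hL
  have key := lintegral_rpow_le_of_decomposition (F := f) (h := fourierDensity s f)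
    hf.2.1.aestronglyMeasurable hfd.1 (C := C * L) (κ := 2 * s / α) (p := α + 2) (by positivity)
    (by positivity) (by linarith) fun t ht => by
      refine ⟨fun x => f x - lowPass t f x, hf.2.1.aestronglyMeasurable.sub
        (aestronglyMeasurable_lowPass hf.2.1 ht), ae_of_all _ fun x => ?_,
        lintegral_highPass_le hs.le hf.2.1 hfd ht⟩
      have h1 := hC f hf.1 t ht x
      rw [P.div_critLebesgue] at h1
      have h2 := norm_add_le (lowPass t f x) (f x - lowPass t f x)
      rw [add_sub_cancel] at h2
      linarith
  rw [lebNorm_rpow (by linarith)]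
  refine key.trans ?_
  have e1 : 2 * s / α * (α + 2 - 2) = 2 * s := by field_simp; ring
  have e2 : α + 2 - 2 = α := by ring
  rw [e1, e2]
  calc _ ≤ ENNReal.ofReal (4 * (α + 2) / α * (2 * (C * L)) ^ α) * homSobolevNorm s f ^ 2 := by
        gcongr; exact lintegral_norm_rpow_mul_le hs.le _
    _ = _ := by
        rw [← ENNReal.ofReal_toReal hL, ← hLdef, ENNReal.ofReal_rpow_of_pos hL0,
          ← mul_assoc 2 C L, Real.mul_rpow (by positivity) hL0.le, ← mul_assoc,
          ENNReal.ofReal_mul (by positivity), mul_assoc]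

/-- The Sobolev embedding `Ḣ^{s_c} ⊆ L^{α_c}`. The low frequency part up to `t` is bounded by
`C t^{2s/α} ‖f‖_{Ḣ^{s_c}}` through its Fourier integral, and the layer cake estimate applies. -/
theorem exists_sobolev {s α : ℝ} (P : Subcritical d s α) : ∃ C : ℝ, 0 < C ∧
    ∀ f ∈ HomSobolev d (critSobolev d s α), lebNorm (critLebesgue d s α) f ≤
      ENNReal.ofReal C * homSobolevNorm (critSobolev d s α) f := by
  have hα := P.α_pos
  have hs := P.s_pos
  have hd := P.one_le
  set σ := critSobolev d s α with hσ
  set q := critLebesgue d s α with hq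
  have hσ0 : 0 < σ := P.crit_pos
  have hσd : σ < d / 2 := P.crit_lt_half
  have hq2 : 2 < q := P.two_lt_critLebesgue
  have hq0 : 0 < q := by linarith
  obtain ⟨C, hC0, hC⟩ := exists_lintegral_density_le hd hσd
  set K := 4 * q / (q - 2) * (2 * (C * 2 ^ (2 * s / α))) ^ (q - 2) with hK
  have hK0 : 0 < K := by
    have : 0 < q - 2 := by linarith
    positivity
  refine ⟨K ^ q⁻¹, by positivity, fun f hf => ?_⟩
  have hfd := fourierDensity_spec hf
  have hlow (t : ℝ) (ht : 0 < t) (x : 𝔼) : ‖lowPass t f x‖ₑ ≤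
      ENNReal.ofReal (C * (2 * t) ^ (2 * s / α)) * homSobolevNorm σ f := by
    rw [lowPass_eq_integral hσd hfd]
    have h1 := hC σ _ hfd.1 (2 * t) (by positivity) (Metric.ball 0 (2 * t)) measurableSet_ball
      fun ξ hξ => ⟨mem_ball_zero_iff.1 hξ, fun _ => norm_rpow_le_symb hσ0.le ξ⟩
    rw [hσ, Subcritical.half_sub_crit, ← hσ] at h1
    refine (enorm_integral_le_lintegral_enorm _).trans (le_trans ?_ h1)
    rw [← lintegral_indicator measurableSet_ball]
    refine lintegral_mono fun ξ => ?_
    by_cases hξ : ξ ∈ Metric.ball (0 : 𝔼) (2 * t)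
    · rw [indicator_of_mem hξ, enorm_mul]
      refine mul_le_of_le_one_right' ?_
      rw [← ofReal_norm, norm_lowTest_apply ht]
      exact ENNReal.ofReal_le_one.2 (cutoff_le_one _ _)
    · rw [indicator_of_notMem hξ, enorm_mul, ← ofReal_norm (lowTest t x ξ), norm_lowTest_apply ht,
        cutoff_eq_zero ht (by simpa using hξ)]
      simp
  have hN : homSobolevNorm σ f ≠ ⊤ := (homSobolevNorm_lt_top hf).ne
  -- The bound below is applied with `M` slightly above the norm, so that `M > 0`.
  set M := (homSobolevNorm σ f).toReal with hM
  have hkey (ε : ℝ) (hε : 0 < ε) : lebNorm q f ^ q ≤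
      ENNReal.ofReal (K * (M + ε) ^ (q - 2)) * homSobolevNorm σ f ^ 2 := by
    have hMε : 0 < M + ε := by
      have : 0 ≤ M := ENNReal.toReal_nonneg
      linarith
    have key := lintegral_rpow_le_of_decomposition (F := f) (h := fourierDensity σ f)
      hf.1.aestronglyMeasurable hfd.1 (C := C * 2 ^ (2 * s / α) * (M + ε)) (κ := 2 * s / α) (p := q)
      (by positivity) (by positivity) hq2 fun t ht => by
        refine ⟨fun x => f x - lowPass t f x, hf.1.aestronglyMeasurable.sub
          (aestronglyMeasurable_lowPass hf.1 ht), ae_of_all _ fun x => ?_,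
          lintegral_highPass_le hσ0.le hf.1 hfd ht⟩
        have h1 := ENNReal.toReal_mono (ENNReal.mul_ne_top ENNReal.ofReal_ne_top hN) (hlow t ht x)
        rw [toReal_enorm, ENNReal.toReal_mul, ENNReal.toReal_ofReal (by positivity), ← hM,
          Real.mul_rpow two_pos.le ht.le] at h1
        have h2 := norm_add_le (lowPass t f x) (f x - lowPass t f x)
        rw [add_sub_cancel] at h2
        have h3 : C * (2 ^ (2 * s / α) * t ^ (2 * s / α)) * M ≤
            C * 2 ^ (2 * s / α) * (M + ε) * t ^ (2 * s / α) := by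
          rw [show C * 2 ^ (2 * s / α) * (M + ε) * t ^ (2 * s / α) =
            C * (2 ^ (2 * s / α) * t ^ (2 * s / α)) * (M + ε) by ring]
          gcongr
          linarith
        linarith
    rw [lebNorm_rpow hq0]
    refine key.trans ?_
    have e1 : 2 * s / α * (q - 2) = 2 * σ := by
      have h4 := P.div_critLebesgue
      rw [← hq] at h4
      have h5 : (d : ℝ) / 2 - σ = 2 * s / α := Subcritical.half_sub_crit
      have h6 : 2 * s / α * q = d := by rw [← h4]; field_simp
      linarith
    rw [e1]
    refine mul_le_mul' (ENNReal.ofReal_le_ofReal (le_of_eq ?_))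
      (lintegral_norm_rpow_mul_le hσ0.le _)
    rw [hK, ← mul_assoc 2, Real.mul_rpow (by positivity) hMε.le]
    ring
  have hlim : lebNorm q f ^ q ≤ ENNReal.ofReal (K * M ^ (q - 2)) * homSobolevNorm σ f ^ 2 := by
    have h1 : Tendsto (fun ε : ℝ => ENNReal.ofReal (K * (M + ε) ^ (q - 2)) *
        homSobolevNorm σ f ^ 2) (𝓝[>] 0)
        (𝓝 (ENNReal.ofReal (K * M ^ (q - 2)) * homSobolevNorm σ f ^ 2)) := by
      refine ENNReal.Tendsto.mul_const ?_ (Or.inr (ENNReal.pow_ne_top hN))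
      refine ENNReal.tendsto_ofReal ?_
      have h2 : Continuous fun ε : ℝ => K * (M + ε) ^ (q - 2) :=
        continuous_const.mul (Continuous.rpow_const (by fun_prop) fun _ => Or.inr (by linarith))
      have := h2.tendsto 0
      rw [add_zero] at this
      exact this.mono_left nhdsWithin_le_nhds
    refine ge_of_tendsto h1 ?_
    filter_upwards [self_mem_nhdsWithin] with ε hε using hkey ε hε
  have hM0 : 0 ≤ M := ENNReal.toReal_nonneg
  rw [← ENNReal.ofReal_toReal hN, ← hM, ← ENNReal.ofReal_pow hM0,
    ← ENNReal.ofReal_mul (by positivity), mul_assoc, ← Real.rpow_two,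
    ← Real.rpow_add_of_nonneg hM0 (by linarith) two_pos.le, sub_add_cancel] at hlim
  rw [← ENNReal.ofReal_toReal hN, ← hM, ← ENNReal.ofReal_mul (by positivity),
    ← ENNReal.rpow_le_rpow_iff hq0, ENNReal.ofReal_rpow_of_nonneg (by positivity) hq0.le,
    Real.mul_rpow (by positivity) hM0, ← Real.rpow_mul hK0.le, inv_mul_cancel₀ hq0.ne',
    Real.rpow_one]
  exact hlim

end Embedding

/-! ### Nonvanishing of a low frequency part -/

section Nonvanishing

variable {d : ℕ}

local notation "𝔼" => EuclideanSpace ℝ (Fin d)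

/-- The `L^{α+2}` norm of the high frequency part is uniformly small. Bernstein's inequality at the
level of `Ḣ^s` gives `|P_{≤t} f| ≤ C t^κ` at high frequencies `t` with an exponent `κ` strictly
below the scale invariant exponent `2s/α`; the gain is a negative power of `N`. -/
theorem exists_highPass_le {s α : ℝ} (P : Subcritical d s α) {B : ℝ} (hB : 0 < B) :
    ∃ K ε : ℝ, 0 < K ∧ 0 < ε ∧ ∀ f ∈ HomSobolev d s,
      homSobolevNorm s f ≤ ENNReal.ofReal B → ∀ N : ℝ, 1 ≤ N →
      ∫⁻ x, ‖f x - lowPass N f x‖ₑ ^ (α + 2) ≤ ENNReal.ofReal (K * N ^ (-ε)) := by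
  have hα := P.α_pos
  have hs := P.s_pos
  have hd := P.one_le
  have hβ : 0 < 2 * s / α := by positivity
  -- `κ ≥ d/2 - s` is needed for the bound by the `Ḣ^s` norm, `κ < 2s/α` for the gain.
  set κ := max ((d : ℝ) / 2 - s) (2 * s / α / 2) with hκdef
  have hκ0 : 0 < κ := lt_max_of_lt_right (by positivity)
  have hκβ : κ < 2 * s / α := by
    refine max_lt ?_ (by linarith)
    have h1 := P.crit_lt
    have h2 : (d : ℝ) / 2 - critSobolev d s α = 2 * s / α := Subcritical.half_sub_crit
    linarith
  have hκs : (d : ℝ) / 2 - κ ≤ s := by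
    have : (d : ℝ) / 2 - s ≤ κ := le_max_left _ _
    linarith
  obtain ⟨C, hC0, hC⟩ := exists_lintegral_density_le hd (ρ := (d : ℝ) / 2 - κ) (by linarith)
  rw [sub_sub_cancel] at hC
  have hε : 0 < 2 * s - κ * α := by
    rw [lt_div_iff₀ hα] at hκβ
    linarith
  refine ⟨4 * (α + 2) / α * (2 * (C * 2 ^ κ * B)) ^ α * B ^ 2, 2 * s - κ * α, by positivity, hε,
    fun f hf hfB N hN => ?_⟩
  have hN0 : 0 < N := by linarith
  have hfd := fourierDensity_spec hf
  set h := fourierDensity s f with hh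
  set h' : 𝔼 → ℂ := {ξ | N < ‖ξ‖}.indicator h with hh'
  have hms (t : ℝ) : MeasurableSet {ξ : 𝔼 | t < ‖ξ‖} :=
    measurableSet_lt measurable_const measurable_norm
  have hsq : (fun ξ => ‖h' ξ‖ₑ ^ 2) = {ξ | N < ‖ξ‖}.indicator fun ξ => ‖h ξ‖ₑ ^ 2 := by
    ext ξ
    by_cases hξ : ξ ∈ {ξ : 𝔼 | N < ‖ξ‖}
    · rw [indicator_of_mem hξ, hh', indicator_of_mem hξ]
    · rw [indicator_of_notMem hξ, hh', indicator_of_notMem hξ]; simp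
  have hint (t : ℝ) : ∫⁻ ξ in {ξ | t < ‖ξ‖}, ‖h' ξ‖ₑ ^ 2 =
      ∫⁻ ξ in {ξ | N < ‖ξ‖ ∧ t < ‖ξ‖}, ‖h ξ‖ₑ ^ 2 := by
    rw [hsq, lintegral_indicator (hms N), Measure.restrict_restrict (hms N)]
    rfl
  have hlow (M : ℝ) (hM : 0 < M) := aestronglyMeasurable_lowPass hf.1 hM
  have hFm : AEStronglyMeasurable (fun x => f x - lowPass N f x) volume :=
    hf.1.aestronglyMeasurable.sub (hlow N hN0)
  have key := lintegral_rpow_le_of_decomposition (F := fun x => f x - lowPass N f x) (h := h')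
    hFm (hfd.1.indicator (hms N)) (C := C * 2 ^ κ * B) (κ := κ) (p := α + 2) (by positivity)
    hκ0 (by linarith) fun t ht => by
      rcases lt_or_ge t N with htN | htN
      · refine ⟨_, hFm, ae_of_all _ fun x => ?_, ?_⟩
        · have : 0 ≤ C * 2 ^ κ * B * t ^ κ := by positivity
          linarith
        · rw [hint]
          have : {ξ : 𝔼 | N < ‖ξ‖ ∧ t < ‖ξ‖} = {ξ | N < ‖ξ‖} := by
            ext ξ; exact ⟨fun h => h.1, fun h => ⟨h, htN.trans h⟩⟩
          rw [this]
          exact lintegral_highPass_le hs.le hf.1 hfd hN0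
      · refine ⟨fun x => f x - lowPass t f x, hf.1.aestronglyMeasurable.sub (hlow t ht),
          ae_of_all _ fun x => ?_, ?_⟩
        · have h1 : ‖lowPass t f x - lowPass N f x‖ₑ ≤
              ENNReal.ofReal (C * (2 * t) ^ κ) * ENNReal.ofReal B := by
            rw [lowPass_sub_lowPass hf.1 hfd hN0 htN]
            have hA : MeasurableSet {ξ : 𝔼 | 1 ≤ ‖ξ‖ ∧ ‖ξ‖ < 2 * t} :=
              (measurableSet_le measurable_const measurable_norm).inter
                (measurableSet_lt measurable_norm measurable_const)
            have h2 := hC s h hfd.1 (2 * t) (by positivity) {ξ | 1 ≤ ‖ξ‖ ∧ ‖ξ‖ < 2 * t} hA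
              fun ξ hξ => ⟨hξ.2, fun _ =>
                (Real.rpow_le_rpow_of_exponent_le hξ.1 hκs).trans (norm_rpow_le_symb hs.le ξ)⟩
            refine (enorm_integral_le_lintegral_enorm _).trans
              (le_trans ?_ (h2.trans (by gcongr; exact hfB)))
            rw [← lintegral_indicator hA]
            refine lintegral_mono fun ξ => ?_
            have h3 : (lowTest t x - lowTest N x) ξ =
                (Real.fourierChar ⟪x, ξ⟫ : ℂ) * ((cutoff t ξ - cutoff N ξ : ℝ) : ℂ) := by
              rw [sub_apply, lowTest_apply ht, lowTest_apply hN0]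
              push_cast; ring
            by_cases hξ : ξ ∈ {ξ : 𝔼 | 1 ≤ ‖ξ‖ ∧ ‖ξ‖ < 2 * t}
            · rw [indicator_of_mem hξ, enorm_mul]
              refine mul_le_of_le_one_right' ?_
              rw [h3, ← ofReal_norm, norm_mul, Circle.norm_coe, one_mul, Complex.norm_real]
              refine ENNReal.ofReal_le_one.2 (abs_le.2 ⟨?_, ?_⟩) <;>
              linarith [cutoff_le_one t ξ, cutoff_le_one N ξ, cutoff_nonneg t ξ, cutoff_nonneg N ξ]
            · have h4 : cutoff t ξ - cutoff N ξ = 0 := by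
                rcases lt_or_ge ‖ξ‖ 1 with h5 | h5
                · rw [cutoff_eq_one ht (by linarith), cutoff_eq_one hN0 (by linarith), sub_self]
                · have h6 : 2 * t ≤ ‖ξ‖ := not_lt.1 fun h6 => hξ ⟨h5, h6⟩
                  rw [cutoff_eq_zero ht h6, cutoff_eq_zero hN0 (by linarith), sub_self]
              rw [h3, h4]
              simp
          have h2 := ENNReal.toReal_mono (ENNReal.mul_ne_top ENNReal.ofReal_ne_top
            ENNReal.ofReal_ne_top) h1
          rw [toReal_enorm, ENNReal.toReal_mul, ENNReal.toReal_ofReal (by positivity),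
            ENNReal.toReal_ofReal hB.le, Real.mul_rpow two_pos.le ht.le] at h2
          have h3 := norm_add_le (lowPass t f x - lowPass N f x) (f x - lowPass t f x)
          rw [show lowPass t f x - lowPass N f x + (f x - lowPass t f x) = f x - lowPass N f x by
            ring] at h3
          linarith
        · rw [hint]
          have : {ξ : 𝔼 | N < ‖ξ‖ ∧ t < ‖ξ‖} = {ξ | t < ‖ξ‖} := by
            ext ξ; exact ⟨fun h => h.2, fun h => ⟨htN.trans_lt h, h⟩⟩
          rw [this]
          exact lintegral_highPass_le hs.le hf.1 hfd ht
  have e2 : α + 2 - 2 = α := by ring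
  rw [e2] at key
  refine key.trans ?_
  have hw : ∫⁻ ξ, ENNReal.ofReal (‖ξ‖ ^ (κ * α)) * ‖h' ξ‖ₑ ^ 2 ≤
      ENNReal.ofReal (N ^ (-(2 * s - κ * α))) * ENNReal.ofReal B ^ 2 := by
    calc _ ≤ ∫⁻ ξ, ENNReal.ofReal (N ^ (-(2 * s - κ * α))) *
          (ENNReal.ofReal (‖ξ‖ ^ (2 * s)) * ‖h ξ‖ₑ ^ 2) := by
          refine lintegral_mono fun ξ => ?_
          simp only [congrFun hsq ξ]
          by_cases hξ : ξ ∈ {ξ : 𝔼 | N < ‖ξ‖}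
          · rw [indicator_of_mem hξ, ← mul_assoc, ← ENNReal.ofReal_mul (by positivity)]
            gcongr
            have h1 : N ≤ ‖ξ‖ := le_of_lt hξ
            have h2 : 0 < ‖ξ‖ := hN0.trans_le h1
            calc ‖ξ‖ ^ (κ * α) = ‖ξ‖ ^ (-(2 * s - κ * α)) * ‖ξ‖ ^ (2 * s) := by
                  rw [← Real.rpow_add h2]; congr 1; ring
              _ ≤ _ := by
                  refine mul_le_mul_of_nonneg_right ?_ (by positivity)
                  exact Real.rpow_le_rpow_of_nonpos hN0 h1 (by linarith)
          · rw [indicator_of_notMem hξ]; simp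
      _ ≤ _ := by
          rw [lintegral_const_mul' _ _ ENNReal.ofReal_ne_top]
          gcongr
          refine (lintegral_norm_rpow_mul_le hs.le h).trans ?_
          gcongr
          exact hfB
  calc _ ≤ ENNReal.ofReal (4 * (α + 2) / α * (2 * (C * 2 ^ κ * B)) ^ α) *
        (ENNReal.ofReal (N ^ (-(2 * s - κ * α))) * ENNReal.ofReal B ^ 2) := by gcongr
    _ = _ := by
        rw [← ENNReal.ofReal_pow hB.le, ← ENNReal.ofReal_mul (by positivity),
          ← ENNReal.ofReal_mul (by positivity)]
        congr 1; ring

/-- A function bounded in `L^{α_c} ∩ Ḣ^s` whose `L^{α+2}` norm is bounded below has a low frequency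
part which is bounded below at some point. The frequency and the lower bound are uniform. -/
theorem exists_lowPass_ge {s α : ℝ} (P : Subcritical d s α) {A B c : ℝ} (hA : 0 < A) (hB : 0 < B)
    (hc : 0 < c) : ∃ N η : ℝ, 0 < N ∧ 0 < η ∧ ∀ f ∈ LebesgueClass d s α,
      lebNorm (critLebesgue d s α) f ≤ ENNReal.ofReal A →
      homSobolevNorm s f ≤ ENNReal.ofReal B → ENNReal.ofReal c ≤ lebNorm (α + 2) f ^ (α + 2) →
      ∃ x, η ≤ ‖lowPass N f x‖ := by
  have hα := P.α_pos
  set q := critLebesgue d s α with hq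
  have hq2 : 2 < q := P.two_lt_critLebesgue
  have hqα : q < α + 2 := P.critLebesgue_lt
  obtain ⟨K, ε, hK, hε, hKε⟩ := exists_highPass_le P hB
  obtain ⟨N, hN1, hN⟩ : ∃ N : ℝ, 1 ≤ N ∧ 2 ^ (α + 2) * (K * N ^ (-ε)) < c / 2 := by
    have h1 : Tendsto (fun N : ℝ => 2 ^ (α + 2) * (K * N ^ (-ε))) atTop
        (𝓝 (2 ^ (α + 2) * (K * 0))) :=
      ((tendsto_rpow_neg_atTop hε).const_mul K).const_mul _
    rw [mul_zero, mul_zero] at h1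
    exact ((eventually_ge_atTop 1).and (h1.eventually_lt_const (by positivity))).exists
  obtain ⟨η, hη0, hη⟩ : ∃ η : ℝ, 0 < η ∧ (2 * η) ^ (α + 2 - q) * A ^ q < c / 2 := by
    have h2 : Continuous fun η : ℝ => (2 * η) ^ (α + 2 - q) * A ^ q :=
      (Continuous.rpow_const (by fun_prop) fun _ => Or.inr (by linarith)).mul continuous_const
    have h1 := (h2.tendsto 0).mono_left (nhdsWithin_le_nhds (s := Ioi 0))
    rw [mul_zero, Real.zero_rpow (by linarith), zero_mul] at h1
    have h3 := (h1.eventually_lt_const (show (0 : ℝ) < c / 2 by positivity)).and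
      self_mem_nhdsWithin
    obtain ⟨η, h4, h5⟩ := h3.exists
    exact ⟨η, h5, h4⟩
  refine ⟨N, η, by linarith, hη0, fun f hf hfA hfB hfc => ?_⟩
  by_contra! hcon
  -- Where `|f| > 2η` the high frequency part is at least `|f| / 2`; elsewhere `|f|` is small.
  have hpt (x : 𝔼) : ‖f x‖ₑ ^ (α + 2) ≤ ENNReal.ofReal ((2 * η) ^ (α + 2 - q)) * ‖f x‖ₑ ^ q +
      ENNReal.ofReal (2 ^ (α + 2)) * ‖f x - lowPass N f x‖ₑ ^ (α + 2) := by
    have e1 (z : ℂ) {p : ℝ} (hp : 0 ≤ p) : ‖z‖ₑ ^ p = ENNReal.ofReal (‖z‖ ^ p) := by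
      rw [← ofReal_norm, ENNReal.ofReal_rpow_of_nonneg (norm_nonneg _) hp]
    rw [e1 _ (by linarith : 0 ≤ α + 2), e1 _ (by linarith : 0 ≤ q),
      e1 _ (by linarith : 0 ≤ α + 2), ← ENNReal.ofReal_mul (by positivity),
      ← ENNReal.ofReal_mul (by positivity), ← ENNReal.ofReal_add (by positivity) (by positivity)]
    refine ENNReal.ofReal_le_ofReal ?_
    rcases le_or_gt ‖f x‖ (2 * η) with h | h
    · have h1 : ‖f x‖ ^ (α + 2) = ‖f x‖ ^ (α + 2 - q) * ‖f x‖ ^ q := by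
        rw [← Real.rpow_add_of_nonneg (norm_nonneg _) (by linarith) (by linarith), sub_add_cancel]
      have h2 : ‖f x‖ ^ (α + 2 - q) ≤ (2 * η) ^ (α + 2 - q) := by gcongr
      have h3 : 0 ≤ 2 ^ (α + 2) * ‖f x - lowPass N f x‖ ^ (α + 2) := by positivity
      have h4 : 0 ≤ ‖f x‖ ^ q := by positivity
      rw [h1]
      nlinarith
    · have h1 := norm_add_le (lowPass N f x) (f x - lowPass N f x)
      rw [add_sub_cancel] at h1
      have h2 := hcon x
      have h3 : ‖f x‖ ≤ 2 * ‖f x - lowPass N f x‖ := by linarith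
      have h4 : ‖f x‖ ^ (α + 2) ≤ (2 * ‖f x - lowPass N f x‖) ^ (α + 2) := by gcongr
      rw [Real.mul_rpow two_pos.le (norm_nonneg _)] at h4
      have h5 : 0 ≤ (2 * η) ^ (α + 2 - q) * ‖f x‖ ^ q := by positivity
      linarith
  have h1 : lebNorm (α + 2) f ^ (α + 2) ≤ ENNReal.ofReal ((2 * η) ^ (α + 2 - q) * A ^ q +
      2 ^ (α + 2) * (K * N ^ (-ε))) := by
    rw [lebNorm_rpow (by linarith)]
    calc _ ≤ ∫⁻ x, (ENNReal.ofReal ((2 * η) ^ (α + 2 - q)) * ‖f x‖ₑ ^ q +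
          ENNReal.ofReal (2 ^ (α + 2)) * ‖f x - lowPass N f x‖ₑ ^ (α + 2)) := lintegral_mono hpt
      _ = ENNReal.ofReal ((2 * η) ^ (α + 2 - q)) * lebNorm q f ^ q + ENNReal.ofReal (2 ^ (α + 2)) *
          ∫⁻ x, ‖f x - lowPass N f x‖ₑ ^ (α + 2) := by
          rw [lintegral_add_left' (((hf.1.1.enorm).pow_const q).const_mul _),
            lintegral_const_mul' _ _ ENNReal.ofReal_ne_top,
            lintegral_const_mul' _ _ ENNReal.ofReal_ne_top, lebNorm_rpow (by linarith)]
      _ ≤ ENNReal.ofReal ((2 * η) ^ (α + 2 - q)) * ENNReal.ofReal A ^ q +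
          ENNReal.ofReal (2 ^ (α + 2)) * ENNReal.ofReal (K * N ^ (-ε)) := by
          gcongr
          exact hKε f hf.2 hfB N hN1
      _ = _ := by
          rw [ENNReal.ofReal_rpow_of_pos hA, ← ENNReal.ofReal_mul (by positivity),
            ← ENNReal.ofReal_mul (by positivity),
            ← ENNReal.ofReal_add (by positivity) (by positivity)]
  have h2 := (ENNReal.ofReal_le_ofReal_iff (by positivity)).1 (hfc.trans h1)
  linarith

end Nonvanishing

/-! ### The Brezis–Lieb lemma -/

section BrezisLieb

/-- Convexity of `t ↦ t ^ p`, with a factor close to `1` on the first term. -/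
theorem exists_norm_add_rpow_le {p ε : ℝ} (hp : 1 ≤ p) (hε : 0 < ε) : ∃ C : ℝ, 0 ≤ C ∧
    ∀ a b : ℂ, ‖a + b‖ ^ p ≤ (1 + ε) * ‖a‖ ^ p + C * ‖b‖ ^ p := by
  obtain ⟨θ, hθ, hθ0, hθ1⟩ : ∃ θ : ℝ, (1 - θ) ^ (1 - p) < 1 + ε ∧ 0 < θ ∧ θ < 1 := by
    have h1 : ContinuousAt (fun θ : ℝ => (1 - θ) ^ (1 - p)) 0 :=
      ContinuousAt.rpow_const (by fun_prop) (Or.inl (by norm_num))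
    have h2 := h1.tendsto.mono_left (nhdsWithin_le_nhds (s := Ioi 0))
    simp only [sub_zero, Real.one_rpow] at h2
    have h3 := (h2.eventually_lt_const (show (1 : ℝ) < 1 + ε by linarith)).and
      (Ioo_mem_nhdsGT one_pos)
    obtain ⟨θ, h4, h5⟩ := h3.exists
    exact ⟨θ, h4, h5.1, h5.2⟩
  refine ⟨θ ^ (1 - p), by positivity, fun a b => ?_⟩
  have h1θ : 0 < 1 - θ := by linarith
  have hconv := (convexOn_rpow hp).2 (x := ‖a‖ / (1 - θ)) (y := ‖b‖ / θ)
    (by simp only [mem_Ici]; positivity) (by simp only [mem_Ici]; positivity) h1θ.le hθ0.le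
    (by ring)
  simp only [smul_eq_mul] at hconv
  have e1 : (1 - θ) * (‖a‖ / (1 - θ)) + θ * (‖b‖ / θ) = ‖a‖ + ‖b‖ := by field_simp
  have e2 (t x : ℝ) (ht : 0 < t) (hx : 0 ≤ x) : t * (x / t) ^ p = t ^ (1 - p) * x ^ p := by
    rw [Real.div_rpow hx ht.le, Real.rpow_sub ht, Real.rpow_one]; ring
  rw [e1, e2 _ _ h1θ (norm_nonneg _), e2 _ _ hθ0 (norm_nonneg _)] at hconv
  calc ‖a + b‖ ^ p ≤ (‖a‖ + ‖b‖) ^ p := by gcongr; exact norm_add_le _ _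
    _ ≤ _ := hconv
    _ ≤ _ := by gcongr

/-- The elementary inequality behind the Brezis–Lieb lemma. -/
theorem exists_abs_norm_add_rpow_sub_le {p ε : ℝ} (hp : 1 ≤ p) (hε : 0 < ε) : ∃ C : ℝ, 0 ≤ C ∧
    ∀ a b : ℂ, |‖a + b‖ ^ p - ‖a‖ ^ p| ≤ ε * ‖a‖ ^ p + C * ‖b‖ ^ p := by
  set δ := min 1 (ε / 2) with hδ
  have hδ0 : 0 < δ := lt_min one_pos (by linarith)
  have hδ1 : δ ≤ 1 := min_le_left _ _
  have hδε : δ ≤ ε / 2 := min_le_right _ _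
  obtain ⟨C, hC0, hC⟩ := exists_norm_add_rpow_le hp hδ0
  refine ⟨2 * C, by positivity, fun a b => ?_⟩
  have h1 := hC a b
  have h2 := hC (a + b) (-b)
  rw [norm_neg, add_neg_cancel_right] at h2
  have ha : 0 ≤ ‖a‖ ^ p := by positivity
  have hb : 0 ≤ ‖b‖ ^ p := by positivity
  have hab : 0 ≤ ‖a + b‖ ^ p := by positivity
  have hCb : 0 ≤ C * ‖b‖ ^ p := by positivity
  rw [abs_le]
  constructor
  · have h3 : δ * ‖a + b‖ ^ p ≤ δ * ((1 + δ) * ‖a‖ ^ p + C * ‖b‖ ^ p) := by gcongr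
    have h4 : δ * ((1 + δ) * ‖a‖ ^ p) ≤ ε * ‖a‖ ^ p := by
      rw [← mul_assoc]; gcongr; nlinarith
    have h5 : δ * (C * ‖b‖ ^ p) ≤ C * ‖b‖ ^ p := mul_le_of_le_one_left hCb hδ1
    linarith
  · have h4 : δ * ‖a‖ ^ p ≤ ε * ‖a‖ ^ p := by gcongr; linarith
    linarith

variable {X : Type*} [MeasurableSpace X] {μ : Measure X}

theorem toReal_eLpNorm_rpow {p : ℝ} (hp : 0 < p) {f : X → ℂ}
    (hf : MemLp f (ENNReal.ofReal p) μ) :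
    (eLpNorm f (ENNReal.ofReal p) μ).toReal ^ p = ∫ x, ‖f x‖ ^ p ∂μ := by
  rw [hf.eLpNorm_eq_integral_rpow_norm (by simpa using hp) ENNReal.ofReal_ne_top,
    ENNReal.toReal_ofReal hp.le, ENNReal.toReal_ofReal (by positivity),
    ← Real.rpow_mul (integral_nonneg fun x => by positivity), inv_mul_cancel₀ hp.ne', Real.rpow_one]

theorem integrable_norm_rpow_ofReal {p : ℝ} (hp : 0 < p) {f : X → ℂ}
    (hf : MemLp f (ENNReal.ofReal p) μ) : Integrable (fun x => ‖f x‖ ^ p) μ := by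
  have := hf.integrable_norm_rpow (by simpa using hp) ENNReal.ofReal_ne_top
  rwa [ENNReal.toReal_ofReal hp.le] at this

/-- The Brezis–Lieb lemma: for a bounded sequence in `L^p` which converges almost everywhere, the
`p`-th powers of the norms split. The part of the defect not absorbed by `δ |f_n - g|^p` is
dominated by a multiple of `|g|^p`, so dominated convergence applies to it. -/
theorem brezis_lieb {p : ℝ} (hp : 1 ≤ p) {f : ℕ → X → ℂ} {g : X → ℂ}
    (hf : ∀ n, MemLp (f n) (ENNReal.ofReal p) μ) (hg : MemLp g (ENNReal.ofReal p) μ) {M : ℝ≥0∞}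
    (hM : M ≠ ⊤) (hfM : ∀ n, eLpNorm (f n) (ENNReal.ofReal p) μ ≤ M)
    (hlim : ∀ᵐ x ∂μ, Tendsto (fun n => f n x) atTop (𝓝 (g x))) :
    Tendsto (fun n => (eLpNorm (f n) (ENNReal.ofReal p) μ).toReal ^ p -
      (eLpNorm (fun x => f n x - g x) (ENNReal.ofReal p) μ).toReal ^ p) atTop
      (𝓝 ((eLpNorm g (ENNReal.ofReal p) μ).toReal ^ p)) := by
  have hp0 : 0 < p := by linarith
  have hd (n : ℕ) : MemLp (fun x => f n x - g x) (ENNReal.ofReal p) μ := (hf n).sub hg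
  have hp1 : 1 ≤ ENNReal.ofReal p := by simpa using hp
  set B : ℝ := ((M + eLpNorm g (ENNReal.ofReal p) μ).toReal) ^ p with hB
  have hdB (n : ℕ) : ∫ x, ‖f n x - g x‖ ^ p ∂μ ≤ B := by
    rw [← toReal_eLpNorm_rpow hp0 (hd n), hB]
    gcongr
    · exact ENNReal.add_ne_top.2 ⟨hM, hg.2.ne⟩
    · exact (eLpNorm_sub_le (hf n).1 hg.1 hp1).trans (by gcongr; exact hfM n)
  simp_rw [toReal_eLpNorm_rpow hp0 (hf _), toReal_eLpNorm_rpow hp0 (hd _),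
    toReal_eLpNorm_rpow hp0 hg]
  have iF (n : ℕ) := integrable_norm_rpow_ofReal hp0 (hf n)
  have iD (n : ℕ) := integrable_norm_rpow_ofReal hp0 (hd n)
  have iG := integrable_norm_rpow_ofReal hp0 hg
  have hB0 : 0 ≤ B := by positivity
  rw [Metric.tendsto_atTop]
  intro ε hε
  set δ := ε / (2 * (B + 1)) with hδ
  have hδ0 : 0 < δ := by positivity
  obtain ⟨C, hC0, hC⟩ := exists_abs_norm_add_rpow_sub_le hp hδ0
  -- The excess of the Brezis–Lieb defect over a small multiple of `|f_n - g|^p`.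
  set W : ℕ → X → ℝ := fun n x =>
    max (|‖f n x‖ ^ p - ‖f n x - g x‖ ^ p - ‖g x‖ ^ p| - δ * ‖f n x - g x‖ ^ p) 0 with hW
  have hWi (n : ℕ) : Integrable (W n) μ :=
    ((((iF n).sub (iD n)).sub iG).abs.sub ((iD n).const_mul δ)).sup (integrable_zero _ _ _)
  have hWb (n : ℕ) (x : X) : W n x ≤ (C + 1) * ‖g x‖ ^ p := by
    refine max_le ?_ (by positivity)
    have h1 := hC (f n x - g x) (g x)
    rw [sub_add_cancel] at h1
    have h2 := abs_sub (‖f n x‖ ^ p - ‖f n x - g x‖ ^ p) (‖g x‖ ^ p)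
    rw [abs_of_nonneg (by positivity : 0 ≤ ‖g x‖ ^ p)] at h2
    linarith
  have hWlim : Tendsto (fun n => ∫ x, W n x ∂μ) atTop (𝓝 (∫ _, (0 : ℝ) ∂μ)) := by
    refine tendsto_integral_of_dominated_convergence (fun x => (C + 1) * ‖g x‖ ^ p)
      (fun n => (hWi n).1) (iG.const_mul _) (fun n => ae_of_all _ fun x => ?_) ?_
    · rw [Real.norm_of_nonneg (le_max_right _ _)]
      exact hWb n x
    · filter_upwards [hlim] with x hx
      have h1 : Tendsto (fun n => ‖f n x‖ ^ p) atTop (𝓝 (‖g x‖ ^ p)) :=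
        hx.norm.rpow_const (Or.inr hp0.le)
      have h2 : Tendsto (fun n => ‖f n x - g x‖ ^ p) atTop (𝓝 0) := by
        have := (hx.sub_const (g x)).norm.rpow_const (p := p) (Or.inr hp0.le)
        rwa [sub_self, norm_zero, Real.zero_rpow hp0.ne'] at this
      have h3 := (((h1.sub h2).sub_const (‖g x‖ ^ p)).abs.sub (h2.const_mul δ)).max
        (tendsto_const_nhds (x := (0 : ℝ)))
      simpa using h3
  rw [integral_zero] at hWlim
  obtain ⟨n₀, hn₀⟩ := eventually_atTop.1 (hWlim.eventually_lt_const (half_pos hε))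
  refine ⟨n₀, fun n hn => ?_⟩
  have hsub : ∫ x, ‖f n x‖ ^ p ∂μ - ∫ x, ‖f n x - g x‖ ^ p ∂μ - ∫ x, ‖g x‖ ^ p ∂μ =
      ∫ x, (‖f n x‖ ^ p - ‖f n x - g x‖ ^ p - ‖g x‖ ^ p) ∂μ := by
    have h1 := integral_sub (iF n) (iD n)
    have h2 := integral_sub ((iF n).sub (iD n)) iG
    simp only [Pi.sub_apply] at h2
    rw [h2, h1]
  rw [Real.dist_eq, hsub]
  calc |∫ x, (‖f n x‖ ^ p - ‖f n x - g x‖ ^ p - ‖g x‖ ^ p) ∂μ|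
      ≤ ∫ x, |‖f n x‖ ^ p - ‖f n x - g x‖ ^ p - ‖g x‖ ^ p| ∂μ := abs_integral_le_integral_abs
    _ ≤ ∫ x, (W n x + δ * ‖f n x - g x‖ ^ p) ∂μ := by
        refine integral_mono (((iF n).sub (iD n)).sub iG).abs
          ((hWi n).add ((iD n).const_mul δ)) fun x => ?_
        have : |‖f n x‖ ^ p - ‖f n x - g x‖ ^ p - ‖g x‖ ^ p| - δ * ‖f n x - g x‖ ^ p ≤ W n x :=
          le_max_left _ _
        simp only
        linarith
    _ = ∫ x, W n x ∂μ + δ * ∫ x, ‖f n x - g x‖ ^ p ∂μ := by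
        rw [integral_add (hWi n) ((iD n).const_mul δ), integral_const_mul]
    _ < ε / 2 + ε / 2 := by
        refine add_lt_add_of_lt_of_le (hn₀ n hn) ?_
        calc δ * ∫ x, ‖f n x - g x‖ ^ p ∂μ ≤ δ * (B + 1) := by
              gcongr; linarith [hdB n]
          _ = ε / 2 := by rw [hδ]; field_simp
    _ = ε := by ring

end BrezisLieb

/-! ### Weak sequential compactness in `L²` -/

section WeakCompactness

variable {X : Type*} [MeasurableSpace X] {μ : Measure X}

/-- Sequential Banach–Alaoglu in a separable Hilbert space. -/
theorem exists_weak_subseq {H : Type*} [NormedAddCommGroup H] [InnerProductSpace ℂ H]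
    [CompleteSpace H] [TopologicalSpace.SeparableSpace H] {u : ℕ → H} {M : ℝ}
    (hu : ∀ n, ‖u n‖ ≤ M) : ∃ (v : H) (φ : ℕ → ℕ), StrictMono φ ∧
      ∀ w : H, Tendsto (fun n => inner ℂ (u (φ n)) w) atTop (𝓝 (inner ℂ v w)) := by
  have hK := WeakDual.isSeqCompact_closedBall ℂ H 0 M
  obtain ⟨a, _, φ, hφ, ha⟩ := hK (x := fun n => WeakDual.toStrongDual.symm
    (InnerProductSpace.toDual ℂ H (u n))) (fun n => by simpa using hu n)
  refine ⟨(InnerProductSpace.toDual ℂ H).symm (WeakDual.toStrongDual a), φ, hφ, fun w => ?_⟩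
  have h1 := ((WeakDual.eval_continuous w).tendsto a).comp ha
  rw [InnerProductSpace.toDual_symm_apply]
  exact h1

/-- A bounded sequence in `L²` has a weakly convergent subsequence, along which the squared norms
split. -/
theorem exists_weak_subseq_L2 [SecondCountableTopology (Lp ℂ 2 μ)] {f : ℕ → X → ℂ}
    (hf : ∀ n, MemLp (f n) 2 μ) {M : ℝ≥0∞} (hM : M ≠ ⊤) (hfM : ∀ n, eLpNorm (f n) 2 μ ≤ M) :
    ∃ (g : X → ℂ) (φ : ℕ → ℕ), MemLp g 2 μ ∧ StrictMono φ ∧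
      (∀ v : X → ℂ, MemLp v 2 μ →
        Tendsto (fun n => ∫ x, f (φ n) x * v x ∂μ) atTop (𝓝 (∫ x, g x * v x ∂μ))) ∧
      Tendsto (fun n => (eLpNorm (f (φ n)) 2 μ).toReal ^ 2 -
        (eLpNorm (fun x => f (φ n) x - g x) 2 μ).toReal ^ 2) atTop
        (𝓝 ((eLpNorm g 2 μ).toReal ^ 2)) := by
  obtain ⟨v, φ, hφ, hv⟩ := exists_weak_subseq (u := fun n => (hf n).toLp) (M := M.toReal)
    (fun n => by rw [Lp.norm_toLp]; exact ENNReal.toReal_mono hM (hfM n))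
  refine ⟨v, φ, Lp.memLp v, hφ, fun w hw => ?_, ?_⟩
  · have hw' : MemLp (fun x => (starRingEnd ℂ) (w x)) 2 μ := hw.star
    have h1 := (Complex.continuous_conj.tendsto _).comp (hv hw'.toLp)
    have h2 (u : Lp ℂ 2 μ) : (starRingEnd ℂ) (inner ℂ u hw'.toLp) = ∫ x, u x * w x ∂μ := by
      rw [inner_conj_symm, L2.inner_def]
      refine integral_congr_ae ?_
      filter_upwards [hw'.coeFn_toLp] with x hx
      rw [hx, RCLike.inner_apply]
      simp
    rw [h2] at h1
    refine h1.congr fun n => ?_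
    rw [Function.comp_apply, h2]
    refine integral_congr_ae ?_
    filter_upwards [(hf (φ n)).coeFn_toLp] with x hx
    rw [hx]
  · have h1 := hv v
    have h2 (n : ℕ) : (eLpNorm (f (φ n)) 2 μ).toReal ^ 2 -
        (eLpNorm (fun x => f (φ n) x - v x) 2 μ).toReal ^ 2 =
        2 * (inner ℂ (hf (φ n)).toLp v).re - ‖v‖ ^ 2 := by
      have h3 : (eLpNorm (fun x => f (φ n) x - v x) 2 μ).toReal = ‖(hf (φ n)).toLp - v‖ := by
        rw [Lp.norm_def]
        congr 1
        refine eLpNorm_congr_ae ?_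
        filter_upwards [Lp.coeFn_sub (hf (φ n)).toLp v, (hf (φ n)).coeFn_toLp] with x h4 h5
        rw [h4, Pi.sub_apply, h5]
      rw [h3, ← Lp.norm_toLp _ (hf (φ n)), @norm_sub_sq ℂ]
      simp only [RCLike.re_to_complex]
      ring
    simp_rw [h2]
    have h3 := (((Complex.continuous_re.tendsto _).comp h1).const_mul 2).sub_const (‖v‖ ^ 2)
    have h4 : 2 * (inner ℂ v v).re - ‖v‖ ^ 2 = (eLpNorm v 2 μ).toReal ^ 2 := by
      rw [← Lp.norm_def, inner_self_eq_norm_sq_to_K]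
      norm_cast
      simp only [RCLike.ofReal_pow, Complex.coe_algebraMap, ← Complex.ofReal_pow, Complex.ofReal_re]
      ring
    rw [h4] at h3
    exact h3

end WeakCompactness

/-! ### Compactness in the energy space -/

section Compactness

variable {d : ℕ}
local notation "𝔼" => EuclideanSpace ℝ (Fin d)

theorem homSobolev_sub (hd : 1 ≤ d) {γ : ℝ} (h0 : 0 ≤ γ) (h1 : γ < 1) {f g : 𝔼 → ℂ}
    (hf : f ∈ HomSobolev d γ) (hg : g ∈ HomSobolev d γ) :
    (fun x => f x - g x) ∈ HomSobolev d γ := by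
  have := homSobolev_add_smul hd h0 h1 hf hg (-1)
  simpa only [neg_mul, one_mul, ← sub_eq_add_neg] using this

theorem IsFourierDensity.sub (hd : 1 ≤ d) {γ : ℝ} (h0 : 0 ≤ γ) (h1 : γ < 1) {f g h k : 𝔼 → ℂ}
    (hf : IsTemperedFun f) (hg : IsTemperedFun g) (hh : IsFourierDensity γ f h)
    (hk : IsFourierDensity γ g k) :
    IsFourierDensity γ (fun x => f x - g x) (fun ξ => h ξ - k ξ) := by
  have := IsFourierDensity.add_smul hd h0 h1 hf hg hh hk (-1)
  simpa only [neg_mul, one_mul, ← sub_eq_add_neg] using this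

theorem homSobolevNorm_sub_eq (hd : 1 ≤ d) {γ : ℝ} (h0 : 0 ≤ γ) (h1 : γ < 1) {f g h k : 𝔼 → ℂ}
    (hf : IsTemperedFun f) (hg : IsTemperedFun g) (hh : IsFourierDensity γ f h)
    (hk : IsFourierDensity γ g k) :
    homSobolevNorm γ (fun x => f x - g x) =
      eLpNorm (fun ξ => (symb γ ξ : ℂ) * h ξ - (symb γ ξ : ℂ) * k ξ) 2 volume := by
  rw [homSobolevNorm_eq hd h0 h1 (homSobolev_sub hd h0 h1 ⟨hf, h, hh⟩ ⟨hg, k, hk⟩)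
    (IsFourierDensity.sub hd h0 h1 hf hg hh hk)]
  simp only [mul_sub]

theorem homSobolevNorm_sub_le (hd : 1 ≤ d) {γ : ℝ} (h0 : 0 ≤ γ) (h1 : γ < 1) {f g : 𝔼 → ℂ}
    (hf : f ∈ HomSobolev d γ) (hg : g ∈ HomSobolev d γ) :
    homSobolevNorm γ (fun x => f x - g x) ≤ homSobolevNorm γ f + homSobolevNorm γ g := by
  have hh := fourierDensity_spec hf
  have hk := fourierDensity_spec hg
  rw [homSobolevNorm_sub_eq hd h0 h1 hf.1 hg.1 hh hk]
  exact eLpNorm_sub_le hh.2.1.1 hk.2.1.1 (by norm_num)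

/-- A bounded sequence of `Ḣ^γ` which converges as distributions to a tempered function has its
limit in `Ḣ^γ`, and along a subsequence the squared norms split. -/
theorem exists_subseq_homSobolev (hd : 1 ≤ d) {γ : ℝ} (h0 : 0 ≤ γ) (h1 : γ < 1) {f : ℕ → 𝔼 → ℂ}
    {g : 𝔼 → ℂ} (hf : ∀ n, f n ∈ HomSobolev d γ) {M : ℝ≥0∞} (hM : M ≠ ⊤)
    (hfM : ∀ n, homSobolevNorm γ (f n) ≤ M) (hg : IsTemperedFun g)
    (hlim : ∀ ψ : 𝓢(𝔼, ℂ), Tendsto (fun n => ∫ x, f n x * ψ x) atTop (𝓝 (∫ x, g x * ψ x))) :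
    g ∈ HomSobolev d γ ∧ ∃ φ : ℕ → ℕ, StrictMono φ ∧
      Tendsto (fun n => (homSobolevNorm γ (f (φ n))).toReal ^ 2 -
        (homSobolevNorm γ (fun x => f (φ n) x - g x)).toReal ^ 2) atTop
        (𝓝 ((homSobolevNorm γ g).toReal ^ 2)) := by
  have hh (n : ℕ) := fourierDensity_spec (hf n)
  have : Fact ((2 : ℝ≥0∞) ≠ ⊤) := ⟨by norm_num⟩
  obtain ⟨G, φ, hG, hφ, hw, hn⟩ := exists_weak_subseq_L2 (fun n => (hh n).2.1) hM hfM
  have hGs : (fun ξ => (symb γ ξ : ℂ) * (G ξ / symb γ ξ)) =ᵐ[volume] G := by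
    filter_upwards [ae_ne_zero hd] with ξ hξ
    have : (symb γ ξ : ℂ) ≠ 0 := by exact_mod_cast (symb_pos γ hξ).ne'
    field_simp
  have hgd : IsFourierDensity γ g (fun ξ => G ξ / symb γ ξ) := by
    refine ⟨hG.1.div₀ (Complex.measurable_ofReal.comp (measurable_symb γ)).aestronglyMeasurable,
      (memLp_congr_ae hGs).2 hG, fun ψ hψ => ?_⟩
    have l1 := (hlim (𝓕 ψ)).comp hφ.tendsto_atTop
    have l2 := hw _ (Admissible.memLp_div_symb hd h0 h1 hψ)
    have l3 : ∫ ξ, G ξ / (symb γ ξ : ℂ) * ψ ξ = ∫ ξ, G ξ * (ψ ξ / symb γ ξ) := by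
      congr 1; ext ξ; ring
    rw [l3]
    refine tendsto_nhds_unique l1 (l2.congr fun n => ?_)
    rw [Function.comp_apply, (hh (φ n)).2.2 ψ hψ]
    exact integral_congr_ae (IsFourierDensity.mul_ae_eq hd γ _ ψ).symm
  have hgH : g ∈ HomSobolev d γ := ⟨hg, _, hgd⟩
  refine ⟨hgH, φ, hφ, ?_⟩
  have e1 : homSobolevNorm γ g = eLpNorm G 2 volume := by
    rw [homSobolevNorm_eq hd h0 h1 hgH hgd]
    exact eLpNorm_congr_ae hGs
  rw [e1]
  refine hn.congr fun n => ?_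
  congr 3
  rw [homSobolevNorm_sub_eq hd h0 h1 (hf _).1 hg (hh _) hgd]
  refine eLpNorm_congr_ae ?_
  filter_upwards [hGs] with ξ hξ
  rw [hξ]

/-- The weight `(1 + |x|)^{-(d+1)}`, which localises `L^p` functions into `L²`. -/
noncomputable def weight {d : ℕ} (x : EuclideanSpace ℝ (Fin d)) : ℝ := ((1 + ‖x‖) ^ (d + 1))⁻¹

theorem weight_pos (x : 𝔼) : 0 < weight x := by unfold weight; positivity

theorem weight_le_one (x : 𝔼) : weight x ≤ 1 :=
  inv_le_one_of_one_le₀ (one_le_pow₀ (by linarith [norm_nonneg x]))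

theorem continuous_weight : Continuous (weight : 𝔼 → ℝ) := by
  unfold weight
  exact Continuous.inv₀ (by fun_prop) fun x => by positivity

theorem integrable_weight : Integrable (weight : 𝔼 → ℝ) := by
  have h : Integrable (fun x : 𝔼 => (1 + ‖x‖) ^ (-((d + 1 : ℕ) : ℝ))) :=
    integrable_one_add_norm (by simp)
  refine h.congr (ae_of_all _ fun x => ?_)
  simp only [weight]
  rw [Real.rpow_neg (by positivity), Real.rpow_natCast]

theorem integrable_weight_sq : Integrable (fun x : 𝔼 => weight x ^ 2) := by
  refine integrable_weight.mono' (by have := @continuous_weight d; fun_prop)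
    (ae_of_all _ fun x => ?_)
  rw [Real.norm_of_nonneg (by positivity)]
  nlinarith [weight_pos x, weight_le_one x]

theorem memLp_weight : MemLp (fun x : 𝔼 => (weight x : ℂ)) 2 volume := by
  have hm : AEStronglyMeasurable (fun x : 𝔼 => (weight x : ℂ)) volume := by
    have := @continuous_weight d
    exact (Complex.continuous_ofReal.comp this).aestronglyMeasurable
  rw [memLp_two_iff_integrable_sq_norm hm]
  refine integrable_weight_sq.congr (ae_of_all _ fun x => ?_)
  simp

theorem eLpNorm_mul_weight_sq_le {p : ℝ} (hp : 2 ≤ p) (f : 𝔼 → ℂ) :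
    eLpNorm (fun x => f x * weight x) 2 volume ^ 2 ≤
      (∫⁻ x : 𝔼, ENNReal.ofReal (weight x ^ 2)) + lebNorm p f ^ p := by
  rw [eLpNorm_two_sq, lebNorm_rpow (by linarith),
    ← lintegral_add_left (by have := @continuous_weight d; fun_prop)]
  refine lintegral_mono fun x => ?_
  have e1 : ‖f x * weight x‖ₑ ^ 2 = ENNReal.ofReal (‖f x‖ ^ 2 * weight x ^ 2) := by
    rw [← ofReal_norm, norm_mul, Complex.norm_real, Real.norm_of_nonneg (weight_pos x).le,
      ← ENNReal.ofReal_pow (by have := weight_pos x; positivity), mul_pow]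
  have e2 : ‖f x‖ₑ ^ p = ENNReal.ofReal (‖f x‖ ^ p) := by
    rw [← ofReal_norm, ENNReal.ofReal_rpow_of_nonneg (norm_nonneg _) (by linarith)]
  rw [e1, e2, ← ENNReal.ofReal_add (by positivity) (by positivity)]
  refine ENNReal.ofReal_le_ofReal ?_
  have hw : weight x ^ 2 ≤ 1 := pow_le_one₀ (weight_pos x).le (weight_le_one x)
  have hw0 : 0 ≤ weight x ^ 2 := by positivity
  rcases le_total ‖f x‖ 1 with h | h
  · have h2 : ‖f x‖ ^ 2 ≤ 1 := pow_le_one₀ (norm_nonneg _) h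
    have h3 : 0 ≤ ‖f x‖ ^ p := by positivity
    nlinarith
  · have h2 : ‖f x‖ ^ 2 ≤ ‖f x‖ ^ p := by
      rw [← Real.rpow_natCast]
      exact Real.rpow_le_rpow_of_exponent_le h (by exact_mod_cast hp)
    have h3 : 0 ≤ ‖f x‖ ^ 2 := by positivity
    nlinarith

theorem memLp_mul_weight {p : ℝ} (hp : 2 ≤ p) {f : 𝔼 → ℂ}
    (hf : MemLp f (ENNReal.ofReal p) volume) : MemLp (fun x => f x * weight x) 2 volume := by
  refine ⟨hf.1.mul memLp_weight.1, ?_⟩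
  have h1 := eLpNorm_mul_weight_sq_le hp f
  have h2 : (∫⁻ x : 𝔼, ENNReal.ofReal (weight x ^ 2)) + lebNorm p f ^ p < ⊤ :=
    ENNReal.add_lt_top.2 ⟨integrable_weight_sq.lintegral_lt_top,
      ENNReal.rpow_lt_top_of_nonneg (by linarith) hf.2.ne⟩
  have h3 := h1.trans_lt h2
  exact lt_top_iff_ne_top.2 fun h => by simp [h] at h3

theorem memLp_schwartz_div_weight (ψ : 𝓢(𝔼, ℂ)) :
    MemLp (fun x => ψ x / (weight x : ℂ)) 2 volume := by
  obtain ⟨C, hC, h⟩ := exists_schwartz_decay ψ (2 * (d + 1))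
  refine (memLp_weight.const_mul (C : ℂ)).mono
    (ψ.continuous.aestronglyMeasurable.div₀ memLp_weight.1) (ae_of_all _ fun x => ?_)
  rw [norm_div, norm_mul, Complex.norm_real, Complex.norm_real, Real.norm_of_nonneg hC.le,
    Real.norm_of_nonneg (weight_pos x).le, div_le_iff₀ (weight_pos x)]
  have h1 := h x
  have h2 : (0 : ℝ) < (1 + ‖x‖) ^ (d + 1) := by positivity
  rw [two_mul, pow_add] at h1
  unfold weight
  rw [mul_assoc, ← mul_inv, ← div_eq_mul_inv, le_div_iff₀ (by positivity)]
  linarith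

theorem isTemperedFun_div_weight {G : 𝔼 → ℂ} (hG : MemLp G 2 volume) :
    IsTemperedFun (fun x => G x / (weight x : ℂ)) := by
  refine ⟨2 * (d + 1), ?_⟩
  have h := hG.integrable_mul (memLp_weight (d := d))
  refine h.congr (ae_of_all _ fun x => ?_)
  have h2 : (1 + (‖x‖ : ℂ)) ≠ 0 := by
    have : (0 : ℝ) < 1 + ‖x‖ := by positivity
    exact_mod_cast this.ne'
  simp only [Pi.mul_apply, weight]
  push_cast
  field_simp
  ring

/-- High frequencies carry little `L²` mass, uniformly on bounded sets of `Ḣ^s`. -/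
theorem lintegral_highPass_le_norm {γ : ℝ} (h0 : 0 ≤ γ) {f : 𝔼 → ℂ}
    (hf : f ∈ HomSobolev d γ) {N : ℝ} (hN : 0 < N) :
    ∫⁻ x, ‖f x - lowPass N f x‖ₑ ^ 2 ≤
      ENNReal.ofReal (N ^ (-(2 * γ))) * homSobolevNorm γ f ^ 2 := by
  refine (lintegral_highPass_le h0 hf.1 (fourierDensity_spec hf) hN).trans ?_
  refine le_trans ?_ (mul_le_mul_right (lintegral_norm_rpow_mul_le h0 _) _)
  rw [← lintegral_const_mul' _ _ ENNReal.ofReal_ne_top,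
    ← lintegral_indicator (measurableSet_lt measurable_const measurable_norm)]
  refine lintegral_mono fun ξ => ?_
  by_cases hξ : ξ ∈ {ξ : 𝔼 | N < ‖ξ‖}
  · rw [indicator_of_mem hξ, ← mul_assoc, ← ENNReal.ofReal_mul (by positivity)]
    have h1 : N < ‖ξ‖ := hξ
    refine le_mul_of_one_le_left' ?_
    rw [ENNReal.one_le_ofReal, Real.rpow_neg hN.le, ← div_eq_inv_mul,
      one_le_div (by positivity)]
    gcongr
  · rw [indicator_of_notMem hξ]; exact zero_le

/-- A sequence bounded in `L^{α_c} ∩ Ḣ^s` has a subsequence which converges as distributions and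
almost everywhere. Weak convergence comes from the Hilbert space `L²` with a weight; it is upgraded
to strong convergence there because the low frequencies converge pointwise and the high
frequencies are uniformly small. -/
theorem exists_subseq_tendsto_ae {s α : ℝ} (P : Subcritical d s α) {f : ℕ → 𝔼 → ℂ}
    (hf : ∀ n, f n ∈ LebesgueClass d s α) {A B : ℝ≥0∞} (hA : A ≠ ⊤) (hB : B ≠ ⊤)
    (hfA : ∀ n, lebNorm (critLebesgue d s α) (f n) ≤ A) (hfB : ∀ n, homSobolevNorm s (f n) ≤ B) :
    ∃ g ∈ LebesgueClass d s α, ∃ φ : ℕ → ℕ, StrictMono φ ∧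
      (∀ ψ : 𝓢(𝔼, ℂ), Tendsto (fun n => ∫ x, f (φ n) x * ψ x) atTop (𝓝 (∫ x, g x * ψ x))) ∧
      ∀ᵐ x, Tendsto (fun n => f (φ n) x) atTop (𝓝 (g x)) := by
  have hd := P.one_le
  have hs := P.s_pos
  have hs1 := P.s_lt
  set q := critLebesgue d s α with hq
  have hq2 : 2 < q := P.two_lt_critLebesgue
  have : Fact ((2 : ℝ≥0∞) ≠ ⊤) := ⟨by norm_num⟩
  have hw0 (x : 𝔼) : (weight x : ℂ) ≠ 0 := by exact_mod_cast (weight_pos x).ne'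
  set W : ℝ≥0∞ := (∫⁻ x : 𝔼, ENNReal.ofReal (weight x ^ 2)) + A ^ q with hW
  have hWt : W ≠ ⊤ := ENNReal.add_ne_top.2 ⟨integrable_weight_sq.lintegral_lt_top.ne,
    ENNReal.rpow_ne_top_of_nonneg (by linarith) hA⟩
  have hFW (n : ℕ) : eLpNorm (fun x => f n x * weight x) 2 volume ≤ W + 1 := by
    have h1 : eLpNorm (fun x => f n x * weight x) 2 volume ^ 2 ≤ W := by
      refine (eLpNorm_mul_weight_sq_le hq2.le (f n)).trans ?_
      rw [hW]
      gcongr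
      exact hfA n
    by_contra! hcon
    have h2 : 1 ≤ eLpNorm (fun x => f n x * weight x) 2 volume :=
      le_trans (by simp) hcon.le
    have h3 := le_self_pow₀ h2 (two_ne_zero)
    exact absurd (hcon.trans_le (h3.trans h1)) (not_lt.2 (by simp))
  obtain ⟨G, φ, hG, hφ, hw, -⟩ := exists_weak_subseq_L2
    (fun n => memLp_mul_weight hq2.le (hf n).1) (ENNReal.add_ne_top.2 ⟨hWt, ENNReal.one_ne_top⟩) hFW
  set g : 𝔼 → ℂ := fun x => G x / (weight x : ℂ) with hg
  have hgT : IsTemperedFun g := isTemperedFun_div_weight hG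
  have hlim (ψ : 𝓢(𝔼, ℂ)) :
      Tendsto (fun n => ∫ x, f (φ n) x * ψ x) atTop (𝓝 (∫ x, g x * ψ x)) := by
    have h1 := hw _ (memLp_schwartz_div_weight ψ)
    have h2 : ∫ x, g x * ψ x = ∫ x, G x * (ψ x / weight x) := by
      congr 1; ext x; rw [hg]; ring
    rw [h2]
    refine h1.congr fun n => ?_
    congr 1; ext x
    have := hw0 x
    field_simp
  obtain ⟨hgH, -⟩ := exists_subseq_homSobolev hd hs.le hs1 (fun n => (hf (φ n)).2) hB
    (fun n => hfB (φ n)) hgT hlim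
  obtain ⟨C, hC, hCb⟩ := exists_lowPass_le_eLpNorm d (p := q) (by linarith)
  have hdH (n : ℕ) := homSobolev_sub hd hs.le hs1 (hf (φ n)).2 hgH
  have hlow {N : ℝ} (hN : 0 < N) (x : 𝔼) :
      Tendsto (fun n => lowPass N (fun y => f (φ n) y - g y) x) atTop (𝓝 0) := by
    have h1 := (hlim (𝓕 (lowTest N x))).sub_const (∫ y, g y * (𝓕 (lowTest N x)) y)
    rw [sub_self] at h1
    refine h1.congr fun n => ?_
    simp only [lowPass, sub_mul]
    rw [integral_sub ((hf (φ n)).2.1.integrable_mul _) (hgT.integrable_mul _)]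
  have hlowB {N : ℝ} (hN : 0 < N) : ∃ K : ℝ, ∀ n x,
      ‖lowPass N (fun y => f (φ n) y - g y) x‖ ≤ K := by
    have h1 (n : ℕ) (x : 𝔼) : ‖lowPass N (f (φ n)) x‖ ≤ C * N ^ (d / q) * A.toReal := by
      refine (hCb _ (hf (φ n)).1 N hN x).trans ?_
      have := ENNReal.toReal_mono hA (hfA (φ n))
      gcongr
    have h2 (x : 𝔼) : ‖lowPass N g x‖ ≤ C * N ^ (d / q) * A.toReal :=
      le_of_tendsto (hlim (𝓕 (lowTest N x))).norm (Eventually.of_forall fun n => h1 n x)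
    refine ⟨2 * (C * N ^ (d / q) * A.toReal), fun n x => ?_⟩
    have h3 : lowPass N (fun y => f (φ n) y - g y) x = lowPass N (f (φ n)) x - lowPass N g x := by
      simp only [lowPass, sub_mul]
      rw [integral_sub ((hf (φ n)).2.1.integrable_mul _) (hgT.integrable_mul _)]
    rw [h3]
    linarith [norm_sub_le (lowPass N (f (φ n)) x) (lowPass N g x), h1 n x, h2 x]
  have hB' : B + homSobolevNorm s g ≠ ⊤ := ENNReal.add_ne_top.2 ⟨hB, (homSobolevNorm_lt_top hgH).ne⟩
  have hdB (n : ℕ) : homSobolevNorm s (fun y => f (φ n) y - g y) ≤ B + homSobolevNorm s g :=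
    (homSobolevNorm_sub_le hd hs.le hs1 (hf (φ n)).2 hgH).trans (by gcongr; exact hfB _)
  have hFG (n : ℕ) : (fun x => f (φ n) x * weight x) - G =
      fun x => (f (φ n) x - g x) * weight x := by
    ext x
    rw [Pi.sub_apply, hg, sub_mul, div_mul_cancel₀ _ (hw0 x)]
  -- The low frequencies converge by dominated convergence, the high ones are at most `δ`.
  have hstrong : Tendsto (fun n => eLpNorm ((fun x => f (φ n) x * weight x) - G) 2 volume) atTop
      (𝓝 0) := by
    rw [ENNReal.tendsto_nhds_zero]
    intro ε hε
    obtain ⟨δ, hδ0, hδε⟩ : ∃ δ : ℝ≥0∞, 0 < δ ∧ δ + δ = ε := ⟨ε / 2, by simp [hε.ne'], by simp⟩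
    obtain ⟨N, hN0, hN⟩ : ∃ N : ℝ, 0 < N ∧
        ENNReal.ofReal (N ^ (-(2 * s))) * (B + homSobolevNorm s g) ^ 2 < δ ^ 2 := by
      have h1 : Tendsto (fun N : ℝ => ENNReal.ofReal (N ^ (-(2 * s))) *
          (B + homSobolevNorm s g) ^ 2) atTop (𝓝 0) := by
        have h2 := ENNReal.Tendsto.mul_const (b := (B + homSobolevNorm s g) ^ 2)
          (ENNReal.tendsto_ofReal (tendsto_rpow_neg_atTop (y := 2 * s) (by linarith)))
          (Or.inr (ENNReal.pow_ne_top hB'))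
        simpa using h2
      exact ((eventually_gt_atTop 0).and (h1.eventually_lt_const (by positivity))).exists
    obtain ⟨K, hK⟩ := hlowB hN0
    have hmlow (n : ℕ) : AEStronglyMeasurable (lowPass N (fun y => f (φ n) y - g y)) volume :=
      aestronglyMeasurable_lowPass (hdH n).1 hN0
    have hlow0 : Tendsto (fun n => eLpNorm
        (fun x => lowPass N (fun y => f (φ n) y - g y) x * weight x) 2 volume) atTop (𝓝 0) := by
      have h1 : Tendsto (fun n => ∫⁻ x, ‖lowPass N (fun y => f (φ n) y - g y) x * weight x‖ₑ ^ 2)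
          atTop (𝓝 (∫⁻ _ : 𝔼, 0)) := by
        refine tendsto_lintegral_of_dominated_convergence'
          (fun x => ENNReal.ofReal (K ^ 2 * weight x ^ 2)) (fun n => ?_) (fun n => ?_) ?_ ?_
        · exact ((hmlow n).mul memLp_weight.1).enorm.pow_const 2
        · refine ae_of_all _ fun x => ?_
          beta_reduce
          rw [← ofReal_norm, norm_mul, Complex.norm_real, Real.norm_of_nonneg (weight_pos x).le,
            ← ENNReal.ofReal_pow (by have := weight_pos x; positivity), mul_pow]
          have := hK n x
          gcongr
        · exact (integrable_weight_sq.const_mul _).lintegral_lt_top.ne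
        · refine ae_of_all _ fun x => ?_
          have h2 := ENNReal.Tendsto.pow (n := 2) ((hlow hN0 x).mul_const (weight x : ℂ)).enorm
          simpa using h2
      rw [lintegral_zero] at h1
      have h3 := (ENNReal.continuous_rpow_const (y := 1 / 2)).tendsto 0 |>.comp h1
      rw [ENNReal.zero_rpow_of_pos (by norm_num)] at h3
      refine h3.congr fun n => ?_
      rw [Function.comp_apply, ← eLpNorm_two_sq, ← ENNReal.rpow_natCast, ← ENNReal.rpow_mul]
      norm_num
    filter_upwards [ENNReal.tendsto_nhds_zero.1 hlow0 δ hδ0] with n hn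
    have hsplit : (fun x => f (φ n) x * weight x) - G =
        (fun x => lowPass N (fun y => f (φ n) y - g y) x * (weight x : ℂ)) +
        fun x => (f (φ n) x - g x - lowPass N (fun y => f (φ n) y - g y) x) * (weight x : ℂ) := by
      rw [hFG]; ext x; simp only [Pi.add_apply]; ring
    rw [hsplit, ← hδε]
    refine (eLpNorm_add_le ((hmlow n).mul memLp_weight.1)
      ((((hdH n).1.aestronglyMeasurable).sub (hmlow n)).mul memLp_weight.1) (by norm_num)).trans
      (add_le_add hn ?_)
    have h4 : eLpNorm (fun x => (f (φ n) x - g x - lowPass N (fun y => f (φ n) y - g y) x) *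
        (weight x : ℂ)) 2 volume ^ 2 ≤ δ ^ 2 := by
      rw [eLpNorm_two_sq]
      calc _ ≤ ∫⁻ x, ‖f (φ n) x - g x - lowPass N (fun y => f (φ n) y - g y) x‖ₑ ^ 2 := by
            refine lintegral_mono fun x => ?_
            rw [enorm_mul]
            gcongr
            refine mul_le_of_le_one_right' ?_
            rw [← ofReal_norm, Complex.norm_real, Real.norm_of_nonneg (weight_pos x).le]
            exact ENNReal.ofReal_le_one.2 (weight_le_one x)
        _ ≤ ENNReal.ofReal (N ^ (-(2 * s))) * homSobolevNorm s (fun y => f (φ n) y - g y) ^ 2 :=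
            lintegral_highPass_le_norm hs.le (hdH n) hN0
        _ ≤ ENNReal.ofReal (N ^ (-(2 * s))) * (B + homSobolevNorm s g) ^ 2 := by
            gcongr; exact hdB n
        _ ≤ δ ^ 2 := hN.le
    exact (ENNReal.pow_le_pow_left_iff two_ne_zero).1 h4
  obtain ⟨ns, hns, hae⟩ := (tendstoInMeasure_of_tendsto_eLpNorm two_ne_zero
    (fun n => (memLp_mul_weight hq2.le (hf (φ n)).1).1) hG.1 hstrong).exists_seq_tendsto_ae
  have hae' : ∀ᵐ x, Tendsto (fun n => f (φ (ns n)) x) atTop (𝓝 (g x)) := by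
    filter_upwards [hae] with x hx
    refine (hx.div_const (weight x : ℂ)).congr fun n => ?_
    rw [mul_div_cancel_right₀ _ (hw0 x)]
  refine ⟨g, ⟨⟨hgT.aestronglyMeasurable, ?_⟩, hgH⟩, φ ∘ ns, hφ.comp hns,
    fun ψ => (hlim ψ).comp hns.tendsto_atTop, hae'⟩
  refine (Lp.eLpNorm_lim_le_liminf_eLpNorm (fun n => (hf (φ (ns n))).1.1) g hae').trans_lt ?_
  exact (liminf_le_of_frequently_le' (Frequently.of_forall fun n => hfA (φ (ns n)))).trans_lt
    hA.lt_top

end Compactness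

/-! ### Existence of maximizers -/

section Maximizer

variable {d : ℕ}
local notation "𝔼" => EuclideanSpace ℝ (Fin d)

/-- The properties of a scaling critical norm `E` on a class `X` of functions which are used in the
existence proof for maximizers of `‖f‖_{L^{α+2}}^{α+2} / (E f ^ α ‖f‖_{Ḣ^s}²)`: it controls the
`L^{α_c}` norm, scales like it, and its `q`-th power splits along convergent sequences. -/
structure CriticalFunctional (s α : ℝ) (X : Set (EuclideanSpace ℝ (Fin d) → ℂ))
    (E : (EuclideanSpace ℝ (Fin d) → ℂ) → ℝ≥0∞) (q : ℝ) : Prop where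
  q_pos : 0 < q
  subset : X ⊆ LebesgueClass d s α
  exists_le : ∃ C : ℝ, 0 < C ∧ ∀ f ∈ X, lebNorm (critLebesgue d s α) f ≤ ENNReal.ofReal C * E f
  lt_top : ∀ f ∈ X, E f < ⊤
  affine_mem : ∀ f ∈ X, ∀ (c : ℂ) {l : ℝ}, 0 < l → ∀ x₀, (fun x => c * f (l • x + x₀)) ∈ X
  affine : ∀ f ∈ X, ∀ (c : ℂ) {l : ℝ}, 0 < l → ∀ x₀,
    E (fun x => c * f (l • x + x₀)) = ENNReal.ofReal (‖c‖ * l ^ (-(2 * s / α))) * E f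
  sub_mem : ∀ f ∈ X, ∀ g ∈ X, (fun x => f x - g x) ∈ X
  split : ∀ (f : ℕ → EuclideanSpace ℝ (Fin d) → ℂ) (g : EuclideanSpace ℝ (Fin d) → ℂ) (M : ℝ≥0∞),
    M ≠ ⊤ → (∀ n, f n ∈ X) → (∀ n, E (f n) ≤ M) → g ∈ LebesgueClass d s α →
    (∀ ψ : 𝓢(EuclideanSpace ℝ (Fin d), ℂ),
      Tendsto (fun n => ∫ x, f n x * ψ x) atTop (𝓝 (∫ x, g x * ψ x))) →
    (∀ᵐ x, Tendsto (fun n => f n x) atTop (𝓝 (g x))) →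
    g ∈ X ∧ ∃ φ : ℕ → ℕ, StrictMono φ ∧ Tendsto (fun n => (E (f (φ n))).toReal ^ q -
      (E (fun x => f (φ n) x - g x)).toReal ^ q) atTop (𝓝 ((E g).toReal ^ q))
  nonempty : ∃ f ∈ X, ¬ f =ᵐ[volume] 0

theorem lebNorm_rpow_affine {p : ℝ} (hp : 0 < p) (f : 𝔼 → ℂ) (c : ℂ) {l : ℝ} (hl : 0 < l) (x₀ : 𝔼) :
    lebNorm p (fun x => c * f (l • x + x₀)) ^ p =
      ENNReal.ofReal (‖c‖ ^ p * l ^ (-(d : ℝ))) * lebNorm p f ^ p := by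
  unfold lebNorm
  rw [eLpNorm_affine c hl x₀ f, ENNReal.mul_rpow_of_nonneg _ _ hp.le,
    ENNReal.ofReal_rpow_of_nonneg (by positivity) hp.le, Real.mul_rpow (norm_nonneg _)
    (by positivity), ← Real.rpow_mul hl.le, one_div, ENNReal.toReal_inv,
    ENNReal.toReal_ofReal hp.le, mul_assoc (-(d : ℝ)), inv_mul_cancel₀ hp.ne', mul_one]

/-- If both parts of a splitting `e = a + (e - a)`, `m = b + (m - b)` are charged less than the
whole by `(e, m) ↦ e ^ θ * m`, then the splitting is trivial. -/
theorem eq_of_rpow_mul_split {θ a b e m : ℝ} (hθ : 0 < θ) (ha : 0 < a) (hae : a ≤ e) (hb : 0 < b)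
    (hbm : b ≤ m) (h : e ^ θ * m ≤ a ^ θ * b + (e - a) ^ θ * (m - b)) : a = e ∧ b = m := by
  have h0 : 0 < e := ha.trans_le hae
  have he : 0 < e ^ θ := by positivity
  have h1 : (e - a) ^ θ < e ^ θ := Real.rpow_lt_rpow (by linarith) (by linarith) hθ
  have h2 : a ^ θ ≤ e ^ θ := Real.rpow_le_rpow ha.le hae hθ.le
  have h3 : b = m := by
    by_contra hne
    have h4 : 0 < m - b := sub_pos.2 (lt_of_le_of_ne hbm hne)
    nlinarith
  refine ⟨?_, h3⟩
  subst h3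
  rw [sub_self, mul_zero, add_zero] at h
  by_contra hne
  have h5 : a ^ θ < e ^ θ := Real.rpow_lt_rpow ha.le (lt_of_le_of_ne hae hne) hθ
  nlinarith

namespace CriticalFunctional

variable {s α q : ℝ} {X : Set (EuclideanSpace ℝ (Fin d) → ℂ)}
  {E : (EuclideanSpace ℝ (Fin d) → ℂ) → ℝ≥0∞}

theorem exists_gagliardoNirenberg (F : CriticalFunctional s α X E q) (P : Subcritical d s α) :
    ∃ C : ℝ, 0 < C ∧ ∀ f ∈ X, lebNorm (α + 2) f ^ (α + 2) ≤
      ENNReal.ofReal C * (E f ^ α * homSobolevNorm s f ^ 2) := by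
  obtain ⟨C, hC, h⟩ := _root_.exists_gagliardoNirenberg P
  obtain ⟨K, hK, hKE⟩ := F.exists_le
  have hα := P.α_pos
  refine ⟨C * K ^ α, by positivity, fun f hf => (h f (F.subset hf)).trans ?_⟩
  calc _ ≤ ENNReal.ofReal C * ((ENNReal.ofReal K * E f) ^ α * homSobolevNorm s f ^ 2) := by
        gcongr; exact hKE f hf
    _ = _ := by
        rw [ENNReal.mul_rpow_of_nonneg _ _ hα.le, ENNReal.ofReal_rpow_of_pos hK,
          ENNReal.ofReal_mul hC.le]
        ring

theorem lebNorm_lt_top (F : CriticalFunctional s α X E q) (P : Subcritical d s α) {f : 𝔼 → ℂ}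
    (hf : f ∈ X) : lebNorm (α + 2) f < ⊤ := by
  obtain ⟨C, hC, h⟩ := F.exists_gagliardoNirenberg P
  have hα := P.α_pos
  have h1 := (h f hf).trans_lt (ENNReal.mul_lt_top ENNReal.ofReal_lt_top (ENNReal.mul_lt_top
    (ENNReal.rpow_lt_top_of_nonneg hα.le (F.lt_top f hf).ne)
    (ENNReal.pow_lt_top (homSobolevNorm_lt_top (F.subset hf).2))))
  exact (ENNReal.rpow_lt_top_iff_of_pos (by linarith)).1 h1

theorem memLp (F : CriticalFunctional s α X E q) (P : Subcritical d s α) {f : 𝔼 → ℂ}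
    (hf : f ∈ X) : MemLp f (ENNReal.ofReal (α + 2)) volume :=
  ⟨(F.subset hf).1.1, F.lebNorm_lt_top P hf⟩

theorem lebNorm_pos (F : CriticalFunctional s α X E q) (P : Subcritical d s α) {f : 𝔼 → ℂ}
    (hf : f ∈ X) (h0 : ¬ f =ᵐ[volume] 0) : 0 < (lebNorm (α + 2) f).toReal := by
  have hα := P.α_pos
  refine ENNReal.toReal_pos (fun h => h0 ?_) (F.lebNorm_lt_top P hf).ne
  exact (eLpNorm_eq_zero_iff (F.subset hf).1.1
    (by rw [Ne, ENNReal.ofReal_eq_zero, not_le]; linarith)).1 h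

theorem toReal_gagliardoNirenberg (F : CriticalFunctional s α X E q) (P : Subcritical d s α)
    {f : 𝔼 → ℂ} (hf : f ∈ X) {C : ℝ} (hC : 0 ≤ C) (h : lebNorm (α + 2) f ^ (α + 2) ≤
      ENNReal.ofReal C * (E f ^ α * homSobolevNorm s f ^ 2)) :
    (lebNorm (α + 2) f).toReal ^ (α + 2) ≤
      C * ((E f).toReal ^ α * (homSobolevNorm s f).toReal ^ 2) := by
  have hα := P.α_pos
  have h1 := ENNReal.toReal_mono (ENNReal.mul_ne_top ENNReal.ofReal_ne_top (ENNReal.mul_ne_top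
    (ENNReal.rpow_ne_top_of_nonneg hα.le (F.lt_top f hf).ne)
    (ENNReal.pow_ne_top (homSobolevNorm_lt_top (F.subset hf).2).ne))) h
  rwa [← ENNReal.toReal_rpow, ENNReal.toReal_mul, ENNReal.toReal_ofReal hC, ENNReal.toReal_mul,
    ← ENNReal.toReal_rpow, ENNReal.toReal_pow] at h1

/-- Both norms of a nonzero function are positive, so the quotient is a genuine one. -/
theorem norms_pos (F : CriticalFunctional s α X E q) (P : Subcritical d s α) {f : 𝔼 → ℂ}
    (hf : f ∈ X) (h0 : ¬ f =ᵐ[volume] 0) :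
    0 < (E f).toReal ∧ 0 < (homSobolevNorm s f).toReal := by
  obtain ⟨C, hC, h⟩ := F.exists_gagliardoNirenberg P
  have hα := P.α_pos
  have h1 := F.toReal_gagliardoNirenberg P hf hC.le (h f hf)
  have h2 : 0 < (lebNorm (α + 2) f).toReal ^ (α + 2) := by
    have := F.lebNorm_pos P hf h0
    positivity
  constructor <;> refine lt_of_le_of_ne ENNReal.toReal_nonneg fun h3 => ?_
  · rw [← h3, Real.zero_rpow hα.ne'] at h1; linarith
  · rw [← h3] at h1; norm_num at h1; linarith

/-- By scaling, both norms of a nonzero function can be prescribed, at no change of the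
quotient. -/
theorem exists_normalized (F : CriticalFunctional s α X E q) (P : Subcritical d s α)
    {f : 𝔼 → ℂ} (hf : f ∈ X) (h0 : ¬ f =ᵐ[volume] 0) {e n : ℝ} (he : 0 < e) (hn : 0 < n) :
    ∃ g ∈ X, (E g).toReal = e ∧ (homSobolevNorm s g).toReal = n ∧
      (lebNorm (α + 2) g).toReal ^ (α + 2) * ((E f).toReal ^ α * (homSobolevNorm s f).toReal ^ 2) =
      (lebNorm (α + 2) f).toReal ^ (α + 2) * (e ^ α * n ^ 2) := by
  obtain ⟨hE, hN⟩ := F.norms_pos P hf h0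
  have hα := P.α_pos
  set a := (E f).toReal
  set b := (homSobolevNorm s f).toReal
  have hκ : 0 < s - critSobolev d s α := sub_pos.2 P.crit_lt
  -- The two norms scale with different powers of `l`, which determines `l` and then `c`.
  set l : ℝ := (n / b * (a / e)) ^ (s - critSobolev d s α)⁻¹ with hl
  have hl0 : 0 < l := by positivity
  set c : ℝ := e / a * l ^ (2 * s / α) with hc
  have hc0 : 0 < c := by positivity
  have hcn : ‖(c : ℂ)‖ = c := by rw [Complex.norm_real, Real.norm_of_nonneg hc0.le]
  have h1 : c * l ^ (-(2 * s / α)) * a = e := by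
    rw [hc, mul_assoc (e / a), ← Real.rpow_add hl0, add_neg_cancel, Real.rpow_zero]
    field_simp
  have h2 : c * l ^ (s - (d : ℝ) / 2) * b = n := by
    rw [hc, mul_assoc (e / a), ← Real.rpow_add hl0, ← Subcritical.half_sub_crit (d := d),
      show (d : ℝ) / 2 - critSobolev d s α + (s - (d : ℝ) / 2) = s - critSobolev d s α by ring, hl,
      ← Real.rpow_mul (by positivity), inv_mul_cancel₀ hκ.ne', Real.rpow_one]
    field_simp
  refine ⟨_, F.affine_mem f hf c hl0 0, ?_, ?_, ?_⟩
  · rw [F.affine f hf c hl0 0, ENNReal.toReal_mul, ENNReal.toReal_ofReal (by positivity), hcn, h1]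
  · rw [homSobolevNorm_affine P.one_le P.s_pos.le P.s_lt (F.subset hf).2 c hl0 0,
      ENNReal.toReal_mul, ENNReal.toReal_ofReal (by positivity), hcn, h2]
  · rw [ENNReal.toReal_rpow, lebNorm_rpow_affine (by linarith) f c hl0 0, ENNReal.toReal_mul,
      ENNReal.toReal_ofReal (by positivity), hcn, ← ENNReal.toReal_rpow]
    have h3 : c ^ (α + 2) * l ^ (-(d : ℝ)) * (a ^ α * b ^ 2) = e ^ α * n ^ 2 := by
      have h4 : (l ^ (-(2 * s / α))) ^ α * (l ^ (s - (d : ℝ) / 2)) ^ 2 = l ^ (-(d : ℝ)) := by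
        rw [← Real.rpow_natCast, ← Real.rpow_mul hl0.le, ← Real.rpow_mul hl0.le,
          ← Real.rpow_add hl0]
        congr 1
        push_cast
        field_simp
        ring
      rw [← h1, ← h2, Real.mul_rpow (by positivity) hE.le, Real.mul_rpow hc0.le (by positivity),
        ← h4, Real.rpow_add hc0, Real.rpow_two]
      ring
    rw [← h3]; ring

/-- The supremum of the quotient `‖f‖_{L^{α+2}}^{α+2} / (E f ^ α ‖f‖_{Ḣ^s}²)` is positive and finite
and attained, at functions with arbitrarily prescribed values of `E` and of the `Ḣ^s` norm.

A normalized maximizing sequence has, after translations, a nonzero weak limit. The three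
functionals split along the sequence, and a nontrivial splitting would lose some of the supremum. -/
theorem exists_maximizer (F : CriticalFunctional s α X E q) (P : Subcritical d s α) :
    ∃ σ : ℝ, 0 < σ ∧
      sSup {r | ∃ f ∈ X, ¬ f =ᵐ[volume] 0 ∧
        r = lebNorm (α + 2) f ^ (α + 2) / (E f ^ α * homSobolevNorm s f ^ 2)} = ENNReal.ofReal σ ∧
      (∀ f ∈ X, (lebNorm (α + 2) f).toReal ^ (α + 2) ≤
        σ * ((E f).toReal ^ α * (homSobolevNorm s f).toReal ^ 2)) ∧
      ∀ e n : ℝ, 0 < e → 0 < n → ∃ f ∈ X, ¬ f =ᵐ[volume] 0 ∧ (E f).toReal = e ∧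
        (homSobolevNorm s f).toReal = n ∧
        (lebNorm (α + 2) f).toReal ^ (α + 2) = σ * (e ^ α * n ^ 2) := by
  have hα := P.α_pos
  have hs := P.s_pos
  have hs1 := P.s_lt
  have hd := P.one_le
  have hq := F.q_pos
  set S := sSup {r | ∃ f ∈ X, ¬ f =ᵐ[volume] 0 ∧
        r = lebNorm (α + 2) f ^ (α + 2) / (E f ^ α * homSobolevNorm s f ^ 2)} with hS
  have hden {f : 𝔼 → ℂ} (hf : f ∈ X) (h0 : ¬ f =ᵐ[volume] 0) :
      E f ^ α * homSobolevNorm s f ^ 2 ≠ 0 ∧ E f ^ α * homSobolevNorm s f ^ 2 ≠ ⊤ := by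
    obtain ⟨h1, h2⟩ := F.norms_pos P hf h0
    rw [ENNReal.toReal_pos_iff] at h1 h2
    exact ⟨mul_ne_zero (ENNReal.rpow_pos h1.1 h1.2.ne).ne' (pow_ne_zero _ h2.1.ne'),
      ENNReal.mul_ne_top (ENNReal.rpow_ne_top_of_nonneg hα.le h1.2.ne)
        (ENNReal.pow_ne_top h2.2.ne)⟩
  have hquot {f : 𝔼 → ℂ} (hf : f ∈ X) (h0 : ¬ f =ᵐ[volume] 0) :
      lebNorm (α + 2) f ^ (α + 2) / (E f ^ α * homSobolevNorm s f ^ 2) =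
      ENNReal.ofReal ((lebNorm (α + 2) f).toReal ^ (α + 2) /
        ((E f).toReal ^ α * (homSobolevNorm s f).toReal ^ 2)) := by
    have h1 : lebNorm (α + 2) f ^ (α + 2) ≠ ⊤ :=
      ENNReal.rpow_ne_top_of_nonneg (by linarith) (F.lebNorm_lt_top P hf).ne
    rw [← ENNReal.ofReal_toReal (ENNReal.div_ne_top h1 (hden hf h0).1), ENNReal.toReal_div,
      ENNReal.toReal_mul, ENNReal.toReal_rpow, ENNReal.toReal_rpow, ENNReal.toReal_pow]
  have hSt : S ≠ ⊤ := by
    obtain ⟨C, hC, h⟩ := F.exists_gagliardoNirenberg P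
    refine ne_top_of_le_ne_top (ENNReal.ofReal_ne_top (r := C)) (sSup_le ?_)
    rintro r ⟨f, hf, h0, rfl⟩
    exact ENNReal.div_le_of_le_mul (h f hf)
  set σ := S.toReal with hσ
  have hSσ : S = ENNReal.ofReal σ := (ENNReal.ofReal_toReal hSt).symm
  have hσ0 : 0 < σ := by
    obtain ⟨f, hf, h0⟩ := F.nonempty
    have h1 := F.lebNorm_pos P hf h0
    obtain ⟨h2, h3⟩ := F.norms_pos P hf h0
    have h4 : ENNReal.ofReal ((lebNorm (α + 2) f).toReal ^ (α + 2) /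
        ((E f).toReal ^ α * (homSobolevNorm s f).toReal ^ 2)) ≤ S := by
      rw [← hquot hf h0]
      exact le_sSup ⟨f, hf, h0, rfl⟩
    rw [hSσ] at h4
    have h5 : 0 < (lebNorm (α + 2) f).toReal ^ (α + 2) /
        ((E f).toReal ^ α * (homSobolevNorm s f).toReal ^ 2) := by positivity
    have h6 := (ENNReal.ofReal_pos.2 h5).trans_le h4
    exact ENNReal.ofReal_pos.1 h6
  -- Unlike the quotient, this product form of the inequality also covers `f = 0`.
  have hle (f : 𝔼 → ℂ) (hf : f ∈ X) : (lebNorm (α + 2) f).toReal ^ (α + 2) ≤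
      σ * ((E f).toReal ^ α * (homSobolevNorm s f).toReal ^ 2) := by
    by_cases h0 : f =ᵐ[volume] 0
    · have : lebNorm (α + 2) f = 0 := by
        unfold lebNorm; rw [eLpNorm_congr_ae h0, eLpNorm_zero]
      rw [this, ENNReal.toReal_zero, Real.zero_rpow (by linarith)]
      positivity
    · refine F.toReal_gagliardoNirenberg P hf hσ0.le ?_
      rw [← hSσ, ← ENNReal.div_le_iff (hden hf h0).1 (hden hf h0).2]
      exact le_sSup ⟨f, hf, h0, rfl⟩
  refine ⟨σ, hσ0, hSσ, hle, fun e n he hn => ?_⟩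
  set J := σ * (e ^ α * n ^ 2) with hJ
  have hJ0 : 0 < J := by positivity
  -- a normalized maximizing sequence
  have hmax (k : ℕ) : ∃ f ∈ X, (E f).toReal = e ∧ (homSobolevNorm s f).toReal = n ∧
      (1 - 1 / ((k : ℝ) + 2)) * J ≤ (lebNorm (α + 2) f).toReal ^ (α + 2) := by
    have hk : 0 < 1 / ((k : ℝ) + 2) := by positivity
    have hlt : ENNReal.ofReal ((1 - 1 / ((k : ℝ) + 2)) * σ) < S := by
      rw [hSσ, ENNReal.ofReal_lt_ofReal_iff hσ0]
      nlinarith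
    obtain ⟨r, ⟨f, hf, h0, rfl⟩, hr⟩ := lt_sSup_iff.1 hlt
    obtain ⟨g, hg, h1, h2, h3⟩ := F.exists_normalized P hf h0 he hn
    obtain ⟨h4, h5⟩ := F.norms_pos P hf h0
    refine ⟨g, hg, h1, h2, ?_⟩
    rw [hquot hf h0] at hr
    have h6 := ENNReal.lt_ofReal_iff_toReal_lt ENNReal.ofReal_ne_top |>.1 hr
    have h7 := (le_max_left _ _).trans_lt (by rwa [ENNReal.toReal_ofReal'] at h6)
    rw [lt_div_iff₀ (by positivity)] at h7
    have h8 : 0 < (E f).toReal ^ α * (homSobolevNorm s f).toReal ^ 2 := by positivity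
    have h9 : 0 < e ^ α * n ^ 2 := by positivity
    refine le_of_mul_le_mul_right ?_ h8
    rw [h3, hJ]
    nlinarith
  choose f hf hfE hfN hfJ using hmax
  obtain ⟨C, hC, hCE⟩ := F.exists_le
  have hfE' (k : ℕ) : E (f k) = ENNReal.ofReal e := by
    rw [← hfE k, ENNReal.ofReal_toReal (F.lt_top _ (hf k)).ne]
  have hfN' (k : ℕ) : homSobolevNorm s (f k) = ENNReal.ofReal n := by
    rw [← hfN k, ENNReal.ofReal_toReal (homSobolevNorm_lt_top (F.subset (hf k)).2).ne]
  have hfJ2 (k : ℕ) : ENNReal.ofReal (J / 2) ≤ lebNorm (α + 2) (f k) ^ (α + 2) := by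
    rw [ENNReal.ofReal_le_iff_le_toReal (ENNReal.rpow_ne_top_of_nonneg (by linarith)
      (F.lebNorm_lt_top P (hf k)).ne), ← ENNReal.toReal_rpow]
    refine le_trans ?_ (hfJ k)
    have : 1 / ((k : ℝ) + 2) ≤ 1 / 2 := by
      gcongr; linarith [Nat.cast_nonneg (α := ℝ) k]
    nlinarith
  obtain ⟨N, η, hN, hη, hlow⟩ := exists_lowPass_ge P (A := C * e) (B := n) (c := J / 2)
    (by positivity) hn (by positivity)
  have hlow' (k : ℕ) : ∃ x, η ≤ ‖lowPass N (f k) x‖ :=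
    hlow (f k) (F.subset (hf k))
      (by rw [ENNReal.ofReal_mul hC.le, ← hfE' k]; exact hCE _ (hf k)) (hfN' k).le (hfJ2 k)
  choose y hy using hlow'
  -- translate, so that the low frequency parts do not vanish at the origin
  set u : ℕ → 𝔼 → ℂ := fun k x => f k (x + y k) with hu
  have hu' (k : ℕ) : u k = fun x => (1 : ℂ) * f k ((1 : ℝ) • x + y k) := by
    ext x; simp [hu]
  have huX (k : ℕ) : u k ∈ X := by rw [hu']; exact F.affine_mem _ (hf k) 1 one_pos _
  have huE (k : ℕ) : E (u k) = ENNReal.ofReal e := by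
    rw [hu', F.affine _ (hf k) 1 one_pos, hfE']; simp
  have huN (k : ℕ) : homSobolevNorm s (u k) = ENNReal.ofReal n := by
    rw [hu', homSobolevNorm_affine hd hs.le hs1 (F.subset (hf k)).2 1 one_pos, hfN']; simp
  have huJ (k : ℕ) : (lebNorm (α + 2) (u k)).toReal ^ (α + 2) =
      (lebNorm (α + 2) (f k)).toReal ^ (α + 2) := by
    rw [hu', ENNReal.toReal_rpow, lebNorm_rpow_affine (by linarith) _ 1 one_pos,
      ENNReal.toReal_rpow]
    simp
  have hulow (k : ℕ) : η ≤ ‖lowPass N (u k) 0‖ := by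
    rw [hu, lowPass_translate hN, zero_add]; exact hy k
  obtain ⟨g, hg, φ, hφ, hgw, hga⟩ := exists_subseq_tendsto_ae P (fun k => F.subset (huX k))
    (A := ENNReal.ofReal (C * e)) (B := ENNReal.ofReal n) ENNReal.ofReal_ne_top
    ENNReal.ofReal_ne_top
    (fun k => by rw [ENNReal.ofReal_mul hC.le, ← huE k]; exact hCE _ (huX k)) (fun k => (huN k).le)
  have hg0 : ¬ g =ᵐ[volume] 0 := by
    intro h0
    have h1 : η ≤ ‖lowPass N g 0‖ :=
      ge_of_tendsto (hgw (𝓕 (lowTest N 0))).norm (Eventually.of_forall fun k => hulow (φ k))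
    have h2 : lowPass N g 0 = 0 := by
      unfold lowPass
      rw [integral_congr_ae (g := fun _ => (0 : ℂ)), integral_zero]
      filter_upwards [h0] with x hx
      rw [hx]; simp
    rw [h2, norm_zero] at h1
    linarith
  obtain ⟨hgX, ψ, hψ, hEs⟩ := F.split (fun k => u (φ k)) g (ENNReal.ofReal e) ENNReal.ofReal_ne_top
    (fun k => huX _) (fun k => (huE _).le) hg hgw hga
  obtain ⟨-, χ, hχ, hNs⟩ := exists_subseq_homSobolev hd hs.le hs1
    (f := fun k => u (φ (ψ k))) (fun k => (F.subset (huX _)).2) (M := ENNReal.ofReal n)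
    ENNReal.ofReal_ne_top (fun k => (huN _).le) hg.2.1
    (fun θ => (hgw θ).comp hψ.tendsto_atTop)
  set v : ℕ → 𝔼 → ℂ := fun k => u (φ (ψ (χ k))) with hv
  have hτ : Tendsto (fun k => φ (ψ (χ k))) atTop atTop :=
    hφ.tendsto_atTop.comp (hψ.tendsto_atTop.comp hχ.tendsto_atTop)
  have hva : ∀ᵐ x, Tendsto (fun k => v k x) atTop (𝓝 (g x)) := by
    filter_upwards [hga] with x hx
    exact hx.comp (hψ.tendsto_atTop.comp hχ.tendsto_atTop)
  obtain ⟨K, hK, hKE⟩ := F.exists_gagliardoNirenberg P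
  have hvM (k : ℕ) : eLpNorm (v k) (ENNReal.ofReal (α + 2)) volume ≤
      (ENNReal.ofReal K * (ENNReal.ofReal e ^ α * ENNReal.ofReal n ^ 2)) ^ (1 / (α + 2)) := by
    rw [one_div, ENNReal.le_rpow_inv_iff (by linarith)]
    have := hKE _ (huX (φ (ψ (χ k))))
    rwa [huE, huN] at this
  have hJs := brezis_lieb (p := α + 2) (by linarith) (fun k => F.memLp P (huX (φ (ψ (χ k)))))
    (F.memLp P hgX) (ENNReal.rpow_ne_top_of_nonneg (by positivity) (ENNReal.mul_ne_top
      ENNReal.ofReal_ne_top (ENNReal.mul_ne_top (ENNReal.rpow_ne_top_of_nonneg hα.le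
        ENNReal.ofReal_ne_top) (ENNReal.pow_ne_top ENNReal.ofReal_ne_top)))) hvM hva
  have hdX (k : ℕ) : (fun x => v k x - g x) ∈ X := F.sub_mem _ (huX _) _ hgX
  -- limits of the three functionals of the remainder
  have lE : Tendsto (fun k => (E (fun x => v k x - g x)).toReal ^ q) atTop
      (𝓝 (e ^ q - (E g).toReal ^ q)) := by
    refine ((hEs.comp hχ.tendsto_atTop).const_sub (e ^ q)).congr fun k => ?_
    simp only [Function.comp_apply, huE, ENNReal.toReal_ofReal he.le, hv]
    ring
  have lN : Tendsto (fun k => (homSobolevNorm s (fun x => v k x - g x)).toReal ^ 2) atTop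
      (𝓝 (n ^ 2 - (homSobolevNorm s g).toReal ^ 2)) := by
    refine (hNs.const_sub (n ^ 2)).congr fun k => ?_
    simp only [huN, ENNReal.toReal_ofReal hn.le, hv]
    ring
  have lJ0 : Tendsto (fun k => (lebNorm (α + 2) (v k)).toReal ^ (α + 2)) atTop (𝓝 J) := by
    have h1 : Tendsto (fun k : ℕ => (1 - 1 / ((k : ℝ) + 2)) * J) atTop (𝓝 J) := by
      have h2 : Tendsto (fun k : ℕ => 1 / ((k : ℝ) + 2)) atTop (𝓝 0) :=
        tendsto_const_nhds.div_atTop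
          (tendsto_atTop_add_const_right _ _ tendsto_natCast_atTop_atTop)
      simpa using (h2.const_sub 1).mul_const J
    have h2 : Tendsto (fun k => (lebNorm (α + 2) (u k)).toReal ^ (α + 2)) atTop (𝓝 J) := by
      refine tendsto_of_tendsto_of_tendsto_of_le_of_le h1 tendsto_const_nhds
        (fun k => by rw [huJ]; exact hfJ k) fun k => ?_
      have := hle _ (huX k)
      rwa [huE, huN, ENNReal.toReal_ofReal he.le, ENNReal.toReal_ofReal hn.le] at this
    exact h2.comp hτ
  have lJ : Tendsto (fun k => (lebNorm (α + 2) (fun x => v k x - g x)).toReal ^ (α + 2)) atTop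
      (𝓝 (J - (lebNorm (α + 2) g).toReal ^ (α + 2))) := by
    refine (lJ0.sub hJs).congr fun k => ?_
    simp only [lebNorm, hv]
    ring
  obtain ⟨hgE, hgN⟩ := F.norms_pos P hgX hg0
  set a := (E g).toReal ^ q with ha
  set b := (homSobolevNorm s g).toReal ^ 2 with hb
  have hpow {t : ℝ} (ht : 0 ≤ t) : (t ^ q) ^ (α / q) = t ^ α := by
    rw [← Real.rpow_mul ht]; congr 1; field_simp
  have hae : 0 ≤ e ^ q - a := ge_of_tendsto' lE fun k => by positivity
  have hbn : 0 ≤ n ^ 2 - b := ge_of_tendsto' lN fun k => by positivity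
  have hrem : J - (lebNorm (α + 2) g).toReal ^ (α + 2) ≤
      σ * ((e ^ q - a) ^ (α / q) * (n ^ 2 - b)) := by
    have h1 : Tendsto (fun k => σ * (((E (fun x => v k x - g x)).toReal ^ q) ^ (α / q) *
        (homSobolevNorm s (fun x => v k x - g x)).toReal ^ 2)) atTop
        (𝓝 (σ * ((e ^ q - a) ^ (α / q) * (n ^ 2 - b)))) :=
      ((lE.rpow_const (Or.inr (by positivity))).mul lN).const_mul σ
    refine le_of_tendsto_of_tendsto' lJ h1 fun k => ?_
    rw [hpow ENNReal.toReal_nonneg]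
    exact hle _ (hdX k)
  have hgle := hle g hgX
  rw [← hpow ENNReal.toReal_nonneg, ← ha, ← hb] at hgle
  have hsplit : (e ^ q) ^ (α / q) * n ^ 2 ≤
      a ^ (α / q) * b + (e ^ q - a) ^ (α / q) * (n ^ 2 - b) := by
    refine le_of_mul_le_mul_left ?_ hσ0
    rw [hpow he.le, ← hJ]
    linarith
  obtain ⟨h1, h2⟩ := eq_of_rpow_mul_split (by positivity) (by positivity) (sub_nonneg.1 hae)
    (by positivity) (sub_nonneg.1 hbn) hsplit
  refine ⟨g, hgX, hg0, ?_, ?_, le_antisymm ?_ ?_⟩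
  · exact (Real.rpow_left_inj hgE.le he.le hq.ne').1 h1
  · exact (pow_left_inj₀ hgN.le hn.le two_ne_zero).1 h2
  · rwa [h1, h2, hpow he.le] at hgle
  · rw [h1, h2, sub_self, sub_self, mul_zero, mul_zero] at hrem
    linarith

theorem quotient_eq (F : CriticalFunctional s α X E q) (P : Subcritical d s α) {f : 𝔼 → ℂ}
    (hf : f ∈ X) {σ e n : ℝ} (hE : (E f).toReal = e) (hN : (homSobolevNorm s f).toReal = n)
    (he : 0 < e) (hn : 0 < n) (hσ : 0 ≤ σ)
    (hJ : (lebNorm (α + 2) f).toReal ^ (α + 2) = σ * (e ^ α * n ^ 2)) :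
    lebNorm (α + 2) f ^ (α + 2) / (E f ^ α * homSobolevNorm s f ^ 2) = ENNReal.ofReal σ := by
  have hα := P.α_pos
  have h1 : lebNorm (α + 2) f ^ (α + 2) = ENNReal.ofReal (σ * (e ^ α * n ^ 2)) := by
    rw [← hJ, ENNReal.toReal_rpow, ENNReal.ofReal_toReal
      (ENNReal.rpow_ne_top_of_nonneg (by linarith) (F.lebNorm_lt_top P hf).ne)]
  have h2 : E f ^ α * homSobolevNorm s f ^ 2 = ENNReal.ofReal (e ^ α * n ^ 2) := by
    rw [← ENNReal.ofReal_toReal (F.lt_top f hf).ne, hE,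
      ← ENNReal.ofReal_toReal (homSobolevNorm_lt_top (F.subset hf).2).ne, hN,
      ENNReal.ofReal_rpow_of_pos he, ← ENNReal.ofReal_pow hn.le,
      ← ENNReal.ofReal_mul (by positivity)]
  rw [h1, h2, ENNReal.ofReal_mul hσ]
  exact ENNReal.mul_div_cancel_right (ENNReal.ofReal_pos.2 (by positivity)).ne'
    ENNReal.ofReal_ne_top

end CriticalFunctional

end Maximizer

/-! ### The Euler–Lagrange equation -/

section EulerLagrange

variable {d : ℕ}
local notation "𝔼" => EuclideanSpace ℝ (Fin d)
local notation "conj" => starRingEnd ℂ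

/-- The derivative of the `p`-th power of the `L^p` norm along a line. -/
theorem hasDerivAt_eLpNorm_rpow {X : Type*} [MeasurableSpace X] {μ : Measure X} {p : ℝ}
    (hp : 2 ≤ p) {u w : X → ℂ} (hu : MemLp u (ENNReal.ofReal p) μ)
    (hw : MemLp w (ENNReal.ofReal p) μ) :
    HasDerivAt (fun t : ℝ =>
      (eLpNorm (fun x => u x + (t : ℂ) * conj (w x)) (ENNReal.ofReal p) μ).toReal ^ p)
      (p * (∫ x, ((‖u x‖ ^ (p - 2) : ℝ) : ℂ) * u x * w x ∂μ).re) 0 := by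
  have hp0 : 0 < p := by linarith
  have hw' : MemLp (fun x => conj (w x)) (ENNReal.ofReal p) μ := hw.star
  have hut (t : ℝ) : MemLp (fun x => u x + (t : ℂ) * conj (w x)) (ENNReal.ofReal p) μ :=
    hu.add (hw'.const_mul _)
  simp_rw [fun t => toReal_eLpNorm_rpow hp0 (hut t)]
  have hM : Integrable (fun x => p * (‖u x‖ + ‖w x‖) ^ p) μ := by
    have h1 : MemLp (fun x => ((‖u x‖ + ‖w x‖ : ℝ) : ℂ)) (ENNReal.ofReal p) μ :=
      (hu.norm.add hw.norm).ofReal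
    refine ((integrable_norm_rpow_ofReal hp0 h1).const_mul p).congr (ae_of_all _ fun x => ?_)
    simp only [Complex.norm_real]
    rw [Real.norm_of_nonneg (by positivity)]
  have hpow (x : X) : (‖u x‖ + ‖w x‖) ^ (p - 2) * ((‖u x‖ + ‖w x‖) * (‖u x‖ + ‖w x‖)) =
      (‖u x‖ + ‖w x‖) ^ p := by
    rw [← pow_two, ← Real.rpow_two, ← Real.rpow_add_of_nonneg (by positivity) (by linarith)
      (by norm_num), sub_add_cancel]
  have hG : AEStronglyMeasurable (fun x => ((‖u x‖ ^ (p - 2) : ℝ) : ℂ) * u x * w x) μ := by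
    have h1 : AEStronglyMeasurable (fun x => ‖u x‖ ^ (p - 2)) μ :=
      (Real.continuous_rpow_const (by linarith)).comp_aestronglyMeasurable hu.1.norm
    exact ((Complex.continuous_ofReal.comp_aestronglyMeasurable h1).mul hu.1).mul hw.1
  have hGi : Integrable (fun x => ((‖u x‖ ^ (p - 2) : ℝ) : ℂ) * u x * w x) μ := by
    refine hM.mono' hG (ae_of_all _ fun x => ?_)
    rw [norm_mul, norm_mul, Complex.norm_real, Real.norm_of_nonneg (by positivity), ← hpow]
    calc ‖u x‖ ^ (p - 2) * ‖u x‖ * ‖w x‖ ≤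
        (‖u x‖ + ‖w x‖) ^ (p - 2) * ((‖u x‖ + ‖w x‖) * (‖u x‖ + ‖w x‖)) := by
          rw [mul_assoc]
          have := norm_nonneg (u x)
          have := norm_nonneg (w x)
          have := Real.rpow_le_rpow (norm_nonneg (u x)) (by linarith : ‖u x‖ ≤ ‖u x‖ + ‖w x‖)
            (by linarith : 0 ≤ p - 2)
          gcongr <;> linarith
      _ ≤ _ := le_mul_of_one_le_left (by positivity) (by linarith)
  have hF0 : (fun x => p * ‖u x + ((0 : ℝ) : ℂ) * conj (w x)‖ ^ (p - 2) *
      ⟪u x + ((0 : ℝ) : ℂ) * conj (w x), conj (w x)⟫) =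
      fun x => p * (((‖u x‖ ^ (p - 2) : ℝ) : ℂ) * u x * w x).re := by
    ext x
    rw [Complex.ofReal_zero, zero_mul, add_zero, mul_assoc p, mul_assoc (Complex.ofReal _),
      Complex.re_ofReal_mul, Complex.inner, ← map_mul, Complex.conj_re, mul_comm (w x)]
  have key := (hasDerivAt_integral_of_dominated_loc_of_deriv_le (𝕜 := ℝ) (μ := μ) (x₀ := 0)
    (F := fun t x => ‖u x + (t : ℂ) * conj (w x)‖ ^ p)
    (F' := fun t x => p * ‖u x + (t : ℂ) * conj (w x)‖ ^ (p - 2) *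
      ⟪u x + (t : ℂ) * conj (w x), conj (w x)⟫) (s := Metric.ball 0 1)
    (bound := fun x => p * (‖u x‖ + ‖w x‖) ^ p) (Metric.ball_mem_nhds _ one_pos)
    (Eventually.of_forall fun t => (integrable_norm_rpow_ofReal hp0 (hut t)).1)
    (integrable_norm_rpow_ofReal hp0 (hut 0)) ?_ (ae_of_all _ fun x t ht => ?_) hM
    (ae_of_all _ fun x t _ => ?_)).2
  · rw [hF0, integral_const_mul] at key
    have h1 : ∫ x, (((‖u x‖ ^ (p - 2) : ℝ) : ℂ) * u x * w x).re ∂μ =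
        (∫ x, ((‖u x‖ ^ (p - 2) : ℝ) : ℂ) * u x * w x ∂μ).re := integral_re hGi
    rwa [h1] at key
  · rw [hF0]
    exact (hGi.re.const_mul p).1
  · have ht1 : |t| < 1 := by simpa using ht
    have h1 : ‖u x + (t : ℂ) * conj (w x)‖ ≤ ‖u x‖ + ‖w x‖ := by
      refine (norm_add_le _ _).trans ?_
      rw [norm_mul, Complex.norm_real, RCLike.norm_conj, Real.norm_eq_abs]
      have := mul_le_of_le_one_left (norm_nonneg (w x)) ht1.le
      linarith
    have h2 : |⟪u x + (t : ℂ) * conj (w x), conj (w x)⟫| ≤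
        (‖u x‖ + ‖w x‖) * (‖u x‖ + ‖w x‖) := by
      refine (abs_real_inner_le_norm _ _).trans ?_
      rw [RCLike.norm_conj]
      have := norm_nonneg (u x)
      gcongr
      linarith
    rw [norm_mul, norm_mul, Real.norm_of_nonneg hp0.le, Real.norm_of_nonneg (by positivity),
      Real.norm_eq_abs, mul_assoc, ← hpow]
    have h3 := Real.rpow_le_rpow (norm_nonneg _) h1 (by linarith : 0 ≤ p - 2)
    gcongr
  · have h1 : HasDerivAt (fun t : ℝ => u x + (t : ℂ) * conj (w x)) (conj (w x)) t := by
      simpa using ((hasDerivAt_id t).ofReal_comp.mul_const (conj (w x))).const_add (u x)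
    have h2 := (hasFDerivAt_norm_rpow (u x + (t : ℂ) * conj (w x))
      (by linarith : 1 < p)).comp_hasDerivAt t h1
    exact h2

/-- Complex conjugation on Schwartz functions. -/
noncomputable def conjSchwartz (φ : 𝓢(𝔼, ℂ)) : 𝓢(𝔼, ℂ) :=
  SchwartzMap.postcompCLM (𝕜 := ℝ) Complex.conjCLE.toContinuousLinearMap φ

theorem conjSchwartz_apply (φ : 𝓢(𝔼, ℂ)) (x : 𝔼) : conjSchwartz φ x = conj (φ x) := rfl

/-- Test directions are conjugated because the equation is bilinear in `(Q, φ)` whereas the first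
variation produces the real inner product. -/
theorem fourier_conjSchwartz (φ : 𝓢(𝔼, ℂ)) (ξ : 𝔼) :
    (𝓕 (conjSchwartz φ)) ξ = conj ((𝓕⁻ φ) ξ) := by
  rw [SchwartzMap.fourier_coe, SchwartzMap.fourierInv_coe, Real.fourier_eq, Real.fourierInv_eq,
    ← integral_conj]
  refine integral_congr_ae (ae_of_all _ fun x => ?_)
  simp only [conjSchwartz_apply, Circle.smul_def, smul_eq_mul, map_mul]
  rw [AddChar.map_neg_eq_inv, Circle.coe_inv_eq_conj]

/-- The derivative of the squared `Ḣ^γ` norm is the pairing with the fractional Laplacian. -/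
theorem hasDerivAt_homSobolevNorm (hd : 1 ≤ d) {γ : ℝ} (h0 : 0 ≤ γ) (h1 : γ < 1) {f : 𝔼 → ℂ}
    (hf : f ∈ HomSobolev d γ) (φ : 𝓢(𝔼, ℂ)) :
    HasDerivAt (fun t : ℝ =>
      (homSobolevNorm γ (fun x => f x + (t : ℂ) * conj (φ x))).toReal ^ (2 : ℝ))
      (2 * (fracLaplacian γ f φ).re) 0 := by
  have hh := fourierDensity_spec hf
  have hφ := schwartz_isFourierDensity h0 (conjSchwartz φ)
  have hφT := schwartz_isTemperedFun (conjSchwartz φ)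
  have e2 : ENNReal.ofReal 2 = 2 := by simp
  have hu : MemLp (fun ξ => (symb γ ξ : ℂ) * fourierDensity γ f ξ) (ENNReal.ofReal 2) volume := by
    rw [e2]; exact hh.2.1
  have hw : MemLp (fun ξ => (symb γ ξ : ℂ) * (𝓕⁻ φ) ξ) (ENNReal.ofReal 2) volume := by
    rw [e2]; exact memLp_symb_mul_schwartz h0 _
  have key := hasDerivAt_eLpNorm_rpow le_rfl hu hw
  have e3 : ∫ ξ, ((‖(symb γ ξ : ℂ) * fourierDensity γ f ξ‖ ^ ((2 : ℝ) - 2) : ℝ) : ℂ) *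
      ((symb γ ξ : ℂ) * fourierDensity γ f ξ) * ((symb γ ξ : ℂ) * (𝓕⁻ φ) ξ) =
      fracLaplacian γ f φ := by
    unfold fracLaplacian
    congr 1; ext ξ
    rw [sub_self, Real.rpow_zero, symb_two_mul]
    push_cast
    ring
  rw [e3] at key
  convert key using 4 with t
  have hs := homSobolev_add_smul hd h0 h1 hf (g := conjSchwartz φ) ⟨hφT, _, hφ⟩ t
  simp only [conjSchwartz_apply] at hs
  have hδ := IsFourierDensity.add_smul hd h0 h1 hf.1 hφT hh hφ t
  simp only [conjSchwartz_apply] at hδ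
  rw [homSobolevNorm_eq hd h0 h1 hs hδ, e2]
  congr 1; ext ξ
  rw [fourier_conjSchwartz, map_mul, Complex.conj_ofReal]
  ring

theorem fracLaplacian_smul (γ : ℝ) (f : 𝔼 → ℂ) (c : ℂ) (φ : 𝓢(𝔼, ℂ)) :
    fracLaplacian γ f (c • φ) = c * fracLaplacian γ f φ := by
  unfold fracLaplacian
  rw [← integral_const_mul]
  congr 1; ext ξ
  rw [FourierTransform.fourierInv_smul, smul_apply, smul_eq_mul]
  ring

/-- The first variation at a maximizer, normalized so that the equation has unit coefficients. Here
`D` is the derivative of `(E Q)^q / q` in the direction `conj φ`. -/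
theorem CriticalFunctional.first_variation {s α q : ℝ} {X : Set (EuclideanSpace ℝ (Fin d) → ℂ)}
    {E : (EuclideanSpace ℝ (Fin d) → ℂ) → ℝ≥0∞} (F : CriticalFunctional s α X E q)
    (P : Subcritical d s α) {σ e n : ℝ} (he : 0 < e) (hσe : σ * e ^ α = (α + 2) / 2)
    (hne : α * n ^ 2 = 2 * e ^ q)
    (hle : ∀ f ∈ X, (lebNorm (α + 2) f).toReal ^ (α + 2) ≤
      σ * ((E f).toReal ^ α * (homSobolevNorm s f).toReal ^ 2))
    {Q : 𝔼 → ℂ} (hQ : Q ∈ X) (hE : (E Q).toReal = e) (hN : (homSobolevNorm s Q).toReal = n)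
    (hJ : (lebNorm (α + 2) Q).toReal ^ (α + 2) = σ * (e ^ α * n ^ 2)) (φ : 𝓢(𝔼, ℂ))
    (hmem : ∀ t : ℝ, (fun x => Q x + (t : ℂ) * conj (φ x)) ∈ X) {D : ℝ}
    (hD : HasDerivAt (fun t : ℝ => (E (fun x => Q x + (t : ℂ) * conj (φ x))).toReal ^ q)
      (q * D) 0) :
    (fracLaplacian s Q φ).re + D = (∫ x, ((‖Q x‖ ^ α : ℝ) : ℂ) * Q x * φ x).re := by
  have hα := P.α_pos
  have hq := F.q_pos
  have hN' := hasDerivAt_homSobolevNorm P.one_le P.s_pos.le P.s_lt (F.subset hQ).2 φ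
  have hJ' := hasDerivAt_eLpNorm_rpow (by linarith) (F.memLp P hQ)
    (φ.memLp (ENNReal.ofReal (α + 2)) volume)
  have e0 : (fun x => Q x + ((0 : ℝ) : ℂ) * conj (φ x)) = Q := by ext x; simp
  have hEq : e ^ q ≠ 0 := by positivity
  have hpos : ((E (fun x => Q x + ((0 : ℝ) : ℂ) * conj (φ x))).toReal ^ q) ≠ 0 := by
    rwa [e0, hE]
  have hder := (((hD.rpow_const (p := α / q) (Or.inl hpos)).mul hN').const_mul σ).sub hJ'
  have hmin : IsLocalMin (fun t : ℝ => σ * (((E (fun x => Q x + (t : ℂ) * conj (φ x))).toReal ^ q)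
      ^ (α / q) * (homSobolevNorm s (fun x => Q x + (t : ℂ) * conj (φ x))).toReal ^ (2 : ℝ)) -
      (lebNorm (α + 2) (fun x => Q x + (t : ℂ) * conj (φ x))).toReal ^ (α + 2)) 0 := by
    refine Eventually.of_forall fun t => ?_
    have hpow (f : 𝔼 → ℂ) : ((E f).toReal ^ q) ^ (α / q) = (E f).toReal ^ α := by
      rw [← Real.rpow_mul ENNReal.toReal_nonneg]; congr 1; field_simp
    have hpe : (e ^ q) ^ (α / q) = e ^ α := by rw [← hE, hpow]
    simp only [hpow, Real.rpow_two, e0, hE, hN, hpe]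
    have h1 := hle _ (hmem t)
    rw [hJ, sub_self]
    linarith
  have h0 := hmin.hasDerivAt_eq_zero hder
  rw [e0, hE, hN, Real.rpow_two, ← Real.rpow_mul he.le, ← Real.rpow_mul he.le,
    show q * (α / q) = α by field_simp, show q * (α / q - 1) = α - q by field_simp,
    Real.rpow_sub he, add_sub_cancel_right] at h0
  have h2 : σ * (q * D * (α / q) * (e ^ α / e ^ q) * n ^ 2) = (α + 2) * D := by
    calc _ = σ * e ^ α * (α * n ^ 2) * D / e ^ q := by field_simp
      _ = _ := by rw [hσe, hne]; field_simp
  have h3 : σ * (e ^ α * (2 * (fracLaplacian s Q φ).re)) = (α + 2) * (fracLaplacian s Q φ).re := by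
    calc _ = σ * e ^ α * 2 * (fracLaplacian s Q φ).re := by ring
      _ = _ := by rw [hσe]; ring
  have h4 : (α + 2) * ((fracLaplacian s Q φ).re + D -
      (∫ x, ((‖Q x‖ ^ α : ℝ) : ℂ) * Q x * φ x).re) = 0 := by
    rw [mul_add] at h0
    linarith
  have h5 := (mul_eq_zero.1 h4).resolve_left (by linarith)
  linarith

/-- A complex linear functional on test functions whose real part vanishes is zero. -/
theorem eq_zero_of_re_eq_zero {T : 𝓢(𝔼, ℂ) → ℂ} (hT : ∀ (c : ℂ) φ, T (c • φ) = c * T φ)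
    (h : ∀ φ, (T φ).re = 0) (φ : 𝓢(𝔼, ℂ)) : T φ = 0 := by
  refine Complex.ext (h φ) ?_
  have := h (Complex.I • φ)
  rw [hT] at this
  simpa using this

theorem integral_mul_smul_schwartz (g : 𝔼 → ℂ) (c : ℂ) (φ : 𝓢(𝔼, ℂ)) :
    ∫ x, g x * (c • φ) x = c * ∫ x, g x * φ x := by
  rw [← integral_const_mul]
  congr 1; ext x
  rw [smul_apply, smul_eq_mul]
  ring

/-- The value of `e` for which a maximizer with `E Q = e` solves the equation with unit
coefficients. -/
theorem exists_normalization {α q σ : ℝ} (hα : 0 < α) (hσ : 0 < σ) : ∃ e n : ℝ, 0 < e ∧ 0 < n ∧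
    σ * e ^ α = (α + 2) / 2 ∧ α * n ^ 2 = 2 * e ^ q ∧ σ = (α + 2) / 2 * e ^ (-α) := by
  set e : ℝ := ((α + 2) / (2 * σ)) ^ α⁻¹ with he
  have he0 : 0 < e := by positivity
  have h1 : e ^ α = (α + 2) / (2 * σ) := by
    rw [he, ← Real.rpow_mul (by positivity), inv_mul_cancel₀ hα.ne', Real.rpow_one]
  refine ⟨e, √(2 * e ^ q / α), he0, by positivity, ?_, ?_, ?_⟩
  · rw [h1]; field_simp
  · rw [Real.sq_sqrt (by positivity)]; field_simp
  · rw [Real.rpow_neg he0.le, h1]; field_simp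

end EulerLagrange

/-! ### The two sharp inequalities -/

section Sharp

variable {d : ℕ}
local notation "𝔼" => EuclideanSpace ℝ (Fin d)
local notation "conj" => starRingEnd ℂ

theorem schwartz_mem_sobolevClass {s α : ℝ} (P : Subcritical d s α) (φ : 𝓢(𝔼, ℂ)) :
    (φ : 𝔼 → ℂ) ∈ SobolevClass d s α :=
  ⟨⟨schwartz_isTemperedFun φ, _, schwartz_isFourierDensity P.crit_pos.le φ⟩,
    schwartz_isTemperedFun φ, _, schwartz_isFourierDensity P.s_pos.le φ⟩

theorem schwartz_mem_lebesgueClass {s α : ℝ} (P : Subcritical d s α) (φ : 𝓢(𝔼, ℂ)) :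
    (φ : 𝔼 → ℂ) ∈ LebesgueClass d s α :=
  ⟨φ.memLp _ volume, schwartz_isTemperedFun φ, _, schwartz_isFourierDensity P.s_pos.le φ⟩

theorem bumpSchwartz_not_ae_zero : ¬ (bumpSchwartz d : 𝔼 → ℂ) =ᵐ[volume] 0 := by
  intro h
  have h1 := (Continuous.ae_eq_iff_eq volume (bumpSchwartz d).continuous continuous_zero).1 h
  have h2 := congrFun h1 0
  rw [bumpSchwartz_apply, Pi.zero_apply, (unitBump d).one_of_mem_closedBall
    (Metric.mem_closedBall_self (unitBump d).rIn_pos.le)] at h2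
  simp at h2

/-- The norm of `Ḣ^{s_c}` on `Ḣ^{s_c} ∩ Ḣ^s`. -/
theorem criticalFunctional_sobolev {s α : ℝ} (P : Subcritical d s α) :
    CriticalFunctional s α (SobolevClass d s α) (homSobolevNorm (critSobolev d s α)) 2 := by
  have hd := P.one_le
  obtain ⟨C, hC, hS⟩ := exists_sobolev P
  refine
    { q_pos := two_pos
      subset := fun f hf => ⟨⟨hf.1.1.aestronglyMeasurable, (hS f hf.1).trans_lt
        (ENNReal.mul_lt_top ENNReal.ofReal_lt_top (homSobolevNorm_lt_top hf.1))⟩, hf.2⟩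
      exists_le := ⟨C, hC, fun f hf => hS f hf.1⟩
      lt_top := fun f hf => homSobolevNorm_lt_top hf.1
      affine_mem := fun f hf c l hl x₀ =>
        ⟨homSobolev_affine hf.1 c hl x₀, homSobolev_affine hf.2 c hl x₀⟩
      affine := fun f hf c l hl x₀ => ?_
      sub_mem := fun f hf g hg => ⟨homSobolev_sub hd P.crit_pos.le P.crit_lt_one hf.1 hg.1,
        homSobolev_sub hd P.s_pos.le P.s_lt hf.2 hg.2⟩
      split := fun f g M hM hf hfM hg hw _ => ?_
      nonempty := ⟨_, schwartz_mem_sobolevClass P _, bumpSchwartz_not_ae_zero⟩ }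
  · rw [homSobolevNorm_affine hd P.crit_pos.le P.crit_lt_one hf.1 c hl x₀,
      ← Subcritical.half_sub_crit (d := d), neg_sub]
  · obtain ⟨h1, φ, hφ, h2⟩ := exists_subseq_homSobolev hd P.crit_pos.le P.crit_lt_one
      (fun n => (hf n).1) hM hfM hg.2.1 hw
    refine ⟨⟨h1, hg.2⟩, φ, hφ, ?_⟩
    simpa only [Real.rpow_two] using h2

/-- The norm of `L^{α_c}` on `L^{α_c} ∩ Ḣ^s`. -/
theorem criticalFunctional_lebesgue {s α : ℝ} (P : Subcritical d s α) :
    CriticalFunctional s α (LebesgueClass d s α) (lebNorm (critLebesgue d s α))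
      (critLebesgue d s α) := by
  have hd := P.one_le
  have hq := P.two_lt_critLebesgue
  refine
    { q_pos := by linarith
      subset := Subset.rfl
      exists_le := ⟨1, one_pos, fun f _ => by simp⟩
      lt_top := fun f hf => hf.1.2
      affine_mem := fun f hf c l hl x₀ =>
        ⟨⟨(hf.2.1.affine c hl x₀).aestronglyMeasurable, ?_⟩, homSobolev_affine hf.2 c hl x₀⟩
      affine := fun f hf c l hl x₀ => ?_
      sub_mem := fun f hf g hg => ⟨hf.1.sub hg.1, homSobolev_sub hd P.s_pos.le P.s_lt hf.2 hg.2⟩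
      split := fun f g M hM hf hfM hg _ ha => ⟨hg, id, strictMono_id,
        brezis_lieb (by linarith) (fun n => (hf n).1) hg.1 hM hfM ha⟩
      nonempty := ⟨_, schwartz_mem_lebesgueClass P _, bumpSchwartz_not_ae_zero⟩ }
  · rw [eLpNorm_affine c hl x₀]
    exact ENNReal.mul_lt_top ENNReal.ofReal_lt_top hf.1.2
  · unfold lebNorm
    rw [eLpNorm_affine c hl x₀, ← P.div_critLebesgue, one_div, ENNReal.toReal_inv,
      ENNReal.toReal_ofReal (by linarith), neg_mul, div_eq_mul_inv]

theorem exists_sobolev_ground_state {s α : ℝ} (P : Subcritical d s α) :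
    ∃ Q : 𝔼 → ℂ, (Q ∈ SobolevClass d s α ∧ ¬ Q =ᵐ[volume] 0 ∧ quotientH s α Q = sharpA d s α) ∧
      IsSobolevSolution s α Q ∧ sharpA d s α = ENNReal.ofReal
        ((α + 2) / 2 * (homSobolevNorm (critSobolev d s α) Q).toReal ^ (-α)) := by
  have hd := P.one_le
  have hα := P.α_pos
  have F := criticalFunctional_sobolev P
  obtain ⟨σ, hσ, hS, hle, hmax⟩ := F.exists_maximizer P
  obtain ⟨e, n, he, hn, hσe, hne, hσ'⟩ := exists_normalization (q := 2) hα hσ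
  obtain ⟨Q, hQ, hQ0, hE, hN, hJ⟩ := hmax e n he hn
  have hS' : sharpA d s α = ENNReal.ofReal σ := hS
  refine ⟨Q, ⟨hQ, hQ0, ?_⟩, ⟨hQ, F.memLp P hQ, ?_⟩, by rw [hS', hE, ← hσ']⟩
  · exact F.quotient_eq P hQ hE hN he hn hσ.le hJ |>.trans hS'.symm
  · refine eq_zero_of_re_eq_zero (fun c φ => ?_) fun φ => ?_
    · rw [fracLaplacian_smul, fracLaplacian_smul,
        integral_mul_smul_schwartz (fun x => ((‖Q x‖ ^ α : ℝ) : ℂ) * Q x)]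
      ring
    · have h1 := F.first_variation P he hσe hne hle hQ hE hN hJ φ (fun t => ?_)
        (hasDerivAt_homSobolevNorm hd P.crit_pos.le P.crit_lt_one hQ.1 φ)
      · rw [Complex.sub_re, Complex.add_re, h1, sub_self]
      · have h2 := schwartz_mem_sobolevClass P (conjSchwartz φ)
        exact ⟨homSobolev_add_smul hd P.crit_pos.le P.crit_lt_one hQ.1 h2.1 t,
          homSobolev_add_smul hd P.s_pos.le P.s_lt hQ.2 h2.2 t⟩

theorem exists_lebesgue_ground_state {s α : ℝ} (P : Subcritical d s α) :
    ∃ R : 𝔼 → ℂ, (R ∈ LebesgueClass d s α ∧ ¬ R =ᵐ[volume] 0 ∧ quotientK s α R = sharpB d s α) ∧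
      IsLebesgueSolution s α R ∧ sharpB d s α = ENNReal.ofReal
        ((α + 2) / 2 * (lebNorm (critLebesgue d s α) R).toReal ^ (-α)) := by
  have hα := P.α_pos
  have hq := P.two_lt_critLebesgue
  have F := criticalFunctional_lebesgue P
  obtain ⟨σ, hσ, hS, hle, hmax⟩ := F.exists_maximizer P
  obtain ⟨e, n, he, hn, hσe, hne, hσ'⟩ := exists_normalization (q := critLebesgue d s α) hα hσ
  obtain ⟨R, hR, hR0, hE, hN, hJ⟩ := hmax e n he hn
  have hS' : sharpB d s α = ENNReal.ofReal σ := hS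
  refine ⟨R, ⟨hR, hR0, ?_⟩, ⟨hR, F.memLp P hR, ?_⟩, by rw [hS', hE, ← hσ']⟩
  · exact F.quotient_eq P hR hE hN he hn hσ.le hJ |>.trans hS'.symm
  · refine eq_zero_of_re_eq_zero (fun c φ => ?_) fun φ => ?_
    · rw [fracLaplacian_smul,
        integral_mul_smul_schwartz (fun x => ((‖R x‖ ^ α : ℝ) : ℂ) * R x),
        integral_mul_smul_schwartz
          (fun x => ((‖R x‖ ^ (critLebesgue d s α - 2) : ℝ) : ℂ) * R x)]
      ring
    · have h1 := F.first_variation P he hσe hne hle hR hE hN hJ φ (fun t => ?_)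
        (hasDerivAt_eLpNorm_rpow hq.le hR.1 (φ.memLp _ volume))
      · rw [Complex.sub_re, Complex.add_re, h1, sub_self]
      · have h2 := schwartz_mem_lebesgueClass P (conjSchwartz φ)
        exact ⟨hR.1.add (h2.1.const_mul (t : ℂ)),
          homSobolev_add_smul P.one_le P.s_pos.le P.s_lt hR.2 h2.2 t⟩

end Sharp

theorem mainTheorem4 (d : ℕ) (hd : 1 ≤ d) (s α : ℝ) (hs0 : 0 < s) (hs1 : s < 1)
    (hα1 : 4 * s / (d : ℝ) < α)
    (hα2 : 2 * s < (d : ℝ) → α < 4 * s / ((d : ℝ) - 2 * s)) :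
    (∃ U Q : EuclideanSpace ℝ (Fin d) → ℂ,
      (U ∈ SobolevClass d s α ∧ ¬ U =ᵐ[volume] 0 ∧ quotientH s α U = sharpA d s α) ∧
      IsSobolevSolution s α Q ∧
      (∃ (a : ℂ) (l : ℝ) (x₀ : EuclideanSpace ℝ (Fin d)),
        a ≠ 0 ∧ 0 < l ∧ ∀ x, U x = a * Q (l • x + x₀)) ∧
      sharpA d s α = ENNReal.ofReal
        ((α + 2) / 2 * (homSobolevNorm (critSobolev d s α) Q).toReal ^ (-α))) ∧
    (∃ V R : EuclideanSpace ℝ (Fin d) → ℂ,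
      (V ∈ LebesgueClass d s α ∧ ¬ V =ᵐ[volume] 0 ∧ quotientK s α V = sharpB d s α) ∧
      IsLebesgueSolution s α R ∧
      (∃ (b : ℂ) (m : ℝ) (y₀ : EuclideanSpace ℝ (Fin d)),
        b ≠ 0 ∧ 0 < m ∧ ∀ x, V x = b * R (m • x + y₀)) ∧
      sharpB d s α = ENNReal.ofReal
        ((α + 2) / 2 * (lebNorm (critLebesgue d s α) R).toReal ^ (-α))) := by
  have P : Subcritical d s α := ⟨hd, hs0, hs1, hα1, hα2⟩
  obtain ⟨Q, hQ, hQs, hA⟩ := exists_sobolev_ground_state P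
  obtain ⟨R, hR, hRs, hB⟩ := exists_lebesgue_ground_state P
  exact ⟨⟨Q, Q, hQ, hQs, ⟨1, 1, 0, one_ne_zero, one_pos, fun x => by simp⟩, hA⟩,
    ⟨R, R, hR, hRs, ⟨1, 1, 0, one_ne_zero, one_pos, fun x => by simp⟩, hB⟩⟩
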